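/- **Setting.** Let $d\ge 2$, $m\ge 0$, $0<T<\infty$, and let $(\mathbb T_n)$ be a refining sequence ($\mathbb T_1\subset\mathbb T_2\subset\cdots$) of finite partitions of $[0,T]$ containing $0$ and $T$, with mesh tending to $0$; $s'_n$ denotes the successor of $s$ in $\mathbb T_n$ (and $T'_n:=T$). Let $S=(S_1,\dots,S_d)$ be continuous on $[0,T]$ with $S_i\ge 0$, $S_i(0)>0$ and $S_1+\dots+S_d\ne 0$ on $[0,T]$, and let $\mu_i=S_i/(S_1+\dots+S_d)$ be the market weights. Let $U\subset\mathbb R^d$, $W\subset\mathbb R^m$ be open with $\mu(t)\in U$ for all $t\in[0,T]$, and let $A:[0,T]\to W$ be continuous and of bounded variation. Assume that for all $i,j$ and $t\in[0,T]$ the limit $\langle\mu_i,\mu_j\rangle(t)=\lim_n\sum_{s\in\mathbb T_n,\,s\le t}(\mu_i(s'_n)-\mu_i(s))(\mu_j(s'_n)-\mu_j(s))$ exists in $\mathbb R$ and is continuous in $t$. **Functionals.** $D([0,T],V)$ is the space of right-continuous $V$-valued paths with left limits in $V$, and $BV([0,T],V)$ its subset of paths of bounded variation. Write $Y^t(u)=Y(u\wedge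 t)$, and $d_\infty((X,B),(\tilde X,\tilde B))=\sup_{[0,T]}|X-\tilde X|+\sup_{[0,T]}|B-\tilde B|$. Let $F$ be a real functional on $[0,T]\times D([0,T],U)\times BV([0,T],W)$. * $F$ is *non-anticipative* if $F(t,X,B)=F(t,X^t,B^t)$. * $F$ is *continuous* if for all $(t,X,B)$ and $\varepsilon>0$ there is $\eta>0$ such that $d_\infty((X^t,B^t),(\tilde X^{\tilde t},\tilde B^{\tilde t}))+|t-\tilde t|<\eta$ implies $|F(t,X,B)-F(\tilde t,\tilde X,\tilde B)|<\varepsilon$; it is *left-continuous* if this holds with $\tilde t<t$ only. * $F$ is *boundedness-preserving* if for all compact $K\subset U$, $L\subset W$ it is bounded on $[0,T]\times D([0,T],K)\times BV([0,T],L)$. * *Horizontal derivatives* at $t>0$: $D_0F(t,X,B)=\lim_{h\downarrow0}\frac{F(t,X^{t-h},B^{t-h})-F(t-h,X^{t-h},B^{t-h})}{h}$, and $D_kF(t,X,B)$, $1\le k\le m$, is the limit as $h\downarrow 0$ of $$\frac{F(t,X^{t-h},B_1^{t-h},\dots,B_k^{t},\dots,B_m^{t-h})-F(t,X^{t-h},B^{t-h})}{B_k(t)-B_k(t-h)},$$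 meaning that the numerator equals $D_kF(t,X,B)$ times the denominator up to $o(\text{denominator})$ (so $0/0$ imposes no condition, and a non-zero numerator over a zero denominator is not allowed for small $h$); the limit for $D_k$ is required at those $(t,X,B)$ for which the paths with mixed stopping times lie in $BV([0,T],W)$ for all small $h>0$. * *Vertical derivatives*: with $X^{t,v}=X^t+v\mathbf 1_{[t,T]}$, $F$ is vertically differentiable if $v\mapsto F(t,X^{t,v},B)$ is differentiable at $v=0$ for all $(t,X,B)$; $\partial_iF(t,X,B)$ are the partial derivatives at $v=0$. $\mathbb C^{1,2}[0,T]$ is the set of non-anticipative continuous functionals $F$ for which non-anticipative horizontal derivatives $D_0F,\dots,D_mF$ exist, $F$ and all $\partial_iF$ are vertically differentiable, and $F$, $D_kF$, $\partial_iF$, $\partial_i\partial_jF$ can all be taken left-continuous and boundedness-preserving. **Integrals.** For a vector $\Theta$ of functionals, the pathwise Itô integral is $$\int_0^t\Theta(s,\mu,A)\,d\mu(s)=\lim_{n\to\infty}\sum_{s\in\mathbb T_n,\ s\le t}\Theta(s,\mu_n^{s-},A)\cdot(\mu(s'_n)-\mu(s)),$$ where $\mu_n=\mu(s'_n)$ on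 $[s,s'_n)$ and $\mu_n^{s-}$ is the path that equals $\mu_n$ on $[0,s)$ and is constant equal to $\mu(s)$ on $[s,T]$. Integrals against functions of bounded variation are Lebesgue–Stieltjes integrals. A *trading strategy* is given by a vector $\Theta$ of non-anticipative functionals such that, with $V^\Theta(t)=\sum_i\Theta_i(t,\mu,A)\mu_i(t)$, for all $t\in[0,T]$ the integral $\int_0^t\Theta\,d\mu$ exists and equals $V^\Theta(t)-V^\Theta(0)$. **Generation.** A functional $G\in\mathbb C^{1,2}[0,T]$ is *regular* for $(\mu,A)$ if the function $$\Gamma^G(t)=G(0,\mu,A)-G(t,\mu,A)+\int_0^t\sum_i\partial_iG(s,\mu,A)\,d\mu_i(s)$$ is continuous and of bounded variation on $[0,T]$. For such $G$ with $G>0$ put $K(t)=\exp\big(\int_0^t\frac{d\Gamma^G(s)}{G(s,\mu,A)}\big)$, $\eta_i=\partial_iG\cdot K$ (when evaluating along $\mu_n^{s-}$, the finite-variation function $K$ is kept fixed, as is $A$), and let the *multiplicatively generated* strategy be $\psi_i=\eta_i-Q^\eta-C(0)$, with $Q^\eta(t)=V^\eta(t)-V^\eta(0)-\int_0^t\eta\,d\mu$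 and $C(0)=\sum_i\partial_iG(0,\mu,A)\mu_i(0)-G(0,\mu,A)$. **Proposition.** Let $G:[0,T]\times D([0,T],U)\times BV([0,T],W)\to(0,\infty)$ be regular for $(\mu,A)$ and such that $1/G(\cdot,\mu,A)$ is locally bounded on $[0,T]$. Then the pathwise integrals $\int_0^t\sum_i\partial_iG\,d\mu_i$ and $\int_0^t\eta\,d\mu$, $t\in[0,T]$, exist, $1/G(\cdot,\mu,A)$ is integrable on $[0,T]$ with respect to $d\Gamma^G$, $\psi$ is a trading strategy with respect to $\mu$, and for all $t\in[0,T]$ and $i=1,\dots,d$ $$V^\psi(t)=G(t,\mu,A)\exp\Big(\int_0^t\frac{d\Gamma^G(s)}{G(s,\mu,A)}\Big)>0,$$ $$\psi_i(t)=V^\psi(t)\Big(1+\frac1{G(t,\mu,A)}\Big(\partial_iG(t,\mu,A)-\sum_{j=1}^d\mu_j(t)\,\partial_jG(t,\mu,A)\Big)\Big).$$ -/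

import Mathlib

open Set Filter Topology MeasureTheory
open scoped ENNReal Asymptotics

noncomputable section

namespace PathwiseFG

/-- Euclidean space of dimension `n`. -/
abbrev E (n : ℕ) : Type := EuclideanSpace ℝ (Fin n)

/-- Functionals `F(t, X, A)` of time and of two paths.  A path on `[0, T]` is represented by a
function on `ℝ`; only its values on `[0, T]` are ever relevant. -/
abbrev Functional (d m : ℕ) : Type := ℝ → (ℝ → E d) → (ℝ → E m) → ℝ

/-- Integrands `Θ = (Θ₁, …, Θ_d)`: vectors of functionals. -/
abbrev Integrand (d m : ℕ) : Type := ℝ → (ℝ → E d) → (ℝ → E m) → Fin d → ℝ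

/-! ### Spaces of paths -/

/-- `X ∈ D([0, T], V)`: right continuous, `V`-valued, with left limits in `V`. -/
structure IsCadlag {n : ℕ} (T : ℝ) (V : Set (E n)) (X : ℝ → E n) : Prop where
  mem : ∀ t ∈ Icc 0 T, X t ∈ V
  right : ∀ t ∈ Ico 0 T, Tendsto X (𝓝[>] t) (𝓝 (X t))
  left : ∀ t ∈ Ioc 0 T, ∃ x ∈ V, Tendsto X (𝓝[<] t) (𝓝 x)

/-- `A ∈ BV([0, T], V)`. -/
structure IsBVPath {n : ℕ} (T : ℝ) (V : Set (E n)) (A : ℝ → E n) : Prop where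
  cadlag : IsCadlag T V A
  bv : BoundedVariationOn A (Icc 0 T)

/-- `A ∈ CBV([0, T], V)`. -/
structure IsCBVPath {n : ℕ} (T : ℝ) (V : Set (E n)) (A : ℝ → E n) : Prop where
  mem : ∀ t ∈ Icc 0 T, A t ∈ V
  cont : ContinuousOn A (Icc 0 T)
  bv : BoundedVariationOn A (Icc 0 T)

/-- The path `X^t` stopped at time `t`: `X^t(u) = X(u ∧ t)` for `u ≥ 0`. -/
def stopAt {α : Type*} (t : ℝ) (X : ℝ → α) : ℝ → α := fun u => X (max 0 (min u t))

/-- The vertical perturbation `X^{t,v} = X^t + v 1_{[t, T]}`. -/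
def bump {n : ℕ} (t : ℝ) (v : E n) (X : ℝ → E n) : ℝ → E n :=
  fun u => stopAt t X u + if t ≤ u then v else 0

/-- The path with components `A_j^r` for `j ≠ k` and with `k`-th component `A_k^t`. -/
def mixedPath {n : ℕ} (k : Fin n) (r t : ℝ) (A : ℝ → E n) : ℝ → E n :=
  fun u => WithLp.toLp 2 (Function.update (stopAt r A u).ofLp k (stopAt t A u k))

/-- The distance `d_∞((X, A), (Y, B)) = sup_{[0,T]} |X - Y| + sup_{[0,T]} |A - B|`. -/
def pathDist {d m : ℕ} (T : ℝ) (X Y : ℝ → E d) (A B : ℝ → E m) : ℝ≥0∞ :=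
  (⨆ u ∈ Icc (0 : ℝ) T, edist (X u) (Y u)) + ⨆ u ∈ Icc (0 : ℝ) T, edist (A u) (B u)

/-! ### Properties of functionals on `[0, T] × D([0, T], U) × BV([0, T], W)` -/

/-- `F(t, X, A) = F(t, X^t, A^t)`. -/
def NonAnticipative {d m : ℕ} {β : Type*} (T : ℝ) (U : Set (E d)) (W : Set (E m))
    (F : ℝ → (ℝ → E d) → (ℝ → E m) → β) : Prop :=
  ∀ t ∈ Icc 0 T, ∀ X A, IsCadlag T U X → IsBVPath T W A → F t X A = F t (stopAt t X) (stopAt t A)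

/-- Continuity of a functional, jointly in time and in the stopped paths. -/
def ContinuousFunctional {d m : ℕ} (T : ℝ) (U : Set (E d)) (W : Set (E m))
    (F : Functional d m) : Prop :=
  ∀ t ∈ Icc 0 T, ∀ X A, IsCadlag T U X → IsBVPath T W A → ∀ ε > 0, ∃ η > 0,
    ∀ t' ∈ Icc 0 T, ∀ X' A', IsCadlag T U X' → IsBVPath T W A' →
      pathDist T (stopAt t X) (stopAt t' X') (stopAt t A) (stopAt t' A') + ENNReal.ofReal |t - t'|
        < ENNReal.ofReal η → |F t X A - F t' X' A'| < ε

/-- Left-continuity: as above, but only times `t' < t` are compared with `t`. -/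
def LeftContinuous {d m : ℕ} (T : ℝ) (U : Set (E d)) (W : Set (E m))
    (F : Functional d m) : Prop :=
  ∀ t ∈ Icc 0 T, ∀ X A, IsCadlag T U X → IsBVPath T W A → ∀ ε > 0, ∃ η > 0,
    ∀ t' ∈ Ico 0 t, ∀ X' A', IsCadlag T U X' → IsBVPath T W A' →
      pathDist T (stopAt t X) (stopAt t' X') (stopAt t A) (stopAt t' A') + ENNReal.ofReal (t - t')
        < ENNReal.ofReal η → |F t X A - F t' X' A'| < ε

/-- Boundedness on paths with values in given compact sets. -/
def BoundednessPreserving {d m : ℕ} (T : ℝ) (U : Set (E d)) (W : Set (E m))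
    (F : Functional d m) : Prop :=
  ∀ K ⊆ U, IsCompact K → ∀ L ⊆ W, IsCompact L → ∃ C : ℝ,
    ∀ t ∈ Icc 0 T, ∀ X A, IsCadlag T K X → IsBVPath T L A → |F t X A| ≤ C

/-- `D₀` is the horizontal derivative of `F` with respect to time (left-hand limits). -/
def HasTimeDeriv {d m : ℕ} (T : ℝ) (U : Set (E d)) (W : Set (E m))
    (F D₀ : Functional d m) : Prop :=
  ∀ t ∈ Ioc 0 T, ∀ X A, IsCadlag T U X → IsBVPath T W A →
    Tendsto (fun h => (F t (stopAt (t - h) X) (stopAt (t - h) A)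
      - F (t - h) (stopAt (t - h) X) (stopAt (t - h) A)) / h) (𝓝[>] 0) (𝓝 (D₀ t X A))

/-- `Dk` is the horizontal derivative of `F` with respect to `A_k`: the quotient of
`F(t, X^{t-h}, A_1^{t-h}, …, A_k^t, …, A_m^{t-h}) - F(t, X^{t-h}, A^{t-h})` and
`A_k(t) - A_k(t-h)` tends to `Dk(t, X, A)` as `h ↓ 0`.  Written without division, so that a
quotient `0 / 0` imposes no condition and a quotient `x / 0` with `x ≠ 0` is excluded.  Only paths
`A` are considered for which the paths with mixed stopping times belong to the domain of `F`
(all `A` that are continuous at `t`, and all `A` if `W` is a box). -/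
def HasHorizontalDeriv {d m : ℕ} (T : ℝ) (U : Set (E d)) (W : Set (E m))
    (k : Fin m) (F Dk : Functional d m) : Prop :=
  ∀ t ∈ Ioc 0 T, ∀ X A, IsCadlag T U X → IsBVPath T W A →
    (∀ᶠ h in 𝓝[>] (0 : ℝ), IsBVPath T W (mixedPath k (t - h) t A)) →
    (fun h => F t (stopAt (t - h) X) (mixedPath k (t - h) t A)
        - F t (stopAt (t - h) X) (stopAt (t - h) A) - Dk t X A * (A t k - A (t - h) k))
      =o[𝓝[>] 0] fun h => A t k - A (t - h) k

/-- Vertical differentiability: `v ↦ F(t, X^{t,v}, A)` is differentiable at `0`. -/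
def VerticallyDifferentiable {d m : ℕ} (T : ℝ) (U : Set (E d)) (W : Set (E m))
    (F : Functional d m) : Prop :=
  ∀ t ∈ Icc 0 T, ∀ X A, IsCadlag T U X → IsBVPath T W A →
    DifferentiableAt ℝ (fun v : E d => F t (bump t v X) A) 0

/-- The vertical partial derivative `∂_i F`. -/
def vderiv {d m : ℕ} (i : Fin d) (F : Functional d m) : Functional d m :=
  fun t X A => deriv (fun θ : ℝ => F t (bump t (EuclideanSpace.single i θ) X) A) 0

/-- The vertical derivative `∇_X F`. -/
def vgrad {d m : ℕ} (F : Functional d m) : Integrand d m := fun t X A i => vderiv i F t X A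

/-- A functional that is left-continuous and boundedness-preserving. -/
structure IsTame {d m : ℕ} (T : ℝ) (U : Set (E d)) (W : Set (E m))
    (F : Functional d m) : Prop where
  left : LeftContinuous T U W F
  bdd : BoundednessPreserving T U W F

/-- The class `ℂ^{1,2}[0, T]`: non-anticipative continuous functionals, once horizontally and
twice vertically differentiable, such that the functional and all these derivatives are
left-continuous and boundedness-preserving. -/
structure IsC12 {d m : ℕ} (T : ℝ) (U : Set (E d)) (W : Set (E m))
    (F : Functional d m) : Prop where
  nonAnticipative : NonAnticipative T U W F
  continuous : ContinuousFunctional T U W F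
  tame : IsTame T U W F
  time : ∃ D₀ : Functional d m, NonAnticipative T U W D₀ ∧ HasTimeDeriv T U W F D₀ ∧
    IsTame T U W D₀
  horizontal : ∀ k : Fin m, ∃ Dk : Functional d m, NonAnticipative T U W Dk ∧
    HasHorizontalDeriv T U W k F Dk ∧ IsTame T U W Dk
  vertical : VerticallyDifferentiable T U W F
  vertical_tame : ∀ i, IsTame T U W (vderiv i F)
  vertical₂ : ∀ j, VerticallyDifferentiable T U W (vderiv j F)
  vertical₂_tame : ∀ i j, IsTame T U W (vderiv i (vderiv j F))

/-! ### Partitions, covariations and the pathwise Itô integral -/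

/-- The successor of `u` in the finite set `P` (`u` itself if there is none). -/
def succIn (P : Finset ℝ) (u : ℝ) : ℝ :=
  if h : (P.filter fun v => u < v).Nonempty then (P.filter fun v => u < v).min' h else u

/-- A refining sequence of partitions of `[0, T]` whose mesh tends to zero. -/
structure IsRefiningSeq (T : ℝ) (P : ℕ → Finset ℝ) : Prop where
  subset : ∀ n, ∀ s ∈ P n, s ∈ Icc 0 T
  zero_mem : ∀ n, 0 ∈ P n
  end_mem : ∀ n, T ∈ P n
  mono : Monotone P
  mesh : ∀ ε > 0, ∀ᶠ n in atTop, ∀ s ∈ P n, succIn (P n) s - s < ε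

/-- `X` admits continuous covariations `⟨X_i, X_j⟩` along the sequence `P` of partitions. -/
def HasContinuousCovariations {d : ℕ} (T : ℝ) (P : ℕ → Finset ℝ) (X : ℝ → E d) : Prop :=
  ∀ i j : Fin d, ∃ c : ℝ → ℝ, ContinuousOn c (Icc 0 T) ∧ ∀ t ∈ Icc 0 T,
    Tendsto (fun n => ∑ s ∈ (P n).filter (· ≤ t),
      (X (succIn (P n) s) i - X s i) * (X (succIn (P n) s) j - X s j)) atTop (𝓝 (c t))

/-- For `s ∈ P`, the left limit `X_P^{s-} = lim_{r ↑ s} (X_P)^r` of stopped paths, where `X_P` is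
the step path with value `X(u')` on `[u, u')`, for `u ∈ P` with successor `u'`.  On `[0, s)` it
is `X_P`, on `[s, T]` it has the constant value `X_P(s-) = X(s)`. -/
def stepBefore {n : ℕ} (P : Finset ℝ) (X : ℝ → E n) (s : ℝ) : ℝ → E n :=
  fun u => if u < s then X (succIn P u) else X s

/-- The sum `∑_{s ∈ P, s ≤ t} Θ(s, X_P^{s-}, A) · (X(s') - X(s))`. -/
def itoSum {d m : ℕ} (P : Finset ℝ) (Θ : Integrand d m) (X : ℝ → E d) (A : ℝ → E m)
    (t : ℝ) : ℝ :=
  ∑ s ∈ P.filter (· ≤ t), ∑ i, Θ s (stepBefore P X s) A i * (X (succIn P s) i - X s i)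

/-- The pathwise Itô integral `∫_0^t Θ(s, X, A) dX(s)` along `P` exists and equals `I`. -/
def HasItoIntegral {d m : ℕ} (P : ℕ → Finset ℝ) (Θ : Integrand d m) (X : ℝ → E d)
    (A : ℝ → E m) (t I : ℝ) : Prop :=
  Tendsto (fun n => itoSum (P n) Θ X A t) atTop (𝓝 I)

/-- The pathwise Itô integral `∫_0^t Θ(s, X, A) dX(s)` along `P`. -/
def itoIntegral {d m : ℕ} (P : ℕ → Finset ℝ) (Θ : Integrand d m) (X : ℝ → E d)
    (A : ℝ → E m) (t : ℝ) : ℝ :=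
  limUnder atTop fun n => itoSum (P n) Θ X A t

/-! ### Trading strategies and regular functionals -/

/-- The value process `V(t) = ∑_i Θ_i(t, X, A) X_i(t)`. -/
def value {d m : ℕ} (Θ : Integrand d m) (X : ℝ → E d) (A : ℝ → E m) (t : ℝ) : ℝ :=
  ∑ i, Θ t X A i * X t i

/-- `Θ(·, X, A)` is a trading strategy with respect to `X`: `Θ` is non-anticipative, its integral
with respect to `X` exists, and it is self-financed. -/
structure IsTradingStrategy {d m : ℕ} (T : ℝ) (U : Set (E d)) (W : Set (E m))
    (P : ℕ → Finset ℝ) (Θ : Integrand d m) (X : ℝ → E d) (A : ℝ → E m) : Prop where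
  nonAnticipative : NonAnticipative T U W Θ
  selfFinanced : ∀ t ∈ Icc 0 T, HasItoIntegral P Θ X A t (value Θ X A t - value Θ X A 0)

/-- `Γ^G(t) = G(0, X, A) - G(t, X, A) + ∫_0^t ∑_i ∂_i G(s, X, A) dX_i(s)`. -/
def Gam {d m : ℕ} (P : ℕ → Finset ℝ) (G : Functional d m) (X : ℝ → E d) (A : ℝ → E m)
    (t : ℝ) : ℝ :=
  G 0 X A - G t X A + itoIntegral P (vgrad G) X A t

/-- `G` is regular for the pair `(X, A)`. -/
structure IsRegular {d m : ℕ} (T : ℝ) (U : Set (E d)) (W : Set (E m)) (P : ℕ → Finset ℝ)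
    (G : Functional d m) (X : ℝ → E d) (A : ℝ → E m) : Prop where
  c12 : IsC12 T U W G
  cont : ContinuousOn (Gam P G X A) (Icc 0 T)
  bv : BoundedVariationOn (Gam P G X A) (Icc 0 T)

/-! ### Lebesgue-Stieltjes integrals -/

/-- The extension of `g` from `[0, T]` to the line by constants has bounded variation. -/
theorem boundedVariationOn_stopAt {T : ℝ} (hT : 0 ≤ T) {g : ℝ → ℝ}
    (hg : BoundedVariationOn g (Icc 0 T)) : BoundedVariationOn (stopAt T g) univ := by
  have hmono : MonotoneOn (fun u : ℝ => max 0 (min u T)) univ := fun a _ b _ hab =>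
    max_le_max le_rfl (min_le_min hab le_rfl)
  have hmaps : MapsTo (fun u : ℝ => max 0 (min u T)) univ (Icc 0 T) := fun u _ =>
    ⟨le_max_left _ _, max_le hT (min_le_right _ _)⟩
  exact ne_top_of_le_ne_top hg (eVariationOn.comp_le_of_monotoneOn g _ hmono hmaps)

/-- `f` is integrable on `[0, T]` for the signed measure `dg` of a function `g` which has bounded
variation on `[0, T]`. -/
def StieltjesIntegrable (T : ℝ) (f g : ℝ → ℝ) : Prop :=
  ∃ hg : BoundedVariationOn (stopAt T g) univ, hg.vectorMeasure.IntegrableOn f (Icc 0 T)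

open scoped Classical in
/-- The Lebesgue-Stieltjes integral `∫_{(0, t]} f dg`, for `g` of bounded variation on `[0, T]`
and `t ∈ [0, T]`. -/
def stieltjesIntegral (T : ℝ) (f g : ℝ → ℝ) (t : ℝ) : ℝ :=
  if hg : BoundedVariationOn (stopAt T g) univ then
    VectorMeasure.integral (hg.vectorMeasure.restrict (Ioc 0 t)) f (ContinuousLinearMap.lsmul ℝ ℝ)
  else 0

/-! ### The market and multiplicative generation -/

/-- Capitalizations of `d` companies on `[0, T]`. -/
structure IsCapitalization {d : ℕ} (T : ℝ) (S : ℝ → E d) : Prop where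
  cont : ContinuousOn S (Icc 0 T)
  nonneg : ∀ t ∈ Icc 0 T, ∀ i, 0 ≤ S t i
  pos_zero : ∀ i, 0 < S 0 i
  total_ne : ∀ t ∈ Icc 0 T, ∑ i, S t i ≠ 0

/-- The market weights `μ_i = S_i / (S_1 + ⋯ + S_d)`. -/
def marketWeights {d : ℕ} (S : ℝ → E d) : ℝ → E d :=
  fun t => WithLp.toLp 2 fun i => S t i / ∑ j, S t j

/-- `f` is locally bounded on `[0, T]`. -/
def LocallyBoundedOn (T : ℝ) (f : ℝ → ℝ) : Prop :=
  ∀ t ∈ Icc 0 T, ∃ C : ℝ, ∀ᶠ s in 𝓝[Icc 0 T] t, |f s| ≤ C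

/-- `exp (∫_0^t dΓ^G(s) / G(s, X, A))`. -/
def expGam {d m : ℕ} (T : ℝ) (P : ℕ → Finset ℝ) (G : Functional d m) (X : ℝ → E d)
    (A : ℝ → E m) (t : ℝ) : ℝ :=
  Real.exp (stieltjesIntegral T (fun s => 1 / G s X A) (Gam P G X A) t)

/-- `η_i = ∂_i G × exp (∫_0^· dΓ^G / G)`.  The exponential, a function of finite variation that is
computed from the pair `(X, A)`, is kept fixed when the integrand is evaluated along approximating
paths `Y`, just like the finite-variation argument of a functional. -/
def eta {d m : ℕ} (T : ℝ) (P : ℕ → Finset ℝ) (G : Functional d m) (X : ℝ → E d)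
    (A : ℝ → E m) : Integrand d m :=
  fun t Y B i => vderiv i G t Y B * expGam T P G X A t

/-- The defect of self-financibility `Q^Θ(t) = V^Θ(t) - V^Θ(0) - ∫_0^t Θ dX`. -/
def defectSF {d m : ℕ} (P : ℕ → Finset ℝ) (Θ : Integrand d m) (X : ℝ → E d) (A : ℝ → E m)
    (t : ℝ) : ℝ :=
  value Θ X A t - value Θ X A 0 - itoIntegral P Θ X A t

/-- The defect of balance `C(0) = ∑_i ∂_i G(0, X, A) X_i(0) - G(0, X, A)`. -/
def defectBalance {d m : ℕ} (G : Functional d m) (X : ℝ → E d) (A : ℝ → E m) : ℝ :=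
  ∑ i, vderiv i G 0 X A * X 0 i - G 0 X A

/-- The strategy `ψ_i = η_i - Q^η - C(0)` multiplicatively generated by `G`. -/
def psi {d m : ℕ} (T : ℝ) (P : ℕ → Finset ℝ) (G : Functional d m) (X : ℝ → E d)
    (A : ℝ → E m) : Integrand d m :=
  fun t Y B i => eta T P G X A t Y B i - defectSF P (eta T P G X A) X A t - defectBalance G X A

end PathwiseFG

end

/-! Write `s'` for the successor of `s` in `P n`. Over `[s, s']` the increment of `G` along the step
path is its first order vertical part, whose sum is the Itô sum of `∂G`, plus a `remainder`. The
increments of `G` telescope, so the Itô integral exists as soon as the sums of the remainders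
converge, and their limit is then `-Γ`.

Convergence is obtained without writing the limit as an integral. Passing from `s` to `s'` is one
vertical jump at time `s` followed by a horizontal move. `vertical_taylor` and
`abs_horizontal_increment_le` show that, slightly to the left of a time `u`, the remainder is, up to
`ε` times a weight, a linear combination of increments of time, of `A` and of products of increments
of `X`, with coefficients frozen at `u`. The sums of these increments converge, and the sums of the
weights have a continuous limit `c`. The propagation principle `tendsto_zero_of_local` makes this
local information global: the limsup of the error is continuous, vanishes at `0`, and grows to the
left of each time by at most `ε` times the growth of `c`; hence it is at most `ε (c t - c 0)` for
every `ε`. Applied to differences of two partitions, this gives the Cauchy property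
(`IsWeight.exists_tendsto_psum`). Only left neighbourhoods are used, which is why left-continuous
derivatives suffice.

Horizontal derivatives move one component of `A` at a time, so `A` is replaced on `[s, s']` by
staircases whose components jump at different instants. Each jump changes the functional by exactly
`D k` times the jump, and time increments obey a mean value inequality. The staircases converge
uniformly to `A`, and continuity of the functional gives the estimate for `A` itself.

The exponential `K` satisfies `G dK = K dΓ` up to errors that are negligible when summed. The
discrete product rule then writes the Itô sum of `η` as a telescoping sum of increments of `K G`
minus three vanishing sums, so `∫ η dμ = G K - G(0)` (`hasItoIntegral_eta`). Hence `Q^η + C(0) = V^η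
- G K`. Since the market weights sum to one, subtracting this number from all components of `η`
lowers the value to `G K` and leaves every Itô sum unchanged. This is self-financing, and the
formula for `ψ_i` is algebra. -/

noncomputable section

namespace PathwiseFG

/-! ### A propagation principle -/

/-- If `g` is continuous and every `u > 0` has points `r < u` close by with `g u ≤ g r`, then
`g ≤ g 0`. -/
theorem le_of_locally_le_left {T : ℝ} {g : ℝ → ℝ} (hg : ContinuousOn g (Icc 0 T))
    (h : ∀ u ∈ Ioc 0 T, ∃ r ∈ Ico 0 u, g u ≤ g r) {t : ℝ} (ht : t ∈ Icc 0 T) : g t ≤ g 0 := by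
  by_contra! hlt
  have hsub : Icc 0 t ⊆ Icc 0 T := Icc_subset_Icc_right ht.2
  have hcpt : IsCompact (Icc 0 t ∩ g ⁻¹' Ici (g t)) :=
    isCompact_Icc.of_isClosed_subset
      ((hg.mono hsub).preimage_isClosed_of_isClosed isClosed_Icc isClosed_Ici) inter_subset_left
  -- `τ` is the first time at which `g` is at least `g t`; the point `r < τ` supplied by `h` would
  -- be an earlier one.
  obtain ⟨τ, ⟨hτ, hgτ⟩, hmin⟩ := hcpt.exists_isLeast ⟨t, ⟨ht.1, le_rfl⟩, by simp⟩
  have hτ0 : 0 < τ := by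
    rcases hτ.1.eq_or_lt with h0 | h0
    · subst h0
      exact absurd hgτ (not_le.2 hlt)
    · exact h0
  obtain ⟨r, hr, hgr⟩ := h τ ⟨hτ0, hτ.2.trans ht.2⟩
  have : τ ≤ r := hmin ⟨⟨hr.1, hr.2.le.trans hτ.2⟩, le_trans hgτ hgr⟩
  exact absurd hr.2 (not_lt.2 this)

/-- A family of functions of time that vanishes asymptotically at time `0`, whose increments are
asymptotically dominated by those of a continuous function `c`, and whose increments are near each
time, from the left, asymptotically an arbitrarily small fraction of those of `c`, vanishes
asymptotically. -/
theorem tendsto_zero_of_local {ι : Type*} {l : Filter ι} {T : ℝ} {c : ℝ → ℝ} {f : ι → ℝ → ℝ}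
    (hc : ContinuousOn c (Icc 0 T)) (hmono : MonotoneOn c (Icc 0 T))
    (h0 : ∀ ε > 0, ∀ᶠ i in l, |f i 0| ≤ ε)
    {B : ℝ} (h1 : ∀ r ∈ Icc 0 T, ∀ u ∈ Icc 0 T, r ≤ u → ∀ ε > 0,
      ∀ᶠ i in l, |f i u - f i r| ≤ B * (c u - c r) + ε)
    (h2 : ∀ u ∈ Ioc 0 T, ∀ ε > 0, ∃ δ > 0, ∀ r ∈ Ico 0 u, u - δ < r → ∀ ε' > 0,
      ∀ᶠ i in l, |f i u - f i r| ≤ ε * (c u - c r) + ε')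
    {t : ℝ} (ht : t ∈ Icc 0 T) : Tendsto (fun i => f i t) l (𝓝 0) := by
  have hB : ∃ B', 0 ≤ B' ∧ B ≤ B' := ⟨max B 0, le_max_right _ _, le_max_left _ _⟩
  obtain ⟨B', hB'0, hBB'⟩ := hB
  replace h1 : ∀ r ∈ Icc 0 T, ∀ u ∈ Icc 0 T, r ≤ u → ∀ ε > 0,
      ∀ᶠ i in l, |f i u - f i r| ≤ B' * (c u - c r) + ε := by
    intro r hr u hu hru ε hε
    filter_upwards [h1 r hr u hu hru ε hε] with i hi
    have := mul_le_mul_of_nonneg_right hBB' (sub_nonneg.2 (hmono hr hu hru))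
    linarith
  have h0T : (0 : ℝ) ∈ Icc 0 T := ⟨le_rfl, ht.1.trans ht.2⟩
  -- `φ t` is the limsup of `|f i t|` along `l`, written as an infimum of nonnegative eventual
  -- bounds, so that it is nonnegative even if `l` is trivial.
  let φ : ℝ → ℝ := fun t => sInf {x | 0 ≤ x ∧ ∀ᶠ i in l, |f i t| ≤ x}
  have hbdd : ∀ t, BddBelow {x | 0 ≤ x ∧ ∀ᶠ i in l, |f i t| ≤ x} := fun t => ⟨0, fun x hx => hx.1⟩
  have hne : ∀ t ∈ Icc 0 T, {x | 0 ≤ x ∧ ∀ᶠ i in l, |f i t| ≤ x}.Nonempty := by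
    intro t ht
    have hct := mul_nonneg hB'0 (sub_nonneg.2 (hmono h0T ht ht.1))
    refine ⟨B' * (c t - c 0) + 2, by linarith, ?_⟩
    filter_upwards [h0 1 one_pos, h1 0 h0T t ht ht.1 1 one_pos] with i hi hi'
    have := abs_sub_abs_le_abs_sub (f i t) (f i 0)
    linarith
  have F1 : ∀ t ∈ Icc 0 T, ∀ ε > 0, ∀ᶠ i in l, |f i t| ≤ φ t + ε := by
    intro t ht ε hε
    obtain ⟨x, hx, hxlt⟩ := exists_lt_of_csInf_lt (hne t ht) (lt_add_of_pos_right (φ t) hε)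
    filter_upwards [hx.2] with i hi using hi.trans hxlt.le
  have F2 : ∀ t x, 0 ≤ x → (∀ᶠ i in l, |f i t| ≤ x) → φ t ≤ x := fun t x hx h =>
    csInf_le (hbdd t) ⟨hx, h⟩
  have F0 : ∀ t ∈ Icc 0 T, 0 ≤ φ t := fun t ht => le_csInf (hne t ht) fun x hx => hx.1
  have F3 : ∀ r ∈ Icc 0 T, ∀ u ∈ Icc 0 T, ∀ D, 0 ≤ D →
      (∀ ε > 0, ∀ᶠ i in l, |f i u - f i r| ≤ D + ε) → φ u ≤ φ r + D := by
    intro r hr u hu D hD h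
    refine le_of_forall_pos_le_add fun ε hε => ?_
    refine F2 u _ (by linarith [F0 r hr]) ?_
    filter_upwards [F1 r hr (ε / 2) (half_pos hε), h (ε / 2) (half_pos hε)] with i hi hi'
    have := abs_sub_abs_le_abs_sub (f i u) (f i r)
    linarith
  have F4 : ∀ r ∈ Icc 0 T, ∀ u ∈ Icc 0 T, r ≤ u → |φ u - φ r| ≤ B' * |c u - c r| := by
    intro r hr u hu hru
    have hD := mul_nonneg hB'0 (sub_nonneg.2 (hmono hr hu hru))
    rw [abs_of_nonneg (sub_nonneg.2 (hmono hr hu hru)), abs_sub_le_iff]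
    constructor
    · linarith [F3 r hr u hu _ hD (h1 r hr u hu hru)]
    · have := F3 u hu r hr _ hD (by simpa only [abs_sub_comm] using h1 r hr u hu hru)
      linarith
  have F5 : ∀ r ∈ Icc 0 T, ∀ u ∈ Icc 0 T, |φ u - φ r| ≤ B' * |c u - c r| := by
    intro r hr u hu
    rcases le_total r u with h | h
    · exact F4 r hr u hu h
    · rw [abs_sub_comm, abs_sub_comm (c u)]
      exact F4 u hu r hr h
  have hφc : ContinuousOn φ (Icc 0 T) := by
    intro r hr
    rw [ContinuousWithinAt, tendsto_iff_dist_tendsto_zero]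
    have hlim : Tendsto (fun u => B' * |c u - c r|) (𝓝[Icc 0 T] r) (𝓝 0) := by
      have := ((hc r hr).sub_const (c r)).abs.const_mul B'
      simpa [ContinuousWithinAt] using this
    refine squeeze_zero' (Eventually.of_forall fun _ => dist_nonneg) ?_ hlim
    filter_upwards [self_mem_nhdsWithin] with u hu
    rw [Real.dist_eq]
    exact F5 r hr u hu
  have hφ0 : φ 0 ≤ 0 :=
    le_of_forall_pos_le_add fun ε hε => by
      rw [zero_add]
      exact F2 0 ε hε.le (h0 ε hε)
  -- The principle is applied to `φ - ε c`: by `h2`, each `u` has a point `r` to its left where this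
  -- function is at least as large.
  have key : ∀ ε > 0, φ t ≤ ε * (c t - c 0) := by
    intro ε hε
    have := le_of_locally_le_left (g := fun u => φ u - ε * c u) (hφc.sub (continuousOn_const.mul hc))
      (fun u hu => ?_) ht
    · linarith
    · obtain ⟨δ, hδ, hr⟩ := h2 u hu ε hε
      have hrm : max 0 (u - δ / 2) ∈ Ico 0 u := ⟨le_max_left _ _, max_lt hu.1 (by linarith)⟩
      have hrT : max 0 (u - δ / 2) ∈ Icc 0 T := ⟨hrm.1, hrm.2.le.trans hu.2⟩
      refine ⟨_, hrm, ?_⟩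
      have huT : u ∈ Icc 0 T := ⟨hu.1.le, hu.2⟩
      have := F3 _ hrT u huT _ (mul_nonneg hε.le (sub_nonneg.2 (hmono hrT huT hrm.2.le)))
        (hr _ hrm (lt_of_lt_of_le (by linarith) (le_max_right _ _)))
      linarith
  have hφt : φ t ≤ 0 := by
    have hct := sub_nonneg.2 (hmono h0T ht ht.1)
    refine le_of_forall_pos_le_add fun ε hε => ?_
    refine (key (ε / (c t - c 0 + 1)) (by positivity)).trans ?_
    rw [zero_add, div_mul_eq_mul_div, div_le_iff₀ (by linarith)]
    nlinarith
  rw [Metric.tendsto_nhds]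
  intro ε hε
  filter_upwards [F1 t ht (ε / 2) (half_pos hε)] with i hi
  rw [Real.dist_eq, sub_zero]
  linarith

/-! ### Successors in a partition and sums over a partition -/

theorem succIn_eq_of_isLeast {P : Finset ℝ} {u p : ℝ} (hp : p ∈ P) (hu : u < p)
    (hmin : ∀ q ∈ P, u < q → p ≤ q) : succIn P u = p := by
  have hne : (P.filter fun v => u < v).Nonempty := ⟨p, Finset.mem_filter.2 ⟨hp, hu⟩⟩
  rw [succIn, dif_pos hne]
  refine le_antisymm (Finset.min'_le _ _ (Finset.mem_filter.2 ⟨hp, hu⟩)) ?_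
  refine Finset.le_min' _ _ _ fun q hq => ?_
  exact hmin q (Finset.mem_filter.1 hq).1 (Finset.mem_filter.1 hq).2

theorem succIn_eq_self {P : Finset ℝ} {u : ℝ} (h : ∀ q ∈ P, q ≤ u) : succIn P u = u := by
  rw [succIn, dif_neg]
  rintro ⟨q, hq⟩
  exact absurd (Finset.mem_filter.1 hq).2 (not_lt.2 (h q (Finset.mem_filter.1 hq).1))

theorem succIn_spec {P : Finset ℝ} {u p : ℝ} (hp : p ∈ P) (hu : u < p) :
    succIn P u ∈ P ∧ u < succIn P u ∧ ∀ q ∈ P, u < q → succIn P u ≤ q := by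
  have hne : (P.filter fun v => u < v).Nonempty := ⟨p, Finset.mem_filter.2 ⟨hp, hu⟩⟩
  have hmem := Finset.min'_mem _ hne
  rw [succIn, dif_pos hne]
  refine ⟨(Finset.mem_filter.1 hmem).1, (Finset.mem_filter.1 hmem).2, fun q hq huq => ?_⟩
  exact Finset.min'_le _ _ (Finset.mem_filter.2 ⟨hq, huq⟩)

theorem le_succIn (P : Finset ℝ) (u : ℝ) : u ≤ succIn P u := by
  by_cases h : ∃ p ∈ P, u < p
  · obtain ⟨p, hp, hu⟩ := h
    exact (succIn_spec hp hu).2.1.le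
  · push Not at h
    exact (succIn_eq_self h).ge

theorem succIn_mem {P : Finset ℝ} {u : ℝ} (hu : u ∈ P) : succIn P u ∈ P := by
  by_cases h : ∃ p ∈ P, u < p
  · obtain ⟨p, hp, hup⟩ := h
    exact (succIn_spec hp hup).1
  · push Not at h
    rwa [succIn_eq_self h]

theorem exists_last_le {P : Finset ℝ} {u q : ℝ} (hq : q ∈ P) (hqu : q ≤ u) :
    ∃ s ∈ P, s ≤ u ∧ ∀ p ∈ P, p ≤ u → p ≤ s := by
  have hne : (P.filter fun v => v ≤ u).Nonempty := ⟨q, Finset.mem_filter.2 ⟨hq, hqu⟩⟩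
  have hmem := Finset.max'_mem _ hne
  exact ⟨_, (Finset.mem_filter.1 hmem).1, (Finset.mem_filter.1 hmem).2, fun p hp hpu =>
    Finset.le_max' _ _ (Finset.mem_filter.2 ⟨hp, hpu⟩)⟩

/-- The partial sum `∑_{s ∈ P, s ≤ t} a(s)`. -/
def psum (P : Finset ℝ) (a : ℝ → ℝ) (t : ℝ) : ℝ := ∑ s ∈ P.filter (· ≤ t), a s

theorem psum_add (P : Finset ℝ) (a b : ℝ → ℝ) (t : ℝ) :
    psum P (fun s => a s + b s) t = psum P a t + psum P b t := Finset.sum_add_distrib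

theorem psum_sub (P : Finset ℝ) (a b : ℝ → ℝ) (t : ℝ) :
    psum P (fun s => a s - b s) t = psum P a t - psum P b t := Finset.sum_sub_distrib _ _

theorem psum_mul_left (P : Finset ℝ) (k : ℝ) (a : ℝ → ℝ) (t : ℝ) :
    psum P (fun s => k * a s) t = k * psum P a t := (Finset.mul_sum _ _ _).symm

theorem psum_sum {Λ : Type*} [Fintype Λ] (P : Finset ℝ) (b : Λ → ℝ → ℝ) (t : ℝ) :
    psum P (fun s => ∑ l, b l s) t = ∑ l, psum P (b l) t := Finset.sum_comm

theorem abs_psum_le {P : Finset ℝ} {a b : ℝ → ℝ} {t : ℝ} (h : ∀ s ∈ P, |a s| ≤ b s) :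
    |psum P a t| ≤ psum P b t :=
  (Finset.abs_sum_le_sum_abs _ _).trans
    (Finset.sum_le_sum fun s hs => h s (Finset.mem_filter.1 hs).1)

theorem psum_sub_psum {P : Finset ℝ} (a : ℝ → ℝ) {r u : ℝ} (hru : r ≤ u) :
    psum P a u - psum P a r = ∑ s ∈ P.filter (fun s => r < s ∧ s ≤ u), a s := by
  have : P.filter (· ≤ u) = P.filter (· ≤ r) ∪ P.filter (fun s => r < s ∧ s ≤ u) := by
    ext s
    simp only [Finset.mem_filter, Finset.mem_union]
    constructor
    · rintro ⟨hs, hsu⟩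
      rcases le_or_gt s r with h | h
      · exact Or.inl ⟨hs, h⟩
      · exact Or.inr ⟨hs, h, hsu⟩
    · rintro (⟨hs, h⟩ | ⟨hs, h⟩)
      · exact ⟨hs, h.trans hru⟩
      · exact ⟨hs, h.2⟩
  rw [psum, psum, this, Finset.sum_union]
  · ring
  · rw [Finset.disjoint_left]
    intro s hs hs'
    exact absurd (Finset.mem_filter.1 hs).2 (not_le.2 (Finset.mem_filter.1 hs').2.1)

/-- Telescoping sums, up to a point of the partition. -/
theorem psum_telescope_of_mem {P : Finset ℝ} (h0 : (0 : ℝ) ∈ P) (hpos : ∀ s ∈ P, 0 ≤ s)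
    (g : ℝ → ℝ) : ∀ p ∈ P, psum P (fun s => g (succIn P s) - g s) p = g (succIn P p) - g 0 := by
  -- Strong induction on the number of partition points before `p`; the step passes to the
  -- predecessor `q`, whose successor is `p`.
  suffices H : ∀ N : ℕ, ∀ p ∈ P, (P.filter (· < p)).card = N →
      psum P (fun s => g (succIn P s) - g s) p = g (succIn P p) - g 0 from
    fun p hp => H _ p hp rfl
  intro N
  induction N using Nat.strong_induction_on with
  | _ N ih =>
    intro p hp hN
    rcases (hpos p hp).eq_or_lt with h | h
    · subst h
      have : P.filter (· ≤ (0 : ℝ)) = {0} := by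
        ext s
        simp only [Finset.mem_filter, Finset.mem_singleton]
        exact ⟨fun hs => le_antisymm hs.2 (hpos s hs.1), fun hs => by subst hs; exact ⟨h0, le_rfl⟩⟩
      rw [psum, this, Finset.sum_singleton]
    · have hne : (P.filter (· < p)).Nonempty := ⟨0, Finset.mem_filter.2 ⟨h0, h⟩⟩
      obtain ⟨hq, hqp⟩ := Finset.mem_filter.1 (Finset.max'_mem _ hne)
      set q := (P.filter (· < p)).max' hne with hqdef
      have hqmax : ∀ s ∈ P, s < p → s ≤ q := fun s hs hsp =>
        Finset.le_max' _ _ (Finset.mem_filter.2 ⟨hs, hsp⟩)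
      have hsucc : succIn P q = p := by
        refine succIn_eq_of_isLeast hp hqp fun r hr hqr => ?_
        by_contra! hrp
        exact absurd (hqmax r hr hrp) (not_le.2 hqr)
      have hcard : (P.filter (· < q)).card < N := by
        rw [← hN]
        refine Finset.card_lt_card ⟨fun s hs => ?_, fun hsub => ?_⟩
        · exact Finset.mem_filter.2 ⟨(Finset.mem_filter.1 hs).1, (Finset.mem_filter.1 hs).2.trans hqp⟩
        · exact lt_irrefl q (Finset.mem_filter.1 (hsub (Finset.mem_filter.2 ⟨hq, hqp⟩))).2
      have hIH := ih _ hcard q hq rfl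
      have hstep := psum_sub_psum (P := P) (fun s => g (succIn P s) - g s) hqp.le
      have hone : P.filter (fun s => q < s ∧ s ≤ p) = {p} := by
        ext s
        simp only [Finset.mem_filter, Finset.mem_singleton]
        constructor
        · rintro ⟨hs, h1, h2⟩
          by_contra hne'
          exact absurd (hqmax s hs (lt_of_le_of_ne h2 hne')) (not_le.2 h1)
        · rintro rfl
          exact ⟨hp, hqp, le_rfl⟩
      rw [hone, Finset.sum_singleton, hIH, hsucc] at hstep
      linarith

theorem succIn_eq_succIn {P : Finset ℝ} {s t p : ℝ} (hst : s ≤ t) (hp : p ∈ P) (htp : t < p)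
    (hlast : ∀ q ∈ P, q ≤ t → q ≤ s) : succIn P s = succIn P t := by
  obtain ⟨h1, h2, h3⟩ := succIn_spec hp htp
  refine succIn_eq_of_isLeast h1 (hst.trans_lt h2) fun q hq hsq => h3 q hq ?_
  by_contra! hqt
  exact absurd (hlast q hq hqt) (not_le.2 hsq)

variable {T : ℝ} {P : ℕ → Finset ℝ}

/-! ### Refining sequences of partitions -/

namespace IsRefiningSeq

theorem succIn_le (hP : IsRefiningSeq T P) (n : ℕ) {u : ℝ} (hu : u ≤ T) : succIn (P n) u ≤ T := by
  rcases hu.eq_or_lt with rfl | h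
  · exact (succIn_eq_self fun q hq => (hP.subset n q hq).2).le
  · exact (succIn_spec (hP.end_mem n) h).2.2 _ (hP.end_mem n) h

theorem succIn_mem_Icc (hP : IsRefiningSeq T P) (n : ℕ) {u : ℝ} (hu : u ∈ Icc 0 T) :
    succIn (P n) u ∈ Icc 0 T := ⟨hu.1.trans (le_succIn _ _), hP.succIn_le n hu.2⟩

theorem nonneg (hP : IsRefiningSeq T P) : 0 ≤ T := (hP.subset 0 0 (hP.zero_mem 0)).2

/-- Every time shares its successor with the last partition point before it. At `t = T` that point
is `T` itself, which is its own successor by the default value of `succIn`. -/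
theorem exists_pred (hP : IsRefiningSeq T P) (n : ℕ) {t : ℝ} (ht : t ∈ Icc 0 T) :
    ∃ s ∈ P n, s ≤ t ∧ (∀ p ∈ P n, p ≤ t → p ≤ s) ∧ succIn (P n) s = succIn (P n) t := by
  obtain ⟨s, hs, hst, hlast⟩ := exists_last_le (hP.zero_mem n) ht.1
  refine ⟨s, hs, hst, hlast, ?_⟩
  rcases ht.2.eq_or_lt with h | h
  · have : s = t := le_antisymm hst (hlast t (h ▸ hP.end_mem n) le_rfl)
    rw [this]
  · exact succIn_eq_succIn hst (hP.end_mem n) h hlast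

theorem mesh' (hP : IsRefiningSeq T P) {ε : ℝ} (hε : 0 < ε) :
    ∀ᶠ n in atTop, ∀ u ∈ Icc 0 T, succIn (P n) u - u < ε := by
  filter_upwards [hP.mesh ε hε] with n hn u hu
  obtain ⟨s, hs, hsu, -, heq⟩ := hP.exists_pred n hu
  have := hn s hs
  rw [heq] at this
  linarith

theorem tendsto_succIn (hP : IsRefiningSeq T P) {t : ℝ} (ht : t ∈ Icc 0 T) :
    Tendsto (fun n => succIn (P n) t) atTop (𝓝[Icc 0 T] t) := by
  refine tendsto_nhdsWithin_iff.2 ⟨?_, Eventually.of_forall fun n => hP.succIn_mem_Icc n ht⟩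
  rw [Metric.tendsto_nhds]
  intro ε hε
  filter_upwards [hP.mesh' hε] with n hn
  rw [Real.dist_eq, abs_of_nonneg (sub_nonneg.2 (le_succIn _ _))]
  exact hn t ht

/-- The sum overshoots `t` and ends at its successor, because the interval containing `t` is counted
in full; `tendsto_succIn` removes the overshoot in the limit. -/
theorem psum_telescope (hP : IsRefiningSeq T P) (n : ℕ) (g : ℝ → ℝ) {t : ℝ} (ht : t ∈ Icc 0 T) :
    psum (P n) (fun s => g (succIn (P n) s) - g s) t = g (succIn (P n) t) - g 0 := by
  obtain ⟨s, hs, hst, hlast, heq⟩ := hP.exists_pred n ht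
  have : (P n).filter (· ≤ t) = (P n).filter (· ≤ s) := by
    ext p
    simp only [Finset.mem_filter]
    exact ⟨fun h => ⟨h.1, hlast p h.1 h.2⟩, fun h => ⟨h.1, h.2.trans hst⟩⟩
  rw [psum, this, ← heq]
  exact psum_telescope_of_mem (hP.zero_mem n) (fun s hs => (hP.subset n s hs).1) g s hs

theorem psum_zero (hP : IsRefiningSeq T P) (n : ℕ) (a : ℝ → ℝ) : psum (P n) a 0 = a 0 := by
  have : (P n).filter (· ≤ (0 : ℝ)) = {0} := by
    ext s
    simp only [Finset.mem_filter, Finset.mem_singleton]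
    exact ⟨fun hs => le_antisymm hs.2 (hP.subset n s hs.1).1,
      fun hs => by subst hs; exact ⟨hP.zero_mem n, le_rfl⟩⟩
  rw [psum, this, Finset.sum_singleton]

/-- A continuous function oscillates little between successive points of fine partitions. -/
theorem norm_sub_succIn_le (hP : IsRefiningSeq T P) {F : Type*} [SeminormedAddCommGroup F]
    {g : ℝ → F} (hg : ContinuousOn g (Icc 0 T)) {ε : ℝ} (hε : 0 < ε) :
    ∀ᶠ n in atTop, ∀ s ∈ Icc 0 T, ∀ x ∈ Icc s (succIn (P n) s), ∀ y ∈ Icc s (succIn (P n) s),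
      ‖g x - g y‖ ≤ ε := by
  have huc := isCompact_Icc.uniformContinuousOn_of_continuous hg
  obtain ⟨δ, hδ, h⟩ := Metric.uniformContinuousOn_iff.1 huc ε hε
  filter_upwards [hP.mesh' hδ] with n hn s hs x hx y hy
  have hs' := hP.succIn_mem_Icc n hs
  rw [← dist_eq_norm]
  refine (h x ⟨hs.1.trans hx.1, hx.2.trans hs'.2⟩ y ⟨hs.1.trans hy.1, hy.2.trans hs'.2⟩ ?_).le
  rw [Real.dist_eq]
  refine lt_of_le_of_lt ?_ (hn s hs)
  rw [abs_sub_le_iff]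
  exact ⟨by linarith [hx.2, hy.1], by linarith [hy.2, hx.1]⟩

end IsRefiningSeq

/-! ### Convergence of sums over partitions -/

/-- Among the points in `(r, u]`, only `u` itself and the left end point of the one interval with `s
< u ≤ s'` qualify. These are the terms to which a local approximation strictly to the left of `u`
does not apply. -/
theorem card_filter_le_succIn (P : Finset ℝ) (r u : ℝ) :
    ((P.filter fun s => r < s ∧ s ≤ u).filter fun s => u ≤ succIn P s).card ≤ 2 := by
  have hsub : (P.filter fun s => r < s ∧ s ≤ u).filter (fun s => u ≤ succIn P s) ⊆
      (P.filter fun s => s < u ∧ u ≤ succIn P s) ∪ {u} := by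
    intro s hs
    simp only [Finset.mem_filter, Finset.mem_union, Finset.mem_singleton] at hs ⊢
    rcases hs.1.2.2.eq_or_lt with h | h
    · exact Or.inr h
    · exact Or.inl ⟨hs.1.1, h, hs.2⟩
  have hone : (P.filter fun s => s < u ∧ u ≤ succIn P s).card ≤ 1 := by
    refine Finset.card_le_one.2 fun x hx y hy => ?_
    simp only [Finset.mem_filter] at hx hy
    by_contra hne
    rcases lt_or_gt_of_ne hne with h | h
    · exact absurd (hx.2.2.trans ((succIn_spec hy.1 h).2.2 y hy.1 h)) (not_le.2 hy.2.1)
    · exact absurd (hy.2.2.trans ((succIn_spec hx.1 h).2.2 x hx.1 h)) (not_le.2 hx.2.1)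
  refine (Finset.card_le_card hsub).trans ((Finset.card_union_le _ _).trans ?_)
  rw [Finset.card_singleton]
  omega

/-- Terms whose interval ends before `u` obey the local bound; each of the at most two others is
bounded crudely by `B ε₁`. -/
theorem abs_psum_increment_le {P : Finset ℝ} {a b w : ℝ → ℝ} {B ε ε₁ r u δ : ℝ} (hB : 0 ≤ B)
    (hε : 0 ≤ ε) (hw : ∀ s ∈ P, 0 ≤ w s) (hw₁ : ∀ s ∈ P, w s ≤ ε₁)
    (hab : ∀ s ∈ P, |a s - b s| ≤ B * w s)
    (hloc : ∀ s ∈ P, u - δ < s → succIn P s < u → |a s - b s| ≤ ε * w s)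
    (hr : u - δ < r) (hru : r ≤ u) (hε₁ : 0 ≤ ε₁) :
    |(psum P a u - psum P a r) - (psum P b u - psum P b r)| ≤
      ε * (psum P w u - psum P w r) + 2 * (B * ε₁) := by
  rw [psum_sub_psum _ hru, psum_sub_psum _ hru, psum_sub_psum _ hru, ← Finset.sum_sub_distrib,
    Finset.mul_sum]
  set Q := P.filter fun s => r < s ∧ s ≤ u
  have hle : ∀ s ∈ Q, |a s - b s| ≤ ε * w s + if u ≤ succIn P s then B * ε₁ else 0 := by
    intro s hs
    have hs' := Finset.mem_filter.1 hs
    split_ifs with h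
    · have h1 := hab s hs'.1
      have h2 := mul_le_mul_of_nonneg_left (hw₁ s hs'.1) hB
      have h3 := mul_nonneg hε (hw s hs'.1)
      linarith
    · rw [add_zero]
      exact hloc s hs'.1 (hr.trans hs'.2.1) (not_le.1 h)
  refine (Finset.abs_sum_le_sum_abs _ _).trans ((Finset.sum_le_sum hle).trans ?_)
  rw [Finset.sum_add_distrib, ← Finset.sum_filter, Finset.sum_const, nsmul_eq_mul]
  gcongr
  exact_mod_cast card_filter_le_succIn P r u

/-! ### Sums dominated by weights with a continuous limit -/

section Convergence

variable {Λ : Type*} [Fintype Λ] {a w : ℕ → ℝ → ℝ} {b : Λ → ℕ → ℝ → ℝ} {c : ℝ → ℝ} {B : ℝ}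

/-- Nonnegative weights on the partitions, with vanishing maxima, whose partial sums converge to
a continuous function. -/
structure IsWeight (T : ℝ) (P : ℕ → Finset ℝ) (w : ℕ → ℝ → ℝ) (c : ℝ → ℝ) : Prop where
  nonneg : ∀ n, ∀ s ∈ P n, 0 ≤ w n s
  small : ∀ ε > 0, ∀ᶠ n in atTop, ∀ s ∈ P n, w n s ≤ ε
  cont : ContinuousOn c (Icc 0 T)
  tendsto : ∀ t ∈ Icc 0 T, Tendsto (fun n => psum (P n) (w n) t) atTop (𝓝 (c t))

theorem IsWeight.monotoneOn (hw : IsWeight T P w c) : MonotoneOn c (Icc 0 T) := by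
  intro r hr u hu hru
  refine le_of_tendsto_of_tendsto' (hw.tendsto r hr) (hw.tendsto u hu) fun n => ?_
  rw [← sub_nonneg, psum_sub_psum _ hru]
  exact Finset.sum_nonneg fun s hs => hw.nonneg n s (Finset.mem_filter.1 hs).1

/-- The summands `a` are, near each time from the left, close to linear combinations of the
summands `b`. -/
def LocallyApprox (T : ℝ) (P : ℕ → Finset ℝ) (w a : ℕ → ℝ → ℝ) (b : Λ → ℕ → ℝ → ℝ) : Prop :=
  ∀ u ∈ Ioc 0 T, ∀ ε > 0, ∃ δ > 0, ∃ κ : Λ → ℝ, ∀ᶠ n in atTop, ∀ s ∈ P n, u - δ < s →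
    succIn (P n) s < u → |a n s - ∑ l, κ l * b l n s| ≤ ε * w n s

theorem IsWeight.increment_le (hw : IsWeight T P w c)
    (ha : ∀ᶠ n in atTop, ∀ s ∈ P n, |a n s| ≤ B * w n s) :
    ∀ r ∈ Icc 0 T, ∀ u ∈ Icc 0 T, r ≤ u → ∀ ε > 0,
      ∀ᶠ n in atTop, |psum (P n) (a n) u - psum (P n) (a n) r| ≤ B * (c u - c r) + ε := by
  intro r hr u hu hru ε hε
  have hlim : Tendsto (fun n => B * (psum (P n) (w n) u - psum (P n) (w n) r)) atTop
      (𝓝 (B * (c u - c r))) := ((hw.tendsto u hu).sub (hw.tendsto r hr)).const_mul B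
  filter_upwards [ha, hlim.eventually_lt_const (lt_add_of_pos_right _ hε)] with n hn hn'
  rw [psum_sub_psum _ hru] at hn' ⊢
  refine (Finset.abs_sum_le_sum_abs _ _).trans (le_trans ?_ hn'.le)
  rw [Finset.mul_sum]
  exact Finset.sum_le_sum fun s hs => hn s (Finset.mem_filter.1 hs).1

/-- The local approximation passes from summands to partial sums, because the exceptional terms near
`u` disappear together with the maximal weight. The choice of `δ` and `κ` depends neither on `r` nor
on `n`, which allows two partitions to be compared with the same coefficients. -/
theorem IsWeight.local_increment_le (hw : IsWeight T P w c) (hB : 0 ≤ B)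
    (ha : ∀ᶠ n in atTop, ∀ s ∈ P n, |a n s| ≤ B * w n s)
    (hb : ∀ l, ∀ᶠ n in atTop, ∀ s ∈ P n, |b l n s| ≤ B * w n s)
    (hloc : LocallyApprox T P w a b) :
    ∀ u ∈ Ioc 0 T, ∀ ε > 0, ∃ δ > 0, ∃ κ : Λ → ℝ, ∀ r ∈ Ico 0 u, u - δ < r → ∀ ε' > 0,
      ∀ᶠ n in atTop, |(psum (P n) (a n) u - psum (P n) (a n) r) -
        ∑ l, κ l * (psum (P n) (b l n) u - psum (P n) (b l n) r)| ≤ ε * (c u - c r) + ε' := by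
  intro u hu ε hε
  obtain ⟨δ, hδ, κ, h⟩ := hloc u hu ε hε
  refine ⟨δ, hδ, κ, fun r hr hrδ ε' hε' => ?_⟩
  have huT : u ∈ Icc 0 T := ⟨hu.1.le, hu.2⟩
  have hrT : r ∈ Icc 0 T := ⟨hr.1, hr.2.le.trans hu.2⟩
  have hlim : Tendsto (fun n => ε * (psum (P n) (w n) u - psum (P n) (w n) r)) atTop
      (𝓝 (ε * (c u - c r))) := ((hw.tendsto u huT).sub (hw.tendsto r hrT)).const_mul ε
  set B' := B + ∑ l, |κ l| * B
  have hB' : 0 ≤ B' := by positivity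
  -- With all weights below this bound the two exceptional terms contribute at most `ε' / 2`; the
  -- other half absorbs the convergence of the weight sums.
  have hε₁ : 0 < ε' / (4 * (B' + 1)) := by positivity
  filter_upwards [h, ha, eventually_all.2 hb, hw.small _ hε₁,
    hlim.eventually_lt_const (lt_add_of_pos_right _ (half_pos hε'))] with n h ha hb hsm hlt
  have key := abs_psum_increment_le (a := a n) (b := fun s => ∑ l, κ l * b l n s) hB' hε.le
    (hw.nonneg n) hsm (fun s hs => ?_) h hrδ hr.2.le hε₁.le
  · have heq : ∀ x, psum (P n) (fun s => ∑ l, κ l * b l n s) x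
        = ∑ l, κ l * psum (P n) (b l n) x := by
      intro x
      rw [psum_sum]
      exact Finset.sum_congr rfl fun l _ => psum_mul_left _ _ _ _
    rw [heq, heq, ← Finset.sum_sub_distrib] at key
    simp only [← mul_sub] at key
    refine key.trans ?_
    have hsmall : 2 * (B' * (ε' / (4 * (B' + 1)))) ≤ ε' / 2 := by
      rw [mul_div_assoc', mul_div_assoc', div_le_div_iff₀ (by positivity) two_pos]
      nlinarith
    linarith
  · calc |a n s - ∑ l, κ l * b l n s| ≤ |a n s| + |∑ l, κ l * b l n s| := abs_sub _ _
      _ ≤ B * w n s + ∑ l, |κ l| * (B * w n s) := by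
        refine add_le_add (ha s hs) ((Finset.abs_sum_le_sum_abs _ _).trans ?_)
        refine Finset.sum_le_sum fun l _ => ?_
        rw [abs_mul]
        exact mul_le_mul_of_nonneg_left (hb l s hs) (abs_nonneg _)
      _ = B' * w n s := by
        rw [add_mul, Finset.sum_mul]
        simp only [mul_assoc]

/-- At time `0` the sum is not empty: it consists of the term `s = 0`, which is small because its
weight is. -/
theorem IsWeight.psum_zero_small (hP : IsRefiningSeq T P) (hw : IsWeight T P w c) (hB : 0 ≤ B)
    (ha : ∀ᶠ n in atTop, ∀ s ∈ P n, |a n s| ≤ B * w n s) {ε : ℝ} (hε : 0 < ε) :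
    ∀ᶠ n in atTop, |psum (P n) (a n) 0| ≤ ε := by
  have hε₁ : 0 < ε / (B + 1) := by positivity
  filter_upwards [ha, hw.small _ hε₁] with n ha hsm
  rw [hP.psum_zero]
  have h0 := hP.zero_mem n
  refine (ha 0 h0).trans ((mul_le_mul_of_nonneg_left (hsm 0 h0) hB).trans ?_)
  rw [mul_div_assoc', div_le_iff₀ (by positivity)]
  nlinarith

/-- Sums of terms that are locally combinations of terms with vanishing sums vanish. -/
theorem IsWeight.tendsto_psum_zero (hP : IsRefiningSeq T P) (hw : IsWeight T P w c) (hB : 0 ≤ B)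
    (ha : ∀ᶠ n in atTop, ∀ s ∈ P n, |a n s| ≤ B * w n s)
    (hb : ∀ l, ∀ᶠ n in atTop, ∀ s ∈ P n, |b l n s| ≤ B * w n s)
    (hloc : LocallyApprox T P w a b)
    (hlim : ∀ l, ∀ t ∈ Icc 0 T, Tendsto (fun n => psum (P n) (b l n) t) atTop (𝓝 0))
    {t : ℝ} (ht : t ∈ Icc 0 T) : Tendsto (fun n => psum (P n) (a n) t) atTop (𝓝 0) := by
  refine tendsto_zero_of_local (f := fun n t => psum (P n) (a n) t) hw.cont hw.monotoneOn
    (fun ε hε => hw.psum_zero_small hP hB ha hε) (hw.increment_le ha) (fun u hu ε hε => ?_) ht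
  obtain ⟨δ, hδ, κ, h⟩ := hw.local_increment_le hB ha hb hloc u hu ε hε
  refine ⟨δ, hδ, fun r hr hrδ ε' hε' => ?_⟩
  have hL : Tendsto (fun n => ∑ l, κ l * (psum (P n) (b l n) u - psum (P n) (b l n) r)) atTop
      (𝓝 (∑ l : Λ, κ l * (0 - 0))) :=
    tendsto_finsetSum _ fun l _ => ((hlim l u ⟨hu.1.le, hu.2⟩).sub
      (hlim l r ⟨hr.1, hr.2.le.trans hu.2⟩)).const_mul _
  simp only [sub_zero, mul_zero, Finset.sum_const_zero] at hL
  have hL' := hL.abs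
  rw [abs_zero] at hL'
  filter_upwards [h r hr hrδ (ε' / 2) (half_pos hε'),
    hL'.eventually_lt_const (half_pos hε')] with n h1 h2
  have := abs_sub_abs_le_abs_sub (psum (P n) (a n) u - psum (P n) (a n) r)
    (∑ l, κ l * (psum (P n) (b l n) u - psum (P n) (b l n) r))
  linarith

/-- Sums of terms that are locally combinations of terms with convergent sums converge. -/
theorem IsWeight.exists_tendsto_psum (hP : IsRefiningSeq T P) (hw : IsWeight T P w c) (hB : 0 ≤ B)
    (ha : ∀ᶠ n in atTop, ∀ s ∈ P n, |a n s| ≤ B * w n s)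
    (hb : ∀ l, ∀ᶠ n in atTop, ∀ s ∈ P n, |b l n s| ≤ B * w n s)
    (hloc : LocallyApprox T P w a b) {β : Λ → ℝ → ℝ}
    (hlim : ∀ l, ∀ t ∈ Icc 0 T, Tendsto (fun n => psum (P n) (b l n) t) atTop (𝓝 (β l t)))
    {t : ℝ} (ht : t ∈ Icc 0 T) : ∃ L, Tendsto (fun n => psum (P n) (a n) t) atTop (𝓝 L) := by
  -- The Cauchy property: the propagation principle is applied to differences of partial sums,
  -- indexed by pairs of partitions.
  have hf : Tendsto (fun n : ℕ × ℕ => psum (P n.1) (a n.1) t - psum (P n.2) (a n.2) t)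
      (atTop ×ˢ atTop) (𝓝 0) := by
    refine tendsto_zero_of_local (B := 2 * B)
      (f := fun (n : ℕ × ℕ) t => psum (P n.1) (a n.1) t - psum (P n.2) (a n.2) t)
      hw.cont hw.monotoneOn (fun ε hε => ?_) (fun r hr u hu hru ε hε => ?_)
      (fun u hu ε hε => ?_) ht
    · have h := hw.psum_zero_small hP hB ha (half_pos hε)
      filter_upwards [h.prod_mk h] with n hn
      have := abs_sub (psum (P n.1) (a n.1) 0) (psum (P n.2) (a n.2) 0)
      linarith [hn.1, hn.2]
    · have h := hw.increment_le ha r hr u hu hru (ε / 2) (half_pos hε)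
      filter_upwards [h.prod_mk h] with n hn
      have := abs_sub (psum (P n.1) (a n.1) u - psum (P n.1) (a n.1) r)
        (psum (P n.2) (a n.2) u - psum (P n.2) (a n.2) r)
      rw [show psum (P n.1) (a n.1) u - psum (P n.2) (a n.2) u -
        (psum (P n.1) (a n.1) r - psum (P n.2) (a n.2) r) =
        (psum (P n.1) (a n.1) u - psum (P n.1) (a n.1) r) -
        (psum (P n.2) (a n.2) u - psum (P n.2) (a n.2) r) by ring]
      linarith [hn.1, hn.2]
    -- Both partitions are approximated with the same `κ`, and the sums of the `b l` converge, so
    -- the two combinations cancel in the limit.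
    · obtain ⟨δ, hδ, κ, h⟩ := hw.local_increment_le hB ha hb hloc u hu (ε / 2) (half_pos hε)
      refine ⟨δ, hδ, fun r hr hrδ ε' hε' => ?_⟩
      have hL : Tendsto (fun n => ∑ l, κ l * (psum (P n) (b l n) u - psum (P n) (b l n) r)) atTop
          (𝓝 (∑ l : Λ, κ l * (β l u - β l r))) :=
        tendsto_finsetSum _ fun l _ => ((hlim l u ⟨hu.1.le, hu.2⟩).sub
          (hlim l r ⟨hr.1, hr.2.le.trans hu.2⟩)).const_mul _
      have hL' := (Metric.tendsto_nhds.1 hL (ε' / 4) (by linarith)).and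
        (h r hr hrδ (ε' / 4) (by linarith))
      filter_upwards [hL'.prod_mk hL'] with n hn
      obtain ⟨⟨h1, h2⟩, h3, h4⟩ := hn
      rw [Real.dist_eq] at h1 h3
      rw [abs_lt] at h1 h3
      rw [abs_le] at h2 h4 ⊢
      constructor <;> linarith [h1.1, h1.2, h2.1, h2.2, h3.1, h3.2, h4.1, h4.2]
  refine cauchySeq_tendsto_of_complete (cauchySeq_iff_tendsto_dist_atTop_0.2 ?_)
  rw [← prod_atTop_atTop_eq]
  simpa only [Real.dist_eq, abs_zero] using hf.abs

end Convergence

/-! ### Stopped, perturbed and step paths -/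

section Paths

variable {n : ℕ} {T : ℝ} {V : Set (E n)} {X Y : ℝ → E n}

theorem stopAt_apply {α : Type*} {t u : ℝ} (X : ℝ → α) (ht : 0 ≤ t) (hu : 0 ≤ u) :
    stopAt t X u = X (min u t) := by
  rw [stopAt, max_eq_right (le_min hu ht)]

theorem stopAt_of_le {α : Type*} {t u : ℝ} (X : ℝ → α) (hu : 0 ≤ u) (hut : u ≤ t) :
    stopAt t X u = X u := by
  rw [stopAt_apply X (hu.trans hut) hu, min_eq_left hut]

theorem stopAt_of_ge {α : Type*} {t u : ℝ} (X : ℝ → α) (ht : 0 ≤ t) (hut : t ≤ u) :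
    stopAt t X u = X t := by
  rw [stopAt_apply X ht (ht.trans hut), min_eq_right hut]

theorem stopAt_congr {α : Type*} {t : ℝ} {X Y : ℝ → α} (ht : 0 ≤ t) (h : EqOn X Y (Icc 0 t)) :
    stopAt t X = stopAt t Y :=
  funext fun _ => h ⟨le_max_left _ _, max_le ht (min_le_right _ _)⟩

theorem stopAt_stopAt {α : Type*} {s t : ℝ} (X : ℝ → α) (hs : 0 ≤ s) (hst : s ≤ t) :
    stopAt t (stopAt s X) = stopAt s X := by
  funext u
  change X (max 0 (min (max 0 (min u t)) s)) = X (max 0 (min u s))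
  congr 1
  rcases le_total u 0 with h | h
  · rw [min_eq_left (h.trans (hs.trans hst)), max_eq_left h, min_eq_left hs, min_eq_left (h.trans hs),
      max_eq_left h, max_self]
  · rw [max_eq_right (le_min h (hs.trans hst)), min_assoc, min_eq_right hst]

theorem bump_of_lt {t u : ℝ} (v : E n) (X : ℝ → E n) (hu : 0 ≤ u) (hut : u < t) :
    bump t v X u = X u := by
  rw [bump, if_neg (not_le.2 hut), add_zero, stopAt_of_le X hu hut.le]

theorem bump_of_ge {t u : ℝ} (v : E n) (X : ℝ → E n) (ht : 0 ≤ t) (hut : t ≤ u) :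
    bump t v X u = X t + v := by
  rw [bump, if_pos hut, stopAt_of_ge X ht hut]

theorem IsCadlag.mono {V' : Set (E n)} (hX : IsCadlag T V X) (h : V ⊆ V') : IsCadlag T V' X :=
  ⟨fun t ht => h (hX.mem t ht), hX.right, fun t ht =>
    let ⟨x, hx, hlim⟩ := hX.left t ht
    ⟨x, h hx, hlim⟩⟩

theorem IsCadlag.of_isClosed {V' : Set (E n)} (hX : IsCadlag T V' X) (hV : IsClosed V)
    (h : ∀ t ∈ Icc 0 T, X t ∈ V) : IsCadlag T V X := by
  refine ⟨h, hX.right, fun t ht => ?_⟩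
  obtain ⟨x, -, hlim⟩ := hX.left t ht
  refine ⟨x, hV.mem_of_tendsto hlim ?_, hlim⟩
  filter_upwards [Ioo_mem_nhdsLT ht.1] with u hu
  exact h u ⟨hu.1.le, hu.2.le.trans ht.2⟩

/-- A càdlàg path that is frozen at a value `c` from time `t` on is càdlàg. -/
theorem IsCadlag.glue {t : ℝ} {c : E n} (hX : IsCadlag T V X) (hc : c ∈ V)
    (h1 : ∀ u ∈ Ico 0 t, Y u = X u) (h2 : ∀ u, t ≤ u → Y u = c) : IsCadlag T V Y := by
  refine ⟨fun u hu => ?_, fun u hu => ?_, fun u hu => ?_⟩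
  · rcases lt_or_ge u t with h | h
    · rw [h1 u ⟨hu.1, h⟩]
      exact hX.mem u hu
    · rwa [h2 u h]
  · rcases lt_or_ge u t with h | h
    · rw [h1 u ⟨hu.1, h⟩]
      refine (hX.right u hu).congr' ?_
      filter_upwards [Ioo_mem_nhdsGT h] with r hr
      exact (h1 r ⟨hu.1.trans hr.1.le, hr.2⟩).symm
    · rw [h2 u h]
      refine tendsto_const_nhds.congr' ?_
      filter_upwards [self_mem_nhdsWithin] with r hr
      exact (h2 r (h.trans (le_of_lt hr))).symm
  · rcases lt_or_ge t u with h | h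
    · refine ⟨c, hc, tendsto_const_nhds.congr' ?_⟩
      filter_upwards [Ioo_mem_nhdsLT h] with r hr
      exact (h2 r hr.1.le).symm
    · obtain ⟨x, hx, hlim⟩ := hX.left u hu
      refine ⟨x, hx, hlim.congr' ?_⟩
      filter_upwards [Ioo_mem_nhdsLT hu.1] with r hr
      exact (h1 r ⟨hr.1.le, hr.2.trans_le h⟩).symm

theorem IsCadlag.bump {t : ℝ} {v : E n} (hX : IsCadlag T V X) (ht : t ∈ Icc 0 T)
    (hv : X t + v ∈ V) : IsCadlag T V (bump t v X) :=
  hX.glue hv (fun _ hu => bump_of_lt v X hu.1 hu.2) fun _ hu => bump_of_ge v X ht.1 hu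

theorem IsCadlag.stopAt {t : ℝ} (hX : IsCadlag T V X) (ht : t ∈ Icc 0 T) :
    IsCadlag T V (stopAt t X) :=
  hX.glue (hX.mem t ht) (fun _ hu => stopAt_of_le X hu.1 hu.2.le) fun _ hu => stopAt_of_ge X ht.1 hu

theorem IsBVPath.stopAt {t : ℝ} (hX : IsBVPath T V X) (ht : t ∈ Icc 0 T) :
    IsBVPath T V (stopAt t X) := by
  refine ⟨hX.cadlag.stopAt ht, ?_⟩
  refine ne_top_of_le_ne_top hX.bv (eVariationOn.comp_le_of_monotoneOn X
    (fun u => max 0 (min u t)) ?_ ?_)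
  · exact fun a _ b _ hab => max_le_max le_rfl (min_le_min hab le_rfl)
  · exact fun u _ => ⟨le_max_left _ _, (max_le ht.1 (min_le_right _ _)).trans ht.2⟩

theorem IsCadlag.of_continuousOn (hX : ContinuousOn X (Icc 0 T)) (h : ∀ t ∈ Icc 0 T, X t ∈ V) :
    IsCadlag T V X := by
  refine ⟨h, fun t ht => ?_, fun t ht => ⟨X t, h t ⟨ht.1.le, ht.2⟩, ?_⟩⟩
  · refine (hX t ⟨ht.1, ht.2.le⟩).mono_left ?_
    rw [nhdsWithin_le_iff]
    filter_upwards [Ioo_mem_nhdsGT ht.2] with r hr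
    exact ⟨ht.1.trans hr.1.le, hr.2.le⟩
  · refine (hX t ⟨ht.1.le, ht.2⟩).mono_left ?_
    rw [nhdsWithin_le_iff]
    filter_upwards [Ioo_mem_nhdsLT ht.1] with r hr
    exact ⟨hr.1.le, hr.2.le.trans ht.2⟩

theorem IsCBVPath.isBVPath (hX : IsCBVPath T V X) : IsBVPath T V X :=
  ⟨.of_continuousOn hX.cont hX.mem, hX.bv⟩

theorem eventually_succIn_eq_right {P : Finset ℝ} {u p : ℝ} (hp : p ∈ P) (hup : u < p) :
    ∀ᶠ r in 𝓝[>] u, succIn P r = succIn P u := by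
  obtain ⟨h1, h2, h3⟩ := succIn_spec hp hup
  filter_upwards [Ioo_mem_nhdsGT h2] with r hr
  exact succIn_eq_of_isLeast h1 hr.2 fun q hq hrq => h3 q hq (hr.1.trans hrq)

/-- From the left the relevant point is the smallest `q ≥ u`, which is `u` itself, not its
successor, when `u` lies in the partition. -/
theorem eventually_succIn_eq_left {P : Finset ℝ} {u p : ℝ} (hp : p ∈ P) (hup : u ≤ p) :
    ∃ q ∈ P, u ≤ q ∧ ∀ᶠ r in 𝓝[<] u, succIn P r = q := by
  have hne : (P.filter fun v => u ≤ v).Nonempty := ⟨p, Finset.mem_filter.2 ⟨hp, hup⟩⟩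
  obtain ⟨hq, huq⟩ := Finset.mem_filter.1 (Finset.min'_mem _ hne)
  refine ⟨_, hq, huq, ?_⟩
  have hfin : ∀ᶠ r in 𝓝 u, ∀ v ∈ P.filter (· < u), v < r := by
    rw [eventually_all_finset]
    exact fun v hv => lt_mem_nhds (Finset.mem_filter.1 hv).2
  filter_upwards [nhdsWithin_le_nhds hfin, self_mem_nhdsWithin] with r hr hru
  refine succIn_eq_of_isLeast hq (lt_of_lt_of_le hru huq) fun v hv hrv => ?_
  refine Finset.min'_le _ _ (Finset.mem_filter.2 ⟨hv, ?_⟩)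
  by_contra! hvu
  exact absurd hrv (not_lt.2 (hr v (Finset.mem_filter.2 ⟨hv, hvu⟩)).le)

/-- The approximating step path stopped at a time of the partition is càdlàg. -/
theorem isCadlag_stepBefore {P : ℕ → Finset ℝ} (hP : IsRefiningSeq T P) (k : ℕ)
    (hX : ∀ t ∈ Icc 0 T, X t ∈ V) {s : ℝ} (hs : s ∈ Icc 0 T) :
    IsCadlag T V (stepBefore (P k) X s) := by
  have hstep : IsCadlag T V fun u => X (succIn (P k) u) := by
    refine ⟨fun u hu => hX _ (hP.succIn_mem_Icc k hu), fun u hu => ?_, fun u hu => ?_⟩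
    · refine tendsto_const_nhds.congr' ?_
      filter_upwards [eventually_succIn_eq_right (hP.end_mem k) hu.2] with r hr
      rw [hr]
    · obtain ⟨q, hq, -, h⟩ := eventually_succIn_eq_left (hP.end_mem k) hu.2
      refine ⟨X q, hX q (hP.subset k q hq), tendsto_const_nhds.congr' ?_⟩
      filter_upwards [h] with r hr
      rw [hr]
  exact hstep.glue (hX s hs) (fun u hu => if_pos hu.2) fun u hu => if_neg (not_lt.2 hu)

end Paths

/-! ### Functionals -/

section Functionals

variable {d m : ℕ} {T : ℝ} {U : Set (E d)} {W : Set (E m)}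

theorem NonAnticipative.congr {β : Type*} {F : ℝ → (ℝ → E d) → (ℝ → E m) → β}
    (hF : NonAnticipative T U W F) {t : ℝ} (ht : t ∈ Icc 0 T) {X X' : ℝ → E d} {A A' : ℝ → E m}
    (hX : IsCadlag T U X) (hX' : IsCadlag T U X') (hA : IsBVPath T W A) (hA' : IsBVPath T W A')
    (hXX' : EqOn X X' (Icc 0 t)) (hAA' : EqOn A A' (Icc 0 t)) : F t X A = F t X' A' := by
  rw [hF t ht X A hX hA, hF t ht X' A' hX' hA', stopAt_congr ht.1 hXX', stopAt_congr ht.1 hAA']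

theorem pathDist_le {X Y : ℝ → E d} {A B : ℝ → E m} {η : ℝ}
    (h1 : ∀ u ∈ Icc 0 T, ‖X u - Y u‖ ≤ η) (h2 : ∀ u ∈ Icc 0 T, ‖A u - B u‖ ≤ η) :
    pathDist T X Y A B ≤ ENNReal.ofReal η + ENNReal.ofReal η := by
  refine add_le_add (iSup₂_le fun u hu => ?_) (iSup₂_le fun u hu => ?_)
  · rw [edist_dist, dist_eq_norm]
    exact ENNReal.ofReal_le_ofReal (h1 u hu)
  · rw [edist_dist, dist_eq_norm]
    exact ENNReal.ofReal_le_ofReal (h2 u hu)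

theorem pathDist_add_lt {X Y : ℝ → E d} {A B : ℝ → E m} {η δ : ℝ} (hη : 0 < η)
    (h1 : ∀ u ∈ Icc 0 T, ‖X u - Y u‖ ≤ η / 4) (h2 : ∀ u ∈ Icc 0 T, ‖A u - B u‖ ≤ η / 4)
    (hδ : δ ≤ η / 4) : pathDist T X Y A B + ENNReal.ofReal δ < ENNReal.ofReal η := by
  refine lt_of_le_of_lt (add_le_add (pathDist_le h1 h2) (ENNReal.ofReal_le_ofReal hδ)) ?_
  rw [← ENNReal.ofReal_add (by positivity) (by positivity),
    ← ENNReal.ofReal_add (by positivity) (by positivity), ENNReal.ofReal_lt_ofReal_iff hη]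
  linarith

/-- Left-continuity with one real radius for the time lag and both path distances. A quarter of the
original `η` serves for each of the three terms and keeps their sum strictly below `η`. -/
theorem LeftContinuous.exists_close {F : Functional d m} (hF : LeftContinuous T U W F) {t : ℝ}
    (ht : t ∈ Icc 0 T) {X : ℝ → E d} {A : ℝ → E m} (hX : IsCadlag T U X) (hA : IsBVPath T W A)
    {ε : ℝ} (hε : 0 < ε) : ∃ η > 0, ∀ t' ∈ Ico 0 t, t - t' ≤ η → ∀ X' A', IsCadlag T U X' →
      IsBVPath T W A' → (∀ u ∈ Icc 0 T, ‖stopAt t X u - stopAt t' X' u‖ ≤ η) →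
      (∀ u ∈ Icc 0 T, ‖stopAt t A u - stopAt t' A' u‖ ≤ η) → |F t X A - F t' X' A'| ≤ ε := by
  obtain ⟨η, hη, h⟩ := hF t ht X A hX hA ε hε
  exact ⟨η / 4, by positivity, fun t' ht' hδ X' A' hX' hA' h1 h2 =>
    (h t' ht' X' A' hX' hA' (pathDist_add_lt hη h1 h2 hδ)).le⟩

theorem ContinuousFunctional.exists_close {F : Functional d m} (hF : ContinuousFunctional T U W F)
    {t : ℝ} (ht : t ∈ Icc 0 T) {X : ℝ → E d} {A : ℝ → E m} (hX : IsCadlag T U X)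
    (hA : IsBVPath T W A) {ε : ℝ} (hε : 0 < ε) :
    ∃ η > 0, ∀ t' ∈ Icc 0 T, |t - t'| ≤ η → ∀ X' A', IsCadlag T U X' →
      IsBVPath T W A' → (∀ u ∈ Icc 0 T, ‖stopAt t X u - stopAt t' X' u‖ ≤ η) →
      (∀ u ∈ Icc 0 T, ‖stopAt t A u - stopAt t' A' u‖ ≤ η) → |F t X A - F t' X' A'| ≤ ε := by
  obtain ⟨η, hη, h⟩ := hF t ht X A hX hA ε hε
  exact ⟨η / 4, by positivity, fun t' ht' hδ X' A' hX' hA' h1 h2 =>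
    (h t' ht' X' A' hX' hA' (pathDist_add_lt hη h1 h2 hδ)).le⟩

theorem bump_bump {t : ℝ} (ht : 0 ≤ t) (v w : E d) (X : ℝ → E d) :
    EqOn (bump t w (bump t v X)) (bump t (v + w) X) (Icc 0 t) := by
  intro u hu
  rcases hu.2.eq_or_lt with rfl | h
  · rw [bump_of_ge _ _ ht le_rfl, bump_of_ge _ _ ht le_rfl, bump_of_ge _ _ ht le_rfl, add_assoc]
  · rw [bump_of_lt _ _ hu.1 h, bump_of_lt _ _ hu.1 h, bump_of_lt _ _ hu.1 h]

/-- Since `U` is open, small vertical perturbations stay in the domain of `F`, where bumping `X` or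
the stopped path gives the same value. -/
theorem nonAnticipative_vderiv (hU : IsOpen U) {F : Functional d m} (hF : NonAnticipative T U W F)
    (i : Fin d) : NonAnticipative T U W (vderiv i F) := by
  intro t ht X A hX hA
  refine Filter.EventuallyEq.deriv_eq ?_
  have hcont : Continuous fun θ : ℝ => X t + EuclideanSpace.single i θ := by
    have : (fun θ : ℝ => X t + EuclideanSpace.single i θ)
        = fun θ => X t + θ • EuclideanSpace.single i (1 : ℝ) := by
      funext θ
      congr 1
      ext j
      simp [PiLp.single_apply]
    rw [this]
    fun_prop
  have hev : ∀ᶠ θ in 𝓝 (0 : ℝ), X t + EuclideanSpace.single i θ ∈ U := by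
    refine hcont.continuousAt.eventually_mem (hU.mem_nhds ?_)
    have : X t + EuclideanSpace.single i (0 : ℝ) = X t := by
      ext j
      simp [PiLp.single_apply]
    rw [this]
    exact hX.mem t ht
  filter_upwards [hev] with θ hθ
  have hS : stopAt t X t = X t := stopAt_of_le X ht.1 le_rfl
  refine hF.congr ht (hX.bump ht hθ) ((hX.stopAt ht).bump ht (by rwa [hS])) hA (hA.stopAt ht) ?_ ?_
  · intro u _
    rw [bump, bump, stopAt_stopAt X ht.1 le_rfl]
  · exact fun u hu => (stopAt_of_le A hu.1 hu.2).symm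

/-- Two bumps at the same time add up. The derivative at `θ` is therefore the derivative at `0` for
the already bumped path, where vertical differentiability is assumed. -/
theorem hasDerivAt_bump (hU : IsOpen U) {F : Functional d m} (hF : NonAnticipative T U W F)
    (hv : VerticallyDifferentiable T U W F) {t : ℝ} (ht : t ∈ Icc 0 T) {X : ℝ → E d}
    {A : ℝ → E m} (hX : IsCadlag T U X) (hA : IsBVPath T W A) (D : E d) {θ : ℝ}
    (hθ : X t + θ • D ∈ U) :
    HasDerivAt (fun θ : ℝ => F t (bump t (θ • D) X) A)
      (∑ i, D i * vderiv i F t (bump t (θ • D) X) A) θ := by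
  have hY : IsCadlag T U (bump t (θ • D) X) := hX.bump ht hθ
  set Y := bump t (θ • D) X
  set g : E d → ℝ := fun v => F t (bump t v Y) A
  have hg : DifferentiableAt ℝ g 0 := hv t ht Y A hY hA
  have hpart : ∀ i, vderiv i F t Y A = fderiv ℝ g 0 (EuclideanSpace.single i 1) := by
    intro i
    have hline : HasDerivAt (fun x : ℝ => EuclideanSpace.single i x : ℝ → E d)
        (EuclideanSpace.single i 1) 0 := by
      have heq : (fun x : ℝ => EuclideanSpace.single i x : ℝ → E d)
          = fun x => x • EuclideanSpace.single i (1 : ℝ) := by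
        funext x
        ext j
        simp [PiLp.single_apply]
      rw [heq]
      simpa using (hasDerivAt_id (0 : ℝ)).smul_const (EuclideanSpace.single i (1 : ℝ) : E d)
    have h0 : (EuclideanSpace.single i (0 : ℝ) : E d) = 0 := by
      ext j
      simp [PiLp.single_apply]
    have hg' : HasFDerivAt g (fderiv ℝ g 0) (EuclideanSpace.single i (0 : ℝ)) := by
      rw [h0]
      exact hg.hasFDerivAt
    exact (hg'.comp_hasDerivAt (0 : ℝ) hline).deriv
  have hD : fderiv ℝ g 0 D = ∑ i, D i * vderiv i F t Y A := by
    have hDsum : D = ∑ i, D i • (EuclideanSpace.single i (1 : ℝ) : E d) := by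
      ext j
      simp [Pi.single_apply]
    conv_lhs => rw [hDsum]
    rw [map_sum]
    exact Finset.sum_congr rfl fun i _ => by rw [map_smul, hpart i, smul_eq_mul]
  have hline : HasDerivAt (fun x : ℝ => (x - θ) • D) D θ := by
    simpa using ((hasDerivAt_id θ).sub_const θ).smul_const D
  have hg' : HasFDerivAt g (fderiv ℝ g 0) ((θ - θ) • D) := by
    rw [sub_self, zero_smul]
    exact hg.hasFDerivAt
  have hcomp := hg'.comp_hasDerivAt θ hline
  rw [hD] at hcomp
  refine hcomp.congr_of_eventuallyEq ?_
  have hcont : Continuous fun x : ℝ => X t + x • D := by fun_prop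
  filter_upwards [hcont.continuousAt.eventually_mem (hU.mem_nhds hθ)] with x hx
  have hYt : Y t = X t + θ • D := bump_of_ge _ _ ht.1 le_rfl
  have hsum : θ • D + (x - θ) • D = x • D := by rw [← add_smul, add_sub_cancel]
  refine hF.congr ht (hX.bump ht hx) (hY.bump ht ?_) hA hA ?_ fun _ _ => rfl
  · rwa [hYt, add_assoc, hsum]
  · intro u hu
    rw [bump_bump ht.1 _ _ X hu, hsum]

/-- The mean value inequality is applied twice, to `φ' - q θ` and then to `φ - φ'(0) θ - q θ² / 2`;
no continuity of `φ''` is needed, only that it stays within `ε` of `q`. -/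
theorem abs_taylor_le {φ φ' φ'' : ℝ → ℝ} {q ε : ℝ} (hφ : ∀ θ ∈ Icc (0 : ℝ) 1, HasDerivAt φ (φ' θ) θ)
    (hφ' : ∀ θ ∈ Icc (0 : ℝ) 1, HasDerivAt φ' (φ'' θ) θ)
    (hq : ∀ θ ∈ Icc (0 : ℝ) 1, |φ'' θ - q| ≤ ε) : |φ 1 - φ 0 - φ' 0 - q / 2| ≤ ε := by
  have hε : 0 ≤ ε := (abs_nonneg _).trans (hq 0 ⟨le_rfl, zero_le_one⟩)
  have h1 : ∀ θ ∈ Icc (0 : ℝ) 1, |φ' θ - φ' 0 - q * θ| ≤ ε := by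
    intro θ hθ
    have := norm_image_sub_le_of_norm_deriv_le_segment' (f := fun x => φ' x - q * x)
      (f' := fun x => φ'' x - q) (C := ε) (a := 0) (b := 1)
      (fun x hx => by
        have hd := ((hφ' x hx).sub ((hasDerivAt_id x).const_mul q)).hasDerivWithinAt (s := Icc 0 1)
        exact hd.congr_deriv (by ring))
      (fun x hx => hq x ⟨hx.1, hx.2.le⟩) θ hθ
    rw [Real.norm_eq_abs] at this
    have h2 : ε * (θ - 0) ≤ ε := by nlinarith [hθ.1, hθ.2]
    refine le_trans (le_of_eq ?_) (this.trans h2)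
    congr 1
    ring
  have := norm_image_sub_le_of_norm_deriv_le_segment'
    (f := fun x => φ x - φ' 0 * x - q / 2 * x ^ 2) (f' := fun x => φ' x - φ' 0 - q * x)
    (C := ε) (a := 0) (b := 1)
    (fun x hx => by
      have hd := (((hφ x hx).sub ((hasDerivAt_id x).const_mul (φ' 0))).sub
        (((hasDerivAt_id x).pow 2).const_mul (q / 2))).hasDerivWithinAt (s := Icc 0 1)
      refine (hd.congr_deriv ?_)
      simp
      ring)
    (fun x hx => h1 x ⟨hx.1, hx.2.le⟩) 1 ⟨zero_le_one, le_rfl⟩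
  rw [Real.norm_eq_abs] at this
  refine le_trans (le_of_eq ?_) (this.trans (by linarith))
  congr 1
  ring

/-- Second order expansion in the vertical direction. -/
theorem vertical_taylor (hU : IsOpen U) {F : Functional d m} (hF : NonAnticipative T U W F)
    (hv : VerticallyDifferentiable T U W F)
    (hv₂ : ∀ i, VerticallyDifferentiable T U W (vderiv i F)) {t : ℝ} (ht : t ∈ Icc 0 T)
    {X : ℝ → E d} {A : ℝ → E m} (hX : IsCadlag T U X) (hA : IsBVPath T W A) (D : E d)
    (hD : ∀ θ ∈ Icc (0 : ℝ) 1, X t + θ • D ∈ U) {γ : Fin d → Fin d → ℝ} {ε : ℝ}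
    (hε : ∀ θ ∈ Icc (0 : ℝ) 1, ∀ i j,
      |vderiv j (vderiv i F) t (bump t (θ • D) X) A - γ i j| ≤ ε) :
    |F t (bump t D X) A - F t X A - ∑ i, vderiv i F t X A * D i
      - (∑ i, ∑ j, γ i j * (D i * D j)) / 2| ≤ ε * ∑ i, ∑ j, |D i * D j| := by
  have hmain := abs_taylor_le (φ := fun θ => F t (bump t (θ • D) X) A)
    (φ' := fun θ => ∑ i, D i * vderiv i F t (bump t (θ • D) X) A)
    (φ'' := fun θ => ∑ i, D i * ∑ j, D j * vderiv j (vderiv i F) t (bump t (θ • D) X) A)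
    (q := ∑ i, ∑ j, γ i j * (D i * D j)) (ε := ε * ∑ i, ∑ j, |D i * D j|)
    (fun θ hθ => hasDerivAt_bump hU hF hv ht hX hA D (hD θ hθ))
    (fun θ hθ => HasDerivAt.fun_sum fun i _ => (hasDerivAt_bump hU
      (nonAnticipative_vderiv hU hF i) (hv₂ i) ht hX hA D (hD θ hθ)).const_mul (D i))
    (fun θ hθ => by
      simp only [Finset.mul_sum]
      rw [← Finset.sum_sub_distrib]
      refine (Finset.abs_sum_le_sum_abs _ _).trans (Finset.sum_le_sum fun i _ => ?_)
      rw [← Finset.sum_sub_distrib]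
      refine (Finset.abs_sum_le_sum_abs _ _).trans (Finset.sum_le_sum fun j _ => ?_)
      rw [show D i * (D j * vderiv j (vderiv i F) t (bump t (θ • D) X) A) - γ i j * (D i * D j)
        = (vderiv j (vderiv i F) t (bump t (θ • D) X) A - γ i j) * (D i * D j) by ring, abs_mul]
      exact mul_le_mul_of_nonneg_right (hε θ hθ i j) (abs_nonneg _))
  have h0 : EqOn (bump t ((0 : ℝ) • D) X) X (Icc 0 t) := by
    intro u hu
    rcases hu.2.eq_or_lt with rfl | h
    · rw [bump_of_ge _ _ ht.1 le_rfl, zero_smul, add_zero]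
    · rw [bump_of_lt _ _ hu.1 h]
  have hb0 : IsCadlag T U (bump t ((0 : ℝ) • D) X) := hX.bump ht (hD 0 ⟨le_rfl, zero_le_one⟩)
  have e1 : F t (bump t ((0 : ℝ) • D) X) A = F t X A :=
    hF.congr ht hb0 hX hA hA h0 fun _ _ => rfl
  have e2 : ∀ i, vderiv i F t (bump t ((0 : ℝ) • D) X) A = vderiv i F t X A := fun i =>
    (nonAnticipative_vderiv hU hF i).congr ht hb0 hX hA hA h0 fun _ _ => rfl
  simp only [one_smul, e1, e2] at hmain
  simpa only [mul_comm (D _) (vderiv _ F t X A)] using hmain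

end Functionals

/-! ### Horizontal increments -/

section TimeStep

variable {d m : ℕ} {T : ℝ} {U : Set (E d)} {W : Set (E m)} {F : Functional d m}

/-- Mean value inequality in the time direction, along paths that are frozen from time `q` on. -/
theorem abs_time_increment_le (hF : NonAnticipative T U W F) (hc : ContinuousFunctional T U W F)
    {D₀ : Functional d m} (hD : HasTimeDeriv T U W F D₀) {q q' : ℝ} (hq : 0 ≤ q) (hqq' : q ≤ q')
    (hq' : q' ≤ T) {X : ℝ → E d} {C : ℝ → E m} (hX : IsCadlag T U X) (hC : IsBVPath T W C)
    (hXq : ∀ u, q ≤ u → X u = X q) (hCq : ∀ u, q ≤ u → C u = C q) {a ε : ℝ}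
    (hbd : ∀ t ∈ Ioc q q', |D₀ t X C - a| ≤ ε) :
    |F q' X C - F q X C - a * (q' - q)| ≤ ε * (q' - q) := by
  have hfreeze : ∀ {β : Type} (Z : ℝ → β), (∀ u, q ≤ u → Z u = Z q) → ∀ t, q ≤ t → ∀ u, 0 ≤ u →
      stopAt t Z u = Z u := by
    intro β Z hZ t ht u hu
    rcases le_total u t with h | h
    · exact stopAt_of_le Z hu h
    · rw [stopAt_of_ge Z (hq.trans ht) h, hZ t ht, hZ u (ht.trans h)]
  have hmem : ∀ t ∈ Icc q q', t ∈ Icc 0 T := fun t ht => ⟨hq.trans ht.1, ht.2.trans hq'⟩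
  have hcont : ContinuousOn (fun t => F t X C) (Icc q q') := by
    intro t ht
    rw [Metric.continuousWithinAt_iff]
    intro ε hε
    obtain ⟨η, hη, h⟩ := hc.exists_close (hmem t ht) hX hC (half_pos hε)
    refine ⟨η, hη, fun t' ht' hd => ?_⟩
    rw [Real.dist_eq] at hd ⊢
    rw [abs_sub_comm]
    refine lt_of_le_of_lt (h t' (hmem t' ht') ?_ X C hX hC ?_ ?_) (half_lt_self hε)
    · rw [abs_sub_comm]
      exact hd.le
    · intro u hu
      rw [hfreeze X hXq t ht.1 u hu.1, hfreeze X hXq t' ht'.1 u hu.1, sub_self, norm_zero]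
      exact hη.le
    · intro u hu
      rw [hfreeze C hCq t ht.1 u hu.1, hfreeze C hCq t' ht'.1 u hu.1, sub_self, norm_zero]
      exact hη.le
  -- The paths are constant from `q` on, so stopping them at `t - h ≥ q` changes nothing and the
  -- horizontal quotient is an ordinary left difference quotient.
  have hder : ∀ t ∈ Ioc q q', Tendsto (fun h => (F t X C - F (t - h) X C) / h) (𝓝[>] 0)
      (𝓝 (D₀ t X C)) := by
    intro t ht
    have htT : t ∈ Icc 0 T := hmem t ⟨ht.1.le, ht.2⟩
    refine (hD t ⟨hq.trans_lt ht.1, htT.2⟩ X C hX hC).congr' ?_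
    filter_upwards [Ioo_mem_nhdsGT (sub_pos.2 ht.1)] with h hh
    have hth : q ≤ t - h := by linarith [hh.2]
    have hthT : t - h ∈ Icc 0 T := hmem _ ⟨hth, by linarith [hh.1, ht.2]⟩
    have e1 : F t (stopAt (t - h) X) (stopAt (t - h) C) = F t X C :=
      hF.congr htT (hX.stopAt hthT) hX (hC.stopAt hthT) hC (fun u hu => hfreeze X hXq _ hth u hu.1)
        fun u hu => hfreeze C hCq _ hth u hu.1
    have e2 : F (t - h) (stopAt (t - h) X) (stopAt (t - h) C) = F (t - h) X C :=
      hF.congr hthT (hX.stopAt hthT) hX (hC.stopAt hthT) hC (fun u hu => hfreeze X hXq _ hth u hu.1)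
        fun u hu => hfreeze C hCq _ hth u hu.1
    rw [e1, e2]
  -- Time is reversed, which turns the left derivative into the right derivative required by this
  -- mean value inequality.
  have hmv := norm_image_sub_le_of_norm_deriv_right_le_segment
    (f := fun x => F (-x) X C + a * x) (f' := fun x => -D₀ (-x) X C + a) (a := -q') (b := -q)
    (C := ε) ?_ ?_ ?_ (-q) ⟨by linarith, le_rfl⟩
  · rw [Real.norm_eq_abs, abs_sub_comm] at hmv
    simp only [neg_neg] at hmv
    refine le_trans (le_of_eq ?_) (hmv.trans (le_of_eq ?_))
    · congr 1
      ring
    · ring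
  · refine ContinuousOn.add (hcont.comp continuous_neg.continuousOn fun x hx => ?_) (by fun_prop)
    exact ⟨by linarith [hx.2], by linarith [hx.1]⟩
  · intro x hx
    refine HasDerivWithinAt.add ?_ ((hasDerivWithinAt_id x _).const_mul a |>.congr_deriv (mul_one a))
    rw [← hasDerivWithinAt_Ioi_iff_Ici, hasDerivWithinAt_iff_tendsto_slope' (by simp)]
    have hsh : Tendsto (fun y => y - x) (𝓝[>] x) (𝓝[>] 0) := by
      refine tendsto_nhdsWithin_iff.2 ⟨?_, ?_⟩
      · have : Tendsto (fun y => y - x) (𝓝 x) (𝓝 (x - x)) := (continuous_sub_right x).tendsto x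
        rw [sub_self] at this
        exact this.mono_left nhdsWithin_le_nhds
      · filter_upwards [self_mem_nhdsWithin] with y hy
        exact sub_pos.2 (mem_Ioi.1 hy)
    refine ((hder (-x) ⟨by linarith [hx.2], by linarith [hx.1]⟩).comp hsh).neg.congr fun y => ?_
    rw [slope_def_field, Function.comp_apply, show -x - (y - x) = -y by ring, ← neg_div, neg_sub]
  · intro x hx
    rw [Real.norm_eq_abs, show -D₀ (-x) X C + a = -(D₀ (-x) X C - a) by ring, abs_neg]
    exact hbd _ ⟨by linarith [hx.2], by linarith [hx.1]⟩

end TimeStep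

theorem norm_le_sum_abs {n : ℕ} (z : E n) : ‖z‖ ≤ ∑ k, |z k| := by
  have hz : z = ∑ k, z k • (EuclideanSpace.single k (1 : ℝ) : E n) := by
    ext j
    simp [Pi.single_apply]
  conv_lhs => rw [hz]
  refine (norm_sum_le _ _).trans (Finset.sum_le_sum fun k _ => ?_)
  rw [norm_smul, PiLp.norm_single, norm_one, mul_one, Real.norm_eq_abs]

theorem abs_apply_le_norm {n : ℕ} (z : E n) (k : Fin n) : |z k| ≤ ‖z‖ := by
  simpa using EuclideanSpace.norm_eq z ▸ Real.abs_le_sqrt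
    (show (z k) ^ 2 ≤ ∑ i, ‖z i‖ ^ 2 by
      rw [← sq_abs, ← Real.norm_eq_abs]
      exact Finset.single_le_sum (f := fun i => ‖z i‖ ^ 2) (fun i _ => sq_nonneg _)
        (Finset.mem_univ k))

/-! #### Staircase approximations that move one component at a time -/

/-- Rounding of `i` to a multiple of `m + 1`; for different `k < m` the jumps occur at different
places. -/
def stairIdx (m k i : ℕ) : ℕ := (m + 1) * ((i + (m - k)) / (m + 1))

section StairIdx

variable {m k : ℕ}

theorem stairIdx_mono : Monotone (stairIdx m k) := fun _ _ h =>
  Nat.mul_le_mul_left _ (Nat.div_le_div_right (Nat.add_le_add_right h _))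

theorem stairIdx_zero (hk : k < m) : stairIdx m k 0 = 0 := by
  rw [stairIdx, Nat.div_eq_of_lt (by omega), mul_zero]

theorem stairIdx_le (i : ℕ) : stairIdx m k i ≤ i + m := by
  have := Nat.div_add_mod (i + (m - k)) (m + 1)
  rw [stairIdx]
  omega

theorem le_stairIdx (i : ℕ) : i ≤ stairIdx m k i + m := by
  have := Nat.div_add_mod (i + (m - k)) (m + 1)
  have := Nat.mod_lt (i + (m - k)) (show 0 < m + 1 by omega)
  rw [stairIdx]
  omega

/-- At multiples of `m + 1` all components are synchronised. The number of steps is chosen as such a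
multiple, so that the staircase ends exactly on `A`. -/
theorem stairIdx_mul (hk : k < m) (j : ℕ) : stairIdx m k ((m + 1) * j) = (m + 1) * j := by
  rw [stairIdx, Nat.mul_add_div (by omega), Nat.div_eq_of_lt (by omega), add_zero]

/-- The quotient increases from `i` to `i + 1` only if `m + 1` divides `i + 1 + m - k`, that is, if
`i` is congruent to `k`. The residue `m` belongs to no component. -/
theorem stairIdx_succ (hk : k < m) {i : ℕ} (hi : i % (m + 1) ≠ k) :
    stairIdx m k (i + 1) = stairIdx m k i := by
  rw [stairIdx, stairIdx, show i + 1 + (m - k) = i + (m - k) + 1 by omega, Nat.succ_div, if_neg,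
    add_zero]
  rintro ⟨c, hc⟩
  apply hi
  have h1 : i = k + (m + 1) * (c - 1) := by
    rcases c with _ | c
    · omega
    · rw [Nat.add_sub_cancel]
      rw [mul_add] at hc
      omega
  rw [h1, Nat.add_mul_mod_self_left, Nat.mod_eq_of_lt (by omega)]

end StairIdx

/-- The time change used for the component `k` of a staircase path. -/
def stairTime (m N : ℕ) (s h : ℝ) (k : ℕ) (u : ℝ) : ℝ :=
  min u s + h * stairIdx m k (min N ⌊(u - s) / h⌋₊)

/-- The path which follows `A` up to time `s` and then moves along `A` in `N` steps of duration
`h`, one component at a time. -/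
def stairPath {m : ℕ} (N : ℕ) (s h : ℝ) (A : ℝ → E m) : ℝ → E m :=
  fun u => WithLp.toLp 2 fun k => A (stairTime m N s h k u) k

section StairTime

variable {m N k : ℕ} {s h : ℝ}

theorem floor_div_eq {i : ℕ} {u : ℝ} (hh : 0 < h) (h1 : s + i * h ≤ u) (h2 : u < s + (i + 1) * h) :
    ⌊(u - s) / h⌋₊ = i := by
  have hi : (0 : ℝ) ≤ i * h := by positivity
  rw [Nat.floor_eq_iff (div_nonneg (by linarith) hh.le), le_div_iff₀ hh, div_lt_iff₀ hh]
  constructor <;> linarith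

theorem stairTime_of_mem {i : ℕ} {u : ℝ} (hh : 0 < h) (hi : i ≤ N) (h1 : s + i * h ≤ u)
    (h2 : u < s + (i + 1) * h) : stairTime m N s h k u = s + h * stairIdx m k i := by
  have hi0 : (0 : ℝ) ≤ i * h := by positivity
  rw [stairTime, floor_div_eq hh h1 h2, min_eq_right hi, min_eq_right (by linarith)]

theorem stairTime_of_le {u : ℝ} (hk : k < m) (hh : 0 < h) (hu : u ≤ s) :
    stairTime m N s h k u = u := by
  rw [stairTime, Nat.floor_of_nonpos (div_nonpos_of_nonpos_of_nonneg (by linarith) hh.le),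
    Nat.min_zero, stairIdx_zero hk, Nat.cast_zero, mul_zero, add_zero, min_eq_left hu]

theorem stairTime_mono (hh : 0 < h) : Monotone (stairTime m N s h k) := by
  intro u v huv
  refine add_le_add (min_le_min huv le_rfl) (mul_le_mul_of_nonneg_left ?_ hh.le)
  exact_mod_cast stairIdx_mono (min_le_min le_rfl (Nat.floor_mono
    (div_le_div_of_nonneg_right (by linarith) hh.le)))

theorem stairTime_right (hh : 0 < h) (u : ℝ) :
    Tendsto (stairTime m N s h k) (𝓝[>] u) (𝓝 (stairTime m N s h k u)) := by
  have hfl : ∀ᶠ r in 𝓝[>] u, ⌊(r - s) / h⌋₊ = ⌊(u - s) / h⌋₊ := by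
    have hcont : ContinuousAt (fun r => (r - s) / h) u := by fun_prop
    have hlt := hcont.eventually_lt_const (Nat.lt_floor_add_one ((u - s) / h))
    filter_upwards [nhdsWithin_le_nhds hlt, self_mem_nhdsWithin] with r hr hru
    refine le_antisymm ?_ (Nat.floor_mono (div_le_div_of_nonneg_right
      (sub_le_sub_right (le_of_lt hru) s) hh.le))
    rw [← Nat.lt_add_one_iff]
    exact Nat.floor_lt' (by omega) |>.2 (by exact_mod_cast hr)
  have hmin : Tendsto (fun r => min r s + h * stairIdx m k (min N ⌊(u - s) / h⌋₊)) (𝓝[>] u)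
      (𝓝 (stairTime m N s h k u)) := by
    have : Continuous fun r => min r s + h * (stairIdx m k (min N ⌊(u - s) / h⌋₊) : ℝ) := by
      fun_prop
    exact this.continuousAt.tendsto.mono_left nhdsWithin_le_nhds
  refine hmin.congr' ?_
  filter_upwards [hfl] with r hr
  rw [stairTime, hr]

/-- Rounding the index costs at most `m` steps in either direction, and the floor costs at most one
more. -/
theorem abs_stairTime_sub_le (hk : k < m) (hh : 0 < h) {u : ℝ} (hu : u ≤ s + N * h) :
    |stairTime m N s h k u - u| ≤ (m + 1) * h := by
  rcases le_total u s with hus | hus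
  · rw [stairTime_of_le hk hh hus, sub_self, abs_zero]
    positivity
  · have hx : 0 ≤ (u - s) / h := div_nonneg (by linarith) hh.le
    set i := ⌊(u - s) / h⌋₊ with hi
    have h1 : (i : ℝ) ≤ (u - s) / h := Nat.floor_le hx
    have h2 : (u - s) / h < i + 1 := Nat.lt_floor_add_one _
    rw [le_div_iff₀ hh] at h1
    rw [div_lt_iff₀ hh] at h2
    have hiN : i ≤ N := by
      have : (i : ℝ) * h ≤ N * h := by linarith
      exact_mod_cast le_of_mul_le_mul_right this hh
    have h3 : (stairIdx m k i : ℝ) ≤ i + m := by exact_mod_cast stairIdx_le i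
    have h4 : (i : ℝ) ≤ stairIdx m k i + m := by exact_mod_cast le_stairIdx i
    rw [stairTime_of_mem hh hiN (by linarith) (by linarith), abs_sub_le_iff]
    constructor <;> nlinarith

theorem stairTime_end (hk : k < m) (hh : 0 < h) (j : ℕ) :
    stairTime m ((m + 1) * j) s h k (s + ((m + 1) * j : ℕ) * h) = s + ((m + 1) * j : ℕ) * h := by
  rw [stairTime_of_mem hh le_rfl le_rfl (by linarith), stairIdx_mul hk, mul_comm]

end StairTime

section StairPath

variable {m N : ℕ} {T s h : ℝ} {A : ℝ → E m}

theorem stairTime_mem {k : ℕ} (hh : 0 < h) (hend : ∀ k < m,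
    stairTime m N s h k (s + N * h) = s + N * h) (hk : k < m) (u : ℝ) :
    stairTime m N s h k u ∈ Icc (min u s) (s + N * h) := by
  have hN : (0 : ℝ) ≤ N * h := by positivity
  refine ⟨le_add_of_nonneg_right (by positivity), ?_⟩
  rcases le_total u (s + N * h) with h1 | h1
  · exact (stairTime_mono hh h1).trans_eq (hend k hk)
  · rw [← hend k hk, stairTime, stairTime, min_eq_right (by linarith : s ≤ u),
      min_eq_right (by linarith : s ≤ s + N * h)]
    have e1 : (s + N * h - s) / h = N := by
      field_simp
      ring
    have e2 : N ≤ ⌊(u - s) / h⌋₊ := Nat.le_floor ((le_div_iff₀ hh).2 (by linarith))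
    rw [e1, Nat.floor_natCast, min_self, min_eq_left e2]

theorem stairPath_apply (u : ℝ) (k : Fin m) :
    stairPath N s h A u k = A (stairTime m N s h k u) k := rfl

/-- Each component is a component of the continuous path `A` after a monotone right-continuous time
change. Such a time change has left limits and does not increase the variation, and the variation of
the whole path is at most the sum over its components. -/
theorem isBVPath_stairPath (hA : ContinuousOn A (Icc 0 T)) (hbv : BoundedVariationOn A (Icc 0 T))
    (hh : 0 < h) (hs : 0 ≤ s) (hT : s + N * h ≤ T)
    (hend : ∀ k < m, stairTime m N s h k (s + N * h) = s + N * h) {L : Set (E m)}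
    (hL : IsClosed L) (hmem : ∀ u ∈ Icc 0 T, stairPath N s h A u ∈ L) :
    IsBVPath T L (stairPath N s h A) := by
  have hmaps : ∀ k : Fin m, MapsTo (stairTime m N s h k) (Icc 0 T) (Icc 0 T) := by
    intro k u hu
    have := stairTime_mem hh hend k.2 u
    exact ⟨(le_min hu.1 hs).trans this.1, this.2.trans hT⟩
  have hcad : IsCadlag T univ (stairPath N s h A) := by
    refine ⟨fun _ _ => mem_univ _, fun u hu => ?_, fun u hu => ?_⟩
    · rw [(PiLp.homeomorph 2 fun _ : Fin m => ℝ).isInducing.tendsto_nhds_iff, tendsto_pi_nhds]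
      intro k
      have huT : u ∈ Icc 0 T := ⟨hu.1, hu.2.le⟩
      have h1 : Tendsto (stairTime m N s h k) (𝓝[>] u) (𝓝[Icc 0 T] (stairTime m N s h k u)) := by
        refine tendsto_nhdsWithin_iff.2 ⟨stairTime_right hh u, ?_⟩
        filter_upwards [Ioo_mem_nhdsGT hu.2] with r hr
        exact hmaps k ⟨hu.1.trans hr.1.le, hr.2.le⟩
      have h2 := (hA _ (hmaps k huT)).tendsto.comp h1
      exact (((EuclideanSpace.proj k : E m →L[ℝ] ℝ).continuous.tendsto _).comp h2 :)
    · have huT : u ∈ Icc 0 T := ⟨hu.1.le, hu.2⟩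
      have hlim : ∀ k : Fin m, ∃ x : ℝ, Tendsto (fun r => stairPath N s h A r k) (𝓝[<] u) (𝓝 x) := by
        intro k
        have h1 : Tendsto (stairTime m N s h k) (𝓝[<] u)
            (𝓝 (Function.leftLim (stairTime m N s h k) u)) :=
          (stairTime_mono hh).tendsto_leftLim u
        have hev : ∀ᶠ r in 𝓝[<] u, stairTime m N s h k r ∈ Icc 0 T := by
          filter_upwards [Ioo_mem_nhdsLT hu.1] with r hr
          exact hmaps k ⟨hr.1.le, hr.2.le.trans hu.2⟩
        have h2 : Tendsto (stairTime m N s h k) (𝓝[<] u)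
            (𝓝[Icc 0 T] (Function.leftLim (stairTime m N s h k) u)) :=
          tendsto_nhdsWithin_iff.2 ⟨h1, hev⟩
        have h3 := (hA _ (isClosed_Icc.mem_of_tendsto h1 hev)).tendsto.comp h2
        exact ⟨_, (((EuclideanSpace.proj k : E m →L[ℝ] ℝ).continuous.tendsto _).comp h3 :)⟩
      choose x hx using hlim
      refine ⟨WithLp.toLp 2 x, mem_univ _, ?_⟩
      rw [(PiLp.homeomorph 2 fun _ : Fin m => ℝ).isInducing.tendsto_nhds_iff, tendsto_pi_nhds]
      exact hx
  refine ⟨hcad.of_isClosed hL hmem, ?_⟩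
  have hcomp : ∀ k : Fin m, BoundedVariationOn (fun u => A (stairTime m N s h k u)) (Icc 0 T) :=
    fun k => ne_top_of_le_ne_top hbv
      (eVariationOn.comp_le_of_monotoneOn A _ ((stairTime_mono hh).monotoneOn _) (hmaps k))
  have hle : ∀ u v, edist (stairPath N s h A u) (stairPath N s h A v) ≤
      ∑ k : Fin m, edist (A (stairTime m N s h k u)) (A (stairTime m N s h k v)) := by
    intro u v
    simp only [edist_dist]
    rw [← ENNReal.ofReal_sum_of_nonneg fun _ _ => dist_nonneg]
    refine ENNReal.ofReal_le_ofReal ?_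
    rw [dist_eq_norm]
    refine (norm_le_sum_abs _).trans (Finset.sum_le_sum fun k _ => ?_)
    rw [dist_eq_norm]
    exact abs_apply_le_norm (A (stairTime m N s h k u) - A (stairTime m N s h k v)) k
  refine ne_top_of_le_ne_top (b := ∑ k : Fin m,
    eVariationOn (fun u => A (stairTime m N s h k u)) (Icc 0 T))
    (ENNReal.sum_ne_top.2 fun k _ => hcomp k) ?_
  refine iSup_le fun p => ?_
  refine (Finset.sum_le_sum fun i _ => hle _ _).trans ?_
  rw [Finset.sum_comm]
  refine Finset.sum_le_sum fun k _ => ?_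
  exact eVariationOn.sum_le p.2.property.1 p.2.property.2

end StairPath

/-! ### Functionals over one step of a staircase -/

section StairSteps

variable {d m N : ℕ} {T s h : ℝ} {A : ℝ → E m} {U : Set (E d)} {W : Set (E m)}
  {F : Functional d m} {D : Fin m → Functional d m}

theorem stairPath_of_mem {i : ℕ} (hh : 0 < h) (hi : i ≤ N) {u : ℝ} (h1 : s + i * h ≤ u)
    (h2 : u < s + (i + 1) * h) : stairPath N s h A u = stairPath N s h A (s + i * h) := by
  ext k
  rw [stairPath_apply, stairPath_apply, stairTime_of_mem hh hi h1 h2,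
    stairTime_of_mem hh hi le_rfl (by linarith)]

/-- Here the right end point, where the staircase may jump, is included: only the component with
index `i % (m + 1)` can move there. -/
theorem stairPath_component_of_mem {i : ℕ} (hh : 0 < h) (hi : i < N) {k : Fin m}
    (hk : i % (m + 1) ≠ k) {u : ℝ} (h1 : s + i * h ≤ u) (h2 : u ≤ s + (i + 1) * h) :
    stairPath N s h A u k = stairPath N s h A (s + i * h) k := by
  rcases h2.eq_or_lt with h2 | h2
  · rw [stairPath_apply, stairPath_apply, stairTime_of_mem hh hi.le le_rfl (by linarith),
      stairTime_of_mem (i := i + 1) hh hi (by push_cast; linarith) (by push_cast; linarith),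
      stairIdx_succ k.2 hk]
  · rw [stairPath_of_mem hh hi.le h1 h2]

/-- The jump of a staircase path at a grid point changes a functional exactly by the horizontal
derivative times the jump of the component that moves. -/
theorem jump_increment_eq (hF : NonAnticipative T U W F)
    (hD : ∀ k, HasHorizontalDeriv T U W k F (D k)) (hh : 0 < h) (hs : 0 ≤ s) {i : ℕ} (hi : i < N)
    (hT : s + (i + 1) * h ≤ T) {X : ℝ → E d} (hX : IsCadlag T U X)
    (hXs : ∀ u, s ≤ u → X u = X s) (hB : IsBVPath T W (stairPath N s h A)) :
    F (s + (i + 1) * h) X (stairPath N s h A)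
      - F (s + (i + 1) * h) X (stopAt (s + i * h) (stairPath N s h A))
      = ∑ k, D k (s + (i + 1) * h) X (stairPath N s h A) *
        (stairPath N s h A (s + (i + 1) * h) k - stairPath N s h A (s + i * h) k) := by
  set B := stairPath N s h A
  set q := s + i * h with hq
  set q' := s + (i + 1) * h with hq'
  have hi0 : (0 : ℝ) ≤ i * h := by positivity
  have hqq' : q + h = q' := by rw [hq, hq']; ring
  have hsq : s ≤ q := by linarith
  have hqT : q ∈ Icc 0 T := ⟨by linarith, by linarith⟩
  have hq'T : q' ∈ Icc 0 T := ⟨by linarith, hT⟩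
  have hconst : ∀ u ∈ Ico q q', B u = B q := fun u hu => stairPath_of_mem hh hi.le hu.1 hu.2
  have hcomp : ∀ k : Fin m, i % (m + 1) ≠ k → ∀ u ∈ Icc q q', B u k = B q k := fun k hk u hu =>
    stairPath_component_of_mem hh hi hk hu.1 hu.2
  -- Either exactly one component may jump at `q'`, or the residue is `m` and the path does not move
  -- at all.
  by_cases hk : i % (m + 1) < m
  · set k : Fin m := ⟨i % (m + 1), hk⟩ with hkdef
    have hne : ∀ j, j ≠ k → i % (m + 1) ≠ j := fun j hj h' => hj (Fin.ext h'.symm)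
    rw [Finset.sum_eq_single k]
    -- The other components are constant on `[q, q']`, so stopping them earlier is invisible and the
    -- mixed path is simply the path stopped at `q'`.
    · have hmix : ∀ η ∈ Ioo 0 h, mixedPath k (q' - η) q' B = stopAt q' B := by
        intro η hη
        funext u
        ext j
        change Function.update (stopAt (q' - η) B u).ofLp k (stopAt q' B u k) j = _
        by_cases hj : j = k
        · subst hj
          rw [Function.update_self]
        · rw [Function.update_of_ne hj]
          rcases le_total u (q' - η) with hu | hu
          · rw [stopAt, stopAt, min_eq_left hu, min_eq_left (by linarith [hη.1])]
          · have hu0 : 0 ≤ u := by linarith [hη.2, hqT.1]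
            rw [stopAt_of_ge B (by linarith [hη.2, hqT.1]) hu, stopAt_apply B hq'T.1 hu0,
              hcomp j (hne j hj) _ ⟨by linarith [hη.2], by linarith [hη.1]⟩,
              hcomp j (hne j hj) _ ⟨le_min (by linarith [hη.2]) (by linarith),
                min_le_right _ _⟩]
      have hev : ∀ᶠ η in 𝓝[>] (0 : ℝ), η ∈ Ioo 0 h := Ioo_mem_nhdsGT hh
      have hlit := hD k q' ⟨by linarith, hT⟩ X B hX hB (by
        filter_upwards [hev] with η hη
        rw [hmix η hη]
        exact hB.stopAt hq'T)
      -- For lags below `h` neither numerator nor denominator depends on the lag, and a constant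
      -- that is `o` of a constant is zero; this gives an exact identity.
      have hlit' : (fun _ : ℝ => F q' X B - F q' X (stopAt q B) - D k q' X B * (B q' k - B q k))
          =o[𝓝[>] 0] fun _ : ℝ => B q' k - B q k := by
        refine hlit.congr' ?_ ?_
        · filter_upwards [hev] with η hη
          have hr : q ≤ q' - η := by linarith [hη.2]
          have hrT : q' - η ∈ Icc 0 T := ⟨hqT.1.trans hr, by linarith [hη.1, hq'T.2]⟩
          have hXe : EqOn (stopAt (q' - η) X) X (Icc 0 q') := by
            intro u hu
            rcases le_total u (q' - η) with h1 | h1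
            · exact stopAt_of_le X hu.1 h1
            · rw [stopAt_of_ge X hrT.1 h1, hXs _ (hsq.trans hr), hXs u (by linarith)]
          rw [hmix η hη, hconst (q' - η) ⟨hr, by linarith [hη.1]⟩]
          congr 2
          · exact hF.congr hq'T (hX.stopAt hrT) hX (hB.stopAt hq'T) hB hXe fun u hu =>
              stopAt_of_le B hu.1 hu.2
          · refine hF.congr hq'T (hX.stopAt hrT) hX (hB.stopAt hrT) (hB.stopAt hqT) hXe ?_
            intro u hu
            rcases le_total u q with h1 | h1
            · rw [stopAt_of_le B hu.1 h1, stopAt_of_le B hu.1 (h1.trans hr)]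
            · rw [stopAt_of_ge B hqT.1 h1, stopAt_apply B hrT.1 hu.1]
              exact hconst _ ⟨le_min h1 hr, (min_le_right _ _).trans_lt (by linarith [hη.1])⟩
        · filter_upwards [hev] with η hη
          rw [hconst (q' - η) ⟨by linarith [hη.2], by linarith [hη.1]⟩]
      exact sub_eq_zero.1 (Asymptotics.isLittleO_const_const_iff.1 hlit')
    · intro j _ hj
      rw [hcomp j (hne j hj) q' ⟨by linarith, le_rfl⟩, sub_self, mul_zero]
    · exact fun h' => absurd (Finset.mem_univ _) h'
  · have hall : ∀ u ∈ Icc q q', B u = B q := fun u hu => by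
      ext k
      exact hcomp k (fun h' => hk (h' ▸ k.2)) u hu
    rw [Finset.sum_eq_zero fun k _ => by rw [hall q' ⟨by linarith, le_rfl⟩, sub_self, mul_zero],
      sub_eq_zero]
    refine hF.congr hq'T hX hX hB (hB.stopAt hqT) (fun _ _ => rfl) fun u hu => ?_
    rcases le_total u q with h1 | h1
    · rw [stopAt_of_le B hu.1 h1]
    · rw [stopAt_of_ge B hqT.1 h1, hall u ⟨h1, hu.2⟩]

/-- Increment of a functional along one step of a staircase path. -/
theorem abs_stair_step_le (hF : NonAnticipative T U W F) (hc : ContinuousFunctional T U W F)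
    {D₀ : Functional d m} (hD₀ : HasTimeDeriv T U W F D₀)
    (hD : ∀ k, HasHorizontalDeriv T U W k F (D k)) (hh : 0 < h) (hs : 0 ≤ s) {i : ℕ} (hi : i < N)
    (hT : s + (i + 1) * h ≤ T) {X : ℝ → E d} (hX : IsCadlag T U X)
    (hXs : ∀ u, s ≤ u → X u = X s) (hB : IsBVPath T W (stairPath N s h A)) {a ε : ℝ}
    {b : Fin m → ℝ}
    (h₀ : ∀ t ∈ Ioc (s + i * h) (s + (i + 1) * h),
      |D₀ t X (stopAt (s + i * h) (stairPath N s h A)) - a| ≤ ε)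
    (hk : ∀ k, |D k (s + (i + 1) * h) X (stairPath N s h A) - b k| ≤ ε) :
    |F (s + (i + 1) * h) X (stairPath N s h A) - F (s + i * h) X (stairPath N s h A) - a * h
      - ∑ k, b k * (stairPath N s h A (s + (i + 1) * h) k - stairPath N s h A (s + i * h) k)|
      ≤ ε * (h + ∑ k, |stairPath N s h A (s + (i + 1) * h) k
        - stairPath N s h A (s + i * h) k|) := by
  have hj := jump_increment_eq hF hD hh hs hi hT hX hXs hB
  set B := stairPath N s h A
  set q := s + i * h with hq
  set q' := s + (i + 1) * h with hq'
  have hi0 : (0 : ℝ) ≤ i * h := by positivity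
  have hqq' : q' - q = h := by rw [hq, hq']; ring
  have hqT : q ∈ Icc 0 T := ⟨by linarith, by linarith⟩
  -- The step is split at the path stopped at `q`: along it only time moves, and `hj` accounts for
  -- the jump at `q'`.
  have ht := abs_time_increment_le hF hc hD₀ hqT.1 (by linarith) hT hX (hB.stopAt hqT)
    (fun u hu => by rw [hXs u (by linarith), hXs q (by linarith)])
    (fun u hu => by rw [stopAt_of_ge B hqT.1 hu, stopAt_of_ge B hqT.1 le_rfl]) h₀
  have hqe : F q X (stopAt q B) = F q X B := hF.congr hqT hX hX (hB.stopAt hqT) hB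
    (fun _ _ => rfl) fun u hu => stopAt_of_le B hu.1 hu.2
  rw [hqe, hqq'] at ht
  have hsum : |∑ k, D k q' X B * (B q' k - B q k) - ∑ k, b k * (B q' k - B q k)| ≤
      ε * ∑ k, |B q' k - B q k| := by
    rw [← Finset.sum_sub_distrib, Finset.mul_sum]
    refine (Finset.abs_sum_le_sum_abs _ _).trans (Finset.sum_le_sum fun k _ => ?_)
    rw [← sub_mul, abs_mul]
    exact mul_le_mul_of_nonneg_right (hk k) (abs_nonneg _)
  rw [← hj] at hsum
  have hadd := (abs_add_le _ _).trans (add_le_add ht hsum)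
  refine le_trans (le_of_eq ?_) (hadd.trans (le_of_eq ?_))
  · congr 1
    ring
  · ring

end StairSteps

/-! ### The horizontal mean value inequality along a continuous path of bounded variation -/

section Horizontal

variable {d m : ℕ} {T : ℝ} {A : ℝ → E m} {U : Set (E d)} {W : Set (E m)}
  {F : Functional d m} {D : Fin m → Functional d m}

/-- Increment of a functional along a staircase path. -/
theorem abs_stair_increment_le {N : ℕ} {s h : ℝ} (hF : NonAnticipative T U W F)
    (hc : ContinuousFunctional T U W F)
    {D₀ : Functional d m} (hD₀ : HasTimeDeriv T U W F D₀)
    (hD : ∀ k, HasHorizontalDeriv T U W k F (D k)) (hh : 0 < h) (hs : 0 ≤ s)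
    (hT : s + N * h ≤ T) (hend : ∀ k < m, stairTime m N s h k (s + N * h) = s + N * h)
    {v : ℝ → ℝ}
    (hv : ∀ x ∈ Icc 0 T, ∀ y ∈ Icc 0 T, x ≤ y → ‖A y - A x‖ ≤ v y - v x) {X : ℝ → E d}
    (hX : IsCadlag T U X) (hXs : ∀ u, s ≤ u → X u = X s) (hB : IsBVPath T W (stairPath N s h A))
    {a ε : ℝ} (hε : 0 ≤ ε) {b : Fin m → ℝ}
    (hbd : ∀ q ∈ Icc s (s + N * h), ∀ t ∈ Icc q (s + N * h),
      |D₀ t X (stopAt q (stairPath N s h A)) - a| ≤ ε ∧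
      ∀ k, |D k t X (stairPath N s h A) - b k| ≤ ε) :
    |F (s + N * h) X (stairPath N s h A) - F s X (stairPath N s h A) - a * (N * h)
      - ∑ k, b k * (A (s + N * h) k - A s k)|
      ≤ ε * (N * h + m * (v (s + N * h) - v s)) := by
  set B := stairPath N s h A
  have hN0 : (0 : ℝ) ≤ N * h := by positivity
  -- The jumps of component `k` are dominated by increments of `v` along its time change; these
  -- telescope, and the `m` components together give the factor `m`.
  have hstep : ∀ i ∈ Finset.range N, |F (s + (i + 1 : ℕ) * h) X B - F (s + (i : ℕ) * h) X B - a * h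
      - ∑ k, b k * (B (s + (i + 1 : ℕ) * h) k - B (s + (i : ℕ) * h) k)|
      ≤ ε * (h + ∑ k : Fin m, (v (stairTime m N s h k (s + (i + 1 : ℕ) * h))
        - v (stairTime m N s h k (s + (i : ℕ) * h)))) := by
    intro i hi
    have hiN : i < N := Finset.mem_range.1 hi
    have hle : ((i : ℝ) + 1) * h ≤ N * h :=
      mul_le_mul_of_nonneg_right (by exact_mod_cast hiN) hh.le
    have hi0 : (0 : ℝ) ≤ i * h := by positivity
    have := abs_stair_step_le (A := A) hF hc hD₀ hD hh hs hiN (by linarith) hX hXs hB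
      (a := a) (b := b) (ε := ε)
      (fun t ht => (hbd (s + i * h) ⟨by linarith, by linarith⟩ t
        ⟨ht.1.le, ht.2.trans (by linarith)⟩).1)
      (fun k => (hbd s ⟨le_rfl, by linarith⟩ _ ⟨by linarith, by linarith⟩).2 k)
    push_cast
    refine this.trans (mul_le_mul_of_nonneg_left ?_ hε)
    refine add_le_add le_rfl (Finset.sum_le_sum fun k _ => ?_)
    have hm : ∀ u, s ≤ u → stairTime m N s h k u ∈ Icc 0 T := fun u hu => by
      have := stairTime_mem hh hend k.2 u
      rw [min_eq_right hu] at this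
      exact ⟨hs.trans this.1, this.2.trans hT⟩
    have hmono : stairTime m N s h k (s + i * h) ≤ stairTime m N s h k (s + (i + 1) * h) :=
      stairTime_mono hh (by linarith)
    exact (abs_apply_le_norm (A (stairTime m N s h k (s + (i + 1) * h))
      - A (stairTime m N s h k (s + i * h))) k).trans
      (hv _ (hm _ (by linarith)) _ (hm _ (by linarith)) hmono)
  have hs0 : ∀ k : Fin m, stairTime m N s h k s = s := fun k => stairTime_of_le k.2 hh le_rfl
  have hB0 : ∀ k, B s k = A s k := fun k => by rw [stairPath_apply, hs0 k]
  have hBN : ∀ k, B (s + N * h) k = A (s + N * h) k := fun k => by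
    rw [stairPath_apply, hend k k.2]
  have tele : ∀ g : ℝ → ℝ, ∑ i ∈ Finset.range N, (g (s + (i + 1 : ℕ) * h) - g (s + (i : ℕ) * h))
      = g (s + N * h) - g s := by
    intro g
    rw [Finset.sum_range_sub (fun i : ℕ => g (s + i * h)) N, Nat.cast_zero, zero_mul, add_zero]
  have e1 : ∑ i ∈ Finset.range N, (F (s + (i + 1 : ℕ) * h) X B - F (s + (i : ℕ) * h) X B - a * h
      - ∑ k, b k * (B (s + (i + 1 : ℕ) * h) k - B (s + (i : ℕ) * h) k))
      = F (s + N * h) X B - F s X B - a * (N * h) - ∑ k, b k * (A (s + N * h) k - A s k) := by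
    rw [Finset.sum_sub_distrib, Finset.sum_sub_distrib, tele (fun t => F t X B), Finset.sum_const,
      Finset.card_range, Finset.sum_comm, nsmul_eq_mul]
    congr 1
    · ring
    · refine Finset.sum_congr rfl fun k _ => ?_
      rw [← Finset.mul_sum, tele (fun t => B t k), hB0, hBN]
  have e2 : ∑ i ∈ Finset.range N, ε * (h + ∑ k : Fin m, (v (stairTime m N s h k
      (s + (i + 1 : ℕ) * h)) - v (stairTime m N s h k (s + (i : ℕ) * h))))
      = ε * (N * h + m * (v (s + N * h) - v s)) := by
    rw [← Finset.mul_sum, Finset.sum_add_distrib, Finset.sum_comm, Finset.sum_const,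
      Finset.card_range, nsmul_eq_mul]
    congr 2
    rw [Finset.sum_congr rfl fun k _ => by
      rw [tele (fun t => v (stairTime m N s h k t)), hs0, hend k k.2]]
    rw [Finset.sum_const, Finset.card_univ, Fintype.card_fin, nsmul_eq_mul]
  rw [← e1, ← e2]
  exact (Finset.abs_sum_le_sum_abs _ _).trans (Finset.sum_le_sum hstep)

/-- Mean value inequality in the horizontal directions: the increment of a functional between
times `s` and `s'`, along a path `X` that is frozen from time `s` on. -/
theorem abs_horizontal_increment_le {s s' : ℝ} (hF : NonAnticipative T U W F)
    (hc : ContinuousFunctional T U W F)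
    {D₀ : Functional d m} (hD₀ : HasTimeDeriv T U W F D₀)
    (hD : ∀ k, HasHorizontalDeriv T U W k F (D k)) (hs : 0 ≤ s) (hss' : s ≤ s') (hT : s' ≤ T)
    (hA : ContinuousOn A (Icc 0 T)) (hbv : BoundedVariationOn A (Icc 0 T)) {v : ℝ → ℝ}
    (hv : ∀ x ∈ Icc 0 T, ∀ y ∈ Icc 0 T, x ≤ y → ‖A y - A x‖ ≤ v y - v x) {X : ℝ → E d}
    (hX : IsCadlag T U X) (hXs : ∀ u, s ≤ u → X u = X s) {L : Set (E m)} (hLW : L ⊆ W)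
    (hL : IsClosed L) {η : ℝ} (hAL : ∀ u ∈ Icc 0 T, ∀ z, ‖z - A u‖ ≤ η → z ∈ L)
    (hosc : ∀ x ∈ Icc s s', ∀ y ∈ Icc s s', m * ‖A x - A y‖ ≤ η) {a ε : ℝ} (hε : 0 ≤ ε)
    {b : Fin m → ℝ}
    (hbd : ∀ t ∈ Icc s s', ∀ C, IsBVPath T L C → (∀ u ∈ Icc 0 T, ‖C u - A (min u s)‖ ≤ η) →
      |D₀ t X C - a| ≤ ε ∧ ∀ k, |D k t X C - b k| ≤ ε) :
    |F s' X A - F s X A - a * (s' - s) - ∑ k, b k * (A s' k - A s k)|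
      ≤ ε * (s' - s + m * (v s' - v s)) := by
  rcases hss'.eq_or_lt with rfl | hlt
  · simp
  have hsT : s ∈ Icc 0 T := ⟨hs, hss'.trans hT⟩
  have hs'T : s' ∈ Icc 0 T := ⟨hs.trans hss', hT⟩
  have hη0 : 0 ≤ η := by
    have := hosc s ⟨le_rfl, hss'⟩ s ⟨le_rfl, hss'⟩
    simpa using this
  have hAbv : IsBVPath T W A := ⟨.of_continuousOn hA fun u hu => hLW (hAL u hu _ (by simpa)), hbv⟩
  set N : ℕ → ℕ := fun j => (m + 1) * (j + 1)
  set h : ℕ → ℝ := fun j => (s' - s) / N j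
  have hN0 : ∀ j, 0 < (N j : ℝ) := fun j => by
    have : 0 < N j := by positivity
    exact_mod_cast this
  have hh : ∀ j, 0 < h j := fun j => div_pos (sub_pos.2 hlt) (hN0 j)
  have hNh : ∀ j, N j * h j = s' - s := fun j => mul_div_cancel₀ _ (hN0 j).ne'
  have hsN : ∀ j, s + N j * h j = s' := fun j => by rw [hNh]; ring
  have hend : ∀ j, ∀ k < m, stairTime m (N j) s (h j) k (s + N j * h j) = s + N j * h j :=
    fun j k hk => stairTime_end hk (hh j) (j + 1)
  set B : ℕ → ℝ → E m := fun j => stairPath (N j) s (h j) A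
  have hnear : ∀ j, ∀ u ∈ Icc 0 T, ‖B j u - A (min u s)‖ ≤ η := by
    intro j u hu
    rcases le_total u s with hus | hus
    · rw [min_eq_left hus]
      have : B j u = A u := by
        ext k
        rw [stairPath_apply, stairTime_of_le k.2 (hh j) hus]
      rw [this, sub_self, norm_zero]
      exact hη0
    · rw [min_eq_right hus]
      -- The norm is estimated by the sum of `m` components, which is the origin of the factor `m`
      -- in `hosc`.
      have hk : ∀ k : Fin m, m * |(B j u - A s) k| ≤ η := by
        intro k
        have hmem := stairTime_mem (hh j) (hend j) k.2 u
        rw [min_eq_right hus, hsN] at hmem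
        refine le_trans ?_ (hosc _ hmem s ⟨le_rfl, hss'⟩)
        refine mul_le_mul_of_nonneg_left ?_ (Nat.cast_nonneg m)
        exact abs_apply_le_norm (A (stairTime m (N j) s (h j) k u) - A s) k
      refine (norm_le_sum_abs _).trans ?_
      rcases Nat.eq_zero_or_pos m with hm | hm
      · subst hm
        simpa using hη0
      · have hm' : (0 : ℝ) < m := by exact_mod_cast hm
        refine (Finset.sum_le_card_nsmul _ _ (η / m) fun k _ => ?_).trans (le_of_eq ?_)
        · rw [le_div_iff₀ hm', mul_comm]
          exact hk k
        · rw [Finset.card_univ, Fintype.card_fin, nsmul_eq_mul, mul_div_cancel₀ _ hm'.ne']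
  have hBL : ∀ j, IsBVPath T L (B j) := fun j =>
    isBVPath_stairPath hA hbv (hh j) hs (by rw [hsN]; exact hT) (hend j) hL fun u hu =>
      hAL (min u s) ⟨le_min hu.1 hs, (min_le_left _ _).trans hu.2⟩ _ (hnear j u hu)
  have hBW : ∀ j, IsBVPath T W (B j) := fun j => ⟨(hBL j).cadlag.mono hLW, (hBL j).bv⟩
  have hstopnear : ∀ j, ∀ q ∈ Icc s s', ∀ u ∈ Icc 0 T, ‖stopAt q (B j) u - A (min u s)‖ ≤ η := by
    intro j q hq u hu
    rw [stopAt_apply _ (hs.trans hq.1) hu.1]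
    have := hnear j (min u q) ⟨le_min hu.1 (hs.trans hq.1), (min_le_left _ _).trans hu.2⟩
    rwa [min_assoc, min_eq_right hq.1] at this
  have hest : ∀ j, |F s' X (B j) - F s X A - a * (s' - s) - ∑ k, b k * (A s' k - A s k)|
      ≤ ε * (s' - s + m * (v s' - v s)) := by
    intro j
    have := abs_stair_increment_le (N := N j) (h := h j) (A := A) hF hc hD₀ hD (hh j) hs
      (by rw [hsN]; exact hT) (hend j) hv hX hXs (hBW j) hε (a := a) (b := b) (by
        rw [hsN]
        intro q hq t ht
        exact ⟨(hbd t ⟨hq.1.trans ht.1, ht.2⟩ _ ((hBL j).stopAt ⟨hs.trans hq.1, hq.2.trans hT⟩)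
          (hstopnear j q hq)).1, (hbd t ⟨hq.1.trans ht.1, ht.2⟩ _ (hBL j) (hnear j)).2⟩)
    rw [hsN, hNh] at this
    have hsB : F s X (stairPath (N j) s (h j) A) = F s X A := by
      refine hF.congr hsT hX hX (hBW j) hAbv (fun _ _ => rfl) fun u hu => ?_
      ext k
      rw [stairPath_apply, stairTime_of_le k.2 (hh j) hu.2]
    rwa [hsB] at this
  -- The time changes move points by at most `(m + 1) h j = (s' - s) / (j + 1)`, so the staircases
  -- converge uniformly to `A`. The bound `hest` is uniform in `j`, and only continuity of `F` is
  -- needed in the limit.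
  have hclose : ∀ η' > 0, ∀ᶠ j in atTop, ∀ u ∈ Icc 0 T,
      ‖stopAt s' A u - stopAt s' (B j) u‖ ≤ η' := by
    intro η' hη'
    have huc := isCompact_Icc.uniformContinuousOn_of_continuous hA
    obtain ⟨δ, hδ, hu⟩ := Metric.uniformContinuousOn_iff.1 huc (η' / (m + 1)) (by positivity)
    have hlim : Tendsto (fun j : ℕ => (s' - s) * (1 / ((j : ℝ) + 1))) atTop (𝓝 ((s' - s) * 0)) :=
      tendsto_one_div_add_atTop_nhds_zero_nat.const_mul _
    rw [mul_zero] at hlim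
    filter_upwards [hlim.eventually_lt_const hδ] with j hj u hu'
    rw [stopAt_apply _ hs'T.1 hu'.1, stopAt_apply _ hs'T.1 hu'.1]
    have hw : min u s' ∈ Icc 0 T := ⟨le_min hu'.1 hs'T.1, (min_le_left _ _).trans hu'.2⟩
    have hk : ∀ k : Fin m, |(A (min u s') - B j (min u s')) k| ≤ η' / (m + 1) := by
      intro k
      have hmem := stairTime_mem (hh j) (hend j) k.2 (min u s')
      have hmT : stairTime m (N j) s (h j) k (min u s') ∈ Icc 0 T :=
        ⟨(le_min hw.1 hs).trans hmem.1, hmem.2.trans (by rw [hsN]; exact hT)⟩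
      have hd := abs_stairTime_sub_le (u := min u s') k.2 (hh j) (by
        rw [hsN]
        exact min_le_right _ _)
      have hlt' : ((m : ℝ) + 1) * h j = (s' - s) * (1 / ((j : ℝ) + 1)) := by
        simp only [h, N]
        push_cast
        field_simp
      refine (abs_apply_le_norm
        (A (min u s') - A (stairTime m (N j) s (h j) k (min u s'))) k).trans ?_
      rw [← dist_eq_norm]
      refine (hu _ hw _ hmT ?_).le
      rw [Real.dist_eq, abs_sub_comm]
      exact hd.trans_lt (by rwa [hlt'])
    refine (norm_le_sum_abs _).trans ((Finset.sum_le_card_nsmul _ _ _ fun k _ => hk k).trans ?_)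
    rw [Finset.card_univ, Fintype.card_fin, nsmul_eq_mul, mul_div_assoc',
      div_le_iff₀ (by positivity)]
    nlinarith
  have hlim : Tendsto (fun j => F s' X (B j)) atTop (𝓝 (F s' X A)) := by
    rw [Metric.tendsto_nhds]
    intro ε' hε'
    obtain ⟨η', hη', hη⟩ := hc.exists_close hs'T hX hAbv (half_pos hε')
    filter_upwards [hclose η' hη'] with j hj
    rw [Real.dist_eq, abs_sub_comm]
    refine (hη s' hs'T (by simpa using hη'.le) X (B j) hX (hBW j) (fun u _ => ?_) hj).trans_lt
      (half_lt_self hε')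
    rw [sub_self, norm_zero]
    exact hη'.le
  exact le_of_tendsto' ((((hlim.sub_const _).sub_const _).sub_const _).abs) hest

end Horizontal

/-! ### Increments along the approximating step paths -/

section Increments

variable {d m : ℕ}

/-- Indices for the horizontal derivatives and for the second vertical derivatives. -/
abbrev DerivIdx (d m : ℕ) : Type := Option (Fin m ⊕ Fin d × Fin d)

/-- The horizontal derivatives `D₀`, `D k` and the second vertical derivatives of `G`. -/
def derivs (G D₀ : Functional d m) (D : Fin m → Functional d m) : DerivIdx d m → Functional d m
  | none => D₀
  | some (Sum.inl k) => D k
  | some (Sum.inr (i, j)) => vderiv j (vderiv i G)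

/-- The increments by which the derivatives are multiplied in the change of variables formula. -/
def gridIncr (P : Finset ℝ) (X : ℝ → E d) (A : ℝ → E m) : DerivIdx d m → ℝ → ℝ
  | none => fun s => succIn P s - s
  | some (Sum.inl k) => fun s => A (succIn P s) k - A s k
  | some (Sum.inr (i, j)) => fun s =>
    (X (succIn P s) i - X s i) * (X (succIn P s) j - X s j) / 2

/-- The value of a functional at a time of the partition along the step path. -/
def gridValue (P : Finset ℝ) (G : Functional d m) (X : ℝ → E d) (A : ℝ → E m) (s : ℝ) : ℝ :=
  G s (stepBefore P X s) A

/-- The increment of a functional along the step path minus its first order vertical part. -/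
def remainder (P : Finset ℝ) (G : Functional d m) (X : ℝ → E d) (A : ℝ → E m) (s : ℝ) : ℝ :=
  gridValue P G X A (succIn P s) - gridValue P G X A s -
    ∑ i, vderiv i G s (stepBefore P X s) A * (X (succIn P s) i - X s i)

/-- Increment of `z` plus a multiple of the squared increment of `X`. -/
def gridWeight (P : Finset ℝ) (X : ℝ → E d) (z : ℝ → ℝ) (s : ℝ) : ℝ :=
  z (succIn P s) - z s +
    d * ∑ i, (X (succIn P s) i - X s i) * (X (succIn P s) i - X s i)

/-- By `2 |a b| ≤ a² + b²`. It allows squared increments, whose sums converge, to dominate the mixed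
products, and explains the factor `d` in `gridWeight`. -/
theorem sum_abs_mul_le (y : Fin d → ℝ) : ∑ i, ∑ j, |y i * y j| ≤ d * ∑ i, y i * y i := by
  have h : ∀ i j, |y i * y j| ≤ (y i * y i + y j * y j) / 2 := fun i j => by
    rw [abs_mul]
    nlinarith [sq_nonneg (|y i| - |y j|), abs_mul_abs_self (y i), abs_mul_abs_self (y j)]
  refine (Finset.sum_le_sum fun i _ => Finset.sum_le_sum fun j _ => h i j).trans (le_of_eq ?_)
  simp only [← Finset.sum_div, Finset.sum_add_distrib, Finset.sum_const, Finset.card_univ,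
    Fintype.card_fin, nsmul_eq_mul, ← Finset.mul_sum]
  ring

theorem sum_derivIdx (f : DerivIdx d m → ℝ) : ∑ l, f l =
    f none + (∑ k, f (some (Sum.inl k)) + ∑ i, ∑ j, f (some (Sum.inr (i, j)))) := by
  rw [Fintype.sum_option, Fintype.sum_sum_type, Fintype.sum_prod_type]

variable {T : ℝ} {P : ℕ → Finset ℝ} {U : Set (E d)} {W : Set (E m)} {X : ℝ → E d} {A : ℝ → E m}
  {G D₀ : Functional d m} {D : Fin m → Functional d m}

theorem stepBefore_of_lt {P : Finset ℝ} {s u : ℝ} (h : u < s) :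
    stepBefore P X s u = X (succIn P u) := if_pos h

theorem stepBefore_of_ge {P : Finset ℝ} {s u : ℝ} (h : s ≤ u) : stepBefore P X s u = X s :=
  if_neg (not_lt.2 h)

/-- The step path for `s'` already takes the value `X(s')` at time `s`. So between `s` and `s'` the
paths differ by one bump at `s`, after which everything in `X` is frozen. -/
theorem stepBefore_succIn_of_ge {P : Finset ℝ} {s u : ℝ} (hlt : s < succIn P s) (hu : s ≤ u) :
    stepBefore P X (succIn P s) u = X (succIn P s) := by
  rcases lt_or_ge u (succIn P s) with h | h
  · have hex : ∃ p ∈ P, s < p := by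
      by_contra! hno
      exact hlt.ne (succIn_eq_self hno).symm
    obtain ⟨p, hp, hsp⟩ := hex
    obtain ⟨h1, h2, h3⟩ := succIn_spec hp hsp
    rw [stepBefore_of_lt h, succIn_eq_of_isLeast h1 h fun q hq huq => h3 q hq (hu.trans_lt huq)]
  · rw [stepBefore_of_ge h]

/-- Expansion of the increment of a functional over one interval of the partition. -/
theorem abs_remainder_sub_le (hP : IsRefiningSeq T P) (hU : IsOpen U)
    (hG : NonAnticipative T U W G) (hc : ContinuousFunctional T U W G)
    (hD₀ : HasTimeDeriv T U W G D₀) (hD : ∀ k, HasHorizontalDeriv T U W k G (D k))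
    (hv₁ : VerticallyDifferentiable T U W G)
    (hv₂ : ∀ i, VerticallyDifferentiable T U W (vderiv i G))
    (hA : ContinuousOn A (Icc 0 T)) (hbv : BoundedVariationOn A (Icc 0 T)) {v : ℝ → ℝ}
    (hv : ∀ x ∈ Icc 0 T, ∀ y ∈ Icc 0 T, x ≤ y → ‖A y - A x‖ ≤ v y - v x) {K : Set (E d)}
    (hKU : K ⊆ U) (hK : IsClosed K) {L : Set (E m)} (hLW : L ⊆ W) (hL : IsClosed L) {η : ℝ}
    (hXK : ∀ u ∈ Icc 0 T, ∀ z, ‖z - X u‖ ≤ η → z ∈ K)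
    (hAL : ∀ u ∈ Icc 0 T, ∀ z, ‖z - A u‖ ≤ η → z ∈ L) {n : ℕ}
    (hoscX : ∀ s ∈ Icc 0 T, ∀ x ∈ Icc s (succIn (P n) s), ∀ y ∈ Icc s (succIn (P n) s),
      ‖X x - X y‖ ≤ η)
    (hoscA : ∀ s ∈ Icc 0 T, ∀ x ∈ Icc s (succIn (P n) s), ∀ y ∈ Icc s (succIn (P n) s),
      m * ‖A x - A y‖ ≤ η) {s : ℝ} (hs : s ∈ Icc 0 T) {κ : DerivIdx d m → ℝ} {ε : ℝ} (hε : 0 ≤ ε)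
    (hbd : ∀ t ∈ Icc s (succIn (P n) s), ∀ Y C, IsCadlag T K Y → IsBVPath T L C →
      (∀ u ∈ Icc 0 T, ‖Y u - X (min u s)‖ ≤ η) → (∀ u ∈ Icc 0 T, ‖C u - A (min u s)‖ ≤ η) →
      ∀ l, |derivs G D₀ D l t Y C - κ l| ≤ ε) :
    |remainder (P n) G X A s - ∑ l, κ l * gridIncr (P n) X A l s|
      ≤ ε * gridWeight (P n) X (fun t => t + m * v t) s := by
  -- If `s` is its own successor, as at the terminal time, both sides vanish.
  rcases (le_succIn (P n) s).eq_or_lt with heq | hlt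
  · rw [remainder, sum_derivIdx]
    simp [gridIncr, gridWeight, ← heq]
  have hη : 0 ≤ η := by
    simpa using hoscX s hs s ⟨le_rfl, hlt.le⟩ s ⟨le_rfl, hlt.le⟩
  have hs'T : succIn (P n) s ∈ Icc 0 T := hP.succIn_mem_Icc n hs
  have hmin : ∀ {u}, u ∈ Icc 0 T → min u s ∈ Icc 0 T := fun hu =>
    ⟨le_min hu.1 hs.1, (min_le_left _ _).trans hu.2⟩
  have hXU : ∀ u ∈ Icc 0 T, X u ∈ U := fun u hu => hKU (hXK u hu _ (by simpa))
  have hAW : IsBVPath T W A := ⟨.of_continuousOn hA fun u hu => hLW (hAL u hu _ (by simpa)), hbv⟩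
  have hAL' : IsBVPath T L A := ⟨.of_continuousOn hA fun u hu => hAL u hu _ (by simpa), hbv⟩
  set s' := succIn (P n) s with hs'
  set Δ := X s' - X s with hΔ
  set x := stepBefore (P n) X s with hx
  set Z := stepBefore (P n) X s' with hZ
  have hxU : IsCadlag T U x := isCadlag_stepBefore hP n hXU hs
  have hZU : IsCadlag T U Z := isCadlag_stepBefore hP n hXU hs'T
  have hZs : ∀ u, s ≤ u → Z u = X s' := fun u hu => stepBefore_succIn_of_ge hlt hu
  have hZl : ∀ u, u < s → Z u = X (succIn (P n) u) := fun u hu =>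
    stepBefore_of_lt (hu.trans hlt)
  have hxs : x s = X s := stepBefore_of_ge le_rfl
  have hXs' : ‖X s' - X s‖ ≤ η := hoscX s hs _ ⟨hlt.le, le_rfl⟩ _ ⟨le_rfl, hlt.le⟩
  have hXsucc : ∀ u ∈ Icc 0 T, ‖X (succIn (P n) u) - X u‖ ≤ η := fun u hu =>
    hoscX u hu _ ⟨le_succIn _ _, le_rfl⟩ _ ⟨le_rfl, le_succIn _ _⟩
  have hZnear : ∀ u ∈ Icc 0 T, ‖Z u - X (min u s)‖ ≤ η := by
    intro u hu
    rcases lt_or_ge u s with h | h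
    · rw [min_eq_left h.le, hZl u h]
      exact hXsucc u hu
    · rw [min_eq_right h, hZs u h]
      exact hXs'
  have hZK : IsCadlag T K Z := hZU.of_isClosed hK fun u hu => hXK _ (hmin hu) _ (hZnear u hu)
  have hbU : ∀ θ ∈ Icc (0 : ℝ) 1, x s + θ • Δ ∈ K := by
    intro θ hθ
    refine hXK s hs _ ?_
    rw [hxs, add_sub_cancel_left, norm_smul, Real.norm_eq_abs, abs_of_nonneg hθ.1]
    exact (mul_le_of_le_one_left (norm_nonneg _) hθ.2).trans hXs'
  have hbnear : ∀ θ ∈ Icc (0 : ℝ) 1, ∀ u ∈ Icc 0 T, ‖bump s (θ • Δ) x u - X (min u s)‖ ≤ η := by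
    intro θ hθ u hu
    rcases lt_or_ge u s with h | h
    · rw [min_eq_left h.le, bump_of_lt _ _ hu.1 h, hx, stepBefore_of_lt h]
      exact hXsucc u hu
    · rw [min_eq_right h, bump_of_ge _ _ hs.1 h, hxs, add_sub_cancel_left, norm_smul,
        Real.norm_eq_abs, abs_of_nonneg hθ.1]
      exact (mul_le_of_le_one_left (norm_nonneg _) hθ.2).trans hXs'
  -- Horizontal part: from `s` to `s'` along `Z`, which is constant from `s` on.
  have hhor := abs_horizontal_increment_le (s := s) (s' := s') hG hc hD₀ hD hs.1 hlt.le hs'T.2 hA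
    hbv hv hZU (fun u hu => by rw [hZs u hu, hZs s le_rfl]) hLW hL hAL (hoscA s hs) hε
    (a := κ none) (b := fun k => κ (some (Sum.inl k)))
    (fun t ht C hC hCn => ⟨hbd t ht Z C hZK hC hZnear hCn none, fun k =>
      hbd t ht Z C hZK hC hZnear hCn (some (Sum.inl k))⟩)
  -- The vertical expansion is made with `A` stopped at `s`, because `hbd` requires closeness to
  -- `A(· ∧ s)` on all of `[0, T]`. Non-anticipativity undoes this in `e1`, `e2` and `e3`.
  have hstopA : ∀ u ∈ Icc 0 T, ‖stopAt s A u - A (min u s)‖ ≤ η := fun u hu => by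
    rwa [stopAt_apply A hs.1 hu.1, sub_self, norm_zero]
  have hver := vertical_taylor hU hG hv₁ hv₂ hs hxU (hAW.stopAt hs) Δ
    (fun θ hθ => hKU (hbU θ hθ)) (γ := fun i j => κ (some (Sum.inr (i, j)))) (ε := ε)
    (fun θ hθ i j => hbd s ⟨le_rfl, hlt.le⟩ _ _
      ((hxU.bump hs (hKU (hbU θ hθ))).of_isClosed hK fun u hu =>
        hXK _ (hmin hu) _ (hbnear θ hθ u hu)) (hAL'.stopAt hs) (hbnear θ hθ) hstopA
      (some (Sum.inr (i, j))))
  have hAe : EqOn (stopAt s A) A (Icc 0 s) := fun u hu => stopAt_of_le A hu.1 hu.2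
  have hb1 : IsCadlag T U (bump s Δ x) := hxU.bump hs (by
    simpa using hKU (hbU 1 ⟨zero_le_one, le_rfl⟩))
  -- The vertical part ends where the horizontal part starts: the bumped path and `Z` agree up to
  -- time `s`.
  have e1 : G s (bump s Δ x) (stopAt s A) = G s Z A := by
    refine hG.congr hs hb1 hZU (hAW.stopAt hs) hAW (fun u hu => ?_) hAe
    rcases hu.2.eq_or_lt with h | h
    · rw [h, bump_of_ge _ _ hs.1 le_rfl, hxs, hZs s le_rfl, hΔ, add_sub_cancel]
    · rw [bump_of_lt _ _ hu.1 h, hZl u h, hx, stepBefore_of_lt h]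
  have e2 : G s x (stopAt s A) = G s x A :=
    hG.congr hs hxU hxU (hAW.stopAt hs) hAW (fun _ _ => rfl) hAe
  have e3 : ∀ i, vderiv i G s x (stopAt s A) = vderiv i G s x A := fun i =>
    (nonAnticipative_vderiv hU hG i).congr hs hxU hxU (hAW.stopAt hs) hAW (fun _ _ => rfl) hAe
  simp only [e1, e2, e3] at hver
  have hquad := mul_le_mul_of_nonneg_left (sum_abs_mul_le fun i => Δ i) hε
  have hΔi : ∀ i, Δ i = X s' i - X s i := fun i => rfl
  simp only [hΔi] at hver hquad
  rw [remainder, sum_derivIdx, gridWeight]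
  simp only [gridIncr, gridValue]
  have hhalf : (∑ i, ∑ j, κ (some (Sum.inr (i, j))) * ((X s' i - X s i) * (X s' j - X s j))) / 2
      = ∑ i, ∑ j, κ (some (Sum.inr (i, j))) * ((X s' i - X s i) * (X s' j - X s j) / 2) := by
    simp only [Finset.sum_div, mul_div_assoc]
  rw [hhalf] at hver
  have hadd := (abs_add_le _ _).trans (add_le_add hhor (hver.trans hquad))
  refine le_trans (le_of_eq ?_) (hadd.trans (le_of_eq ?_))
  · congr 1
    ring
  · ring

end Increments

/-! ### Convergence of the sums of remainders -/

section Remainders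

variable {d m : ℕ} {T : ℝ} {P : ℕ → Finset ℝ} {X : ℝ → E d} {z : ℝ → ℝ}

theorem abs_mul_le_gridWeight {Q : Finset ℝ} {s : ℝ} (hz : z s ≤ z (succIn Q s)) (i j : Fin d) :
    |(X (succIn Q s) i - X s i) * (X (succIn Q s) j - X s j)| ≤ gridWeight Q X z s := by
  have h1 := sum_abs_mul_le fun i => X (succIn Q s) i - X s i
  have h2 : |(X (succIn Q s) i - X s i) * (X (succIn Q s) j - X s j)| ≤
      ∑ i, ∑ j, |(X (succIn Q s) i - X s i) * (X (succIn Q s) j - X s j)| := by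
    refine le_trans ?_ (Finset.single_le_sum (f := fun i => ∑ j,
      |(X (succIn Q s) i - X s i) * (X (succIn Q s) j - X s j)|)
      (fun _ _ => Finset.sum_nonneg fun _ _ => abs_nonneg _) (Finset.mem_univ i))
    exact Finset.single_le_sum
      (f := fun j => |(X (succIn Q s) i - X s i) * (X (succIn Q s) j - X s j)|)
      (fun _ _ => abs_nonneg _) (Finset.mem_univ j)
  rw [gridWeight]
  linarith

theorem sub_le_gridWeight (Q : Finset ℝ) (X : ℝ → E d) (z : ℝ → ℝ) (s : ℝ) :
    z (succIn Q s) - z s ≤ gridWeight Q X z s :=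
  le_add_of_nonneg_right (mul_nonneg (Nat.cast_nonneg _)
    (Finset.sum_nonneg fun _ _ => mul_self_nonneg _))

/-- The increments of `z` telescope and the squared increments of `X` sum to the quadratic
variations, so the limit is continuous by continuity of `z` and of the covariations. Maximal weights
vanish by uniform continuity. -/
theorem exists_isWeight (hP : IsRefiningSeq T P) (hX : ContinuousOn X (Icc 0 T))
    (hcov : HasContinuousCovariations T P X) (hz : ContinuousOn z (Icc 0 T))
    (hmono : MonotoneOn z (Icc 0 T)) :
    ∃ c, IsWeight T P (fun n => gridWeight (P n) X z) c := by
  choose c hc hlim using hcov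
  have hzs : ∀ n, ∀ s ∈ P n, z s ≤ z (succIn (P n) s) := fun n s hs =>
    hmono (hP.subset n s hs) (hP.subset n _ (succIn_mem hs)) (le_succIn _ _)
  refine ⟨fun t => z t - z 0 + d * ∑ i, c i i t, ⟨fun n s hs => ?_, fun ε hε => ?_, ?_, ?_⟩⟩
  · exact (sub_nonneg.2 (hzs n s hs)).trans (sub_le_gridWeight _ _ _ _)
  · set ε₁ := min 1 (ε / (1 + d * d)) with hε₁
    have hpos : 0 < ε₁ := lt_min one_pos (by positivity)
    filter_upwards [hP.norm_sub_succIn_le hX hpos, hP.norm_sub_succIn_le hz hpos] with n hn hn' s hs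
    have hsT := hP.subset n s hs
    have h1 := hn s hsT _ ⟨le_succIn _ _, le_rfl⟩ _ ⟨le_rfl, le_succIn _ _⟩
    have h2 := hn' s hsT _ ⟨le_succIn _ _, le_rfl⟩ _ ⟨le_rfl, le_succIn _ _⟩
    have h3 : ∀ i, (X (succIn (P n) s) i - X s i) * (X (succIn (P n) s) i - X s i) ≤ ε₁ := by
      intro i
      have h4 : |X (succIn (P n) s) i - X s i| ≤ ε₁ :=
        (abs_apply_le_norm (X (succIn (P n) s) - X s) i).trans h1
      have h5 : ε₁ ≤ 1 := min_le_left _ _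
      rw [← abs_mul_abs_self]
      nlinarith [abs_nonneg (X (succIn (P n) s) i - X s i)]
    have h6 := Finset.sum_le_card_nsmul Finset.univ _ _ fun i _ => h3 i
    rw [Finset.card_univ, Fintype.card_fin, nsmul_eq_mul] at h6
    have h7 : ε₁ * (1 + d * d) ≤ ε := (le_div_iff₀ (by positivity)).1 (min_le_right _ _)
    have h8 := mul_le_mul_of_nonneg_left h6 (Nat.cast_nonneg (α := ℝ) d)
    rw [gridWeight]
    have h9 := (le_abs_self _).trans h2
    nlinarith
  · exact (hz.sub continuousOn_const).add (continuousOn_const.mul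
      (continuousOn_finsetSum _ fun i _ => hc i i))
  · intro t ht
    have h1 : Tendsto (fun n => z (succIn (P n) t) - z 0) atTop (𝓝 (z t - z 0)) :=
      ((hz t ht).tendsto.comp (hP.tendsto_succIn ht)).sub_const _
    have h2 := (tendsto_finsetSum (Finset.univ : Finset (Fin d)) fun i _ =>
      hlim i i t ht).const_mul (d : ℝ)
    refine (h1.add h2).congr fun n => ?_
    change _ = psum (P n) (fun s => (z (succIn (P n) s) - z s) + d * ∑ i,
      (X (succIn (P n) s) i - X s i) * (X (succIn (P n) s) i - X s i)) t
    rw [psum_add, hP.psum_telescope n z ht, psum_mul_left, psum_sum]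
    rfl

end Remainders

/-! ### Local approximation and convergence of the remainders -/

section RemainderSums

variable {d m : ℕ} {T : ℝ} {P : ℕ → Finset ℝ} {U : Set (E d)} {W : Set (E m)} {X : ℝ → E d}
  {A : ℝ → E m} {G : Functional d m} {v z : ℝ → ℝ}

theorem IsC12.exists_derivs (hG : IsC12 T U W G) : ∃ (D₀ : Functional d m)
    (D : Fin m → Functional d m), HasTimeDeriv T U W G D₀ ∧
      (∀ k, HasHorizontalDeriv T U W k G (D k)) ∧ ∀ l, IsTame T U W (derivs G D₀ D l) := by
  obtain ⟨D₀, -, hD₀, ht₀⟩ := hG.time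
  choose D hD using hG.horizontal
  refine ⟨D₀, D, hD₀, fun k => (hD k).2.1, ?_⟩
  rintro (_ | k | ⟨i, j⟩)
  · exact ht₀
  · exact (hD k).2.2
  · exact hG.vertical₂_tame j i

/-- A continuous path in an open set stays in the interior of a compact subset. -/
theorem exists_compact_nhd {n : ℕ} {V : Set (E n)} (hV : IsOpen V) {Y : ℝ → E n}
    (hY : ContinuousOn Y (Icc 0 T)) (hYV : ∀ u ∈ Icc 0 T, Y u ∈ V) :
    ∃ η > 0, ∃ K ⊆ V, IsCompact K ∧ ∀ u ∈ Icc 0 T, ∀ x, ‖x - Y u‖ ≤ η → x ∈ K := by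
  have hc : IsCompact (Y '' Icc 0 T) := isCompact_Icc.image_of_continuousOn hY
  obtain ⟨η, hη, hsub⟩ := hc.exists_cthickening_subset_open hV (image_subset_iff.2 hYV)
  refine ⟨η, hη, _, hsub, hc.cthickening, fun u hu x hx => ?_⟩
  rw [← dist_eq_norm] at hx
  exact Metric.mem_cthickening_of_dist_le x (Y u) η _ (mem_image_of_mem _ hu) hx

/-- Continuous functions `v` and `z` that dominate the increments of the path `A` and of time. -/
structure IsClock (T : ℝ) (A : ℝ → E m) (v z : ℝ → ℝ) : Prop where
  cont : ContinuousOn z (Icc 0 T)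
  norm_sub_le : ∀ x ∈ Icc 0 T, ∀ y ∈ Icc 0 T, x ≤ y → ‖A y - A x‖ ≤ v y - v x
  le : ∀ x ∈ Icc 0 T, ∀ y ∈ Icc 0 T, x ≤ y → y - x + (m + 1) * (v y - v x) ≤ z y - z x

namespace IsClock

theorem sub_nonneg (hz : IsClock T A v z) {x y : ℝ} (hx : x ∈ Icc 0 T) (hy : y ∈ Icc 0 T)
    (hxy : x ≤ y) : 0 ≤ v y - v x := (norm_nonneg _).trans (hz.norm_sub_le x hx y hy hxy)

theorem monotoneOn (hz : IsClock T A v z) : MonotoneOn z (Icc 0 T) := fun x hx y hy hxy => by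
  have h1 := hz.le x hx y hy hxy
  have h2 := hz.sub_nonneg hx hy hxy
  have h3 : 0 ≤ ((m : ℝ) + 1) * (v y - v x) := by positivity
  linarith

theorem gridWeight_le (hz : IsClock T A v z) (hP : IsRefiningSeq T P) {n : ℕ} {s : ℝ}
    (hs : s ∈ P n) :
    gridWeight (P n) X (fun t => t + m * v t) s ≤ gridWeight (P n) X z s := by
  have hs' := hP.subset n _ (succIn_mem hs)
  have h1 := hz.le s (hP.subset n s hs) _ hs' (le_succIn _ _)
  have h2 := hz.sub_nonneg (hP.subset n s hs) hs' (le_succIn _ _)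
  rw [gridWeight, gridWeight]
  linarith

/-- The coefficient `m + 1` in `IsClock.le` leaves, beyond the `m v` used in `gridWeight_le`, one
unit of `v` for the increment of a single component of `A`. -/
theorem abs_gridIncr_le (hz : IsClock T A v z) (hP : IsRefiningSeq T P) {n : ℕ} {s : ℝ}
    (hs : s ∈ P n) (l : DerivIdx d m) :
    |gridIncr (P n) X A l s| ≤ gridWeight (P n) X z s := by
  have hsT := hP.subset n s hs
  have hs' := hP.subset n _ (succIn_mem hs)
  have h1 := hz.le s hsT _ hs' (le_succIn _ _)
  have h2 := hz.sub_nonneg hsT hs' (le_succIn _ _)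
  have h3 := sub_le_gridWeight (P n) X z s
  have h4 : 0 ≤ (m : ℝ) * (v (succIn (P n) s) - v s) := by positivity
  have h5 := le_succIn (P n) s
  rcases l with _ | k | ⟨i, j⟩
  · rw [gridIncr, abs_of_nonneg (_root_.sub_nonneg.2 h5)]
    linarith
  · have h6 := (abs_apply_le_norm (A (succIn (P n) s) - A s) k).trans
      (hz.norm_sub_le s hsT _ hs' h5)
    refine h6.trans ?_
    linarith
  · rw [gridIncr, abs_div, abs_two]
    have := abs_mul_le_gridWeight (X := X) (hz.monotoneOn hsT hs' h5) i j
    linarith [abs_nonneg ((X (succIn (P n) s) i - X s i) * (X (succIn (P n) s) j - X s j))]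

end IsClock

theorem exists_tendsto_psum_gridIncr (hP : IsRefiningSeq T P)
    (hcov : HasContinuousCovariations T P X) (hA : ContinuousOn A (Icc 0 T)) (l : DerivIdx d m) :
    ∃ β : ℝ → ℝ, ∀ t ∈ Icc 0 T,
      Tendsto (fun n => psum (P n) (gridIncr (P n) X A l) t) atTop (𝓝 (β t)) := by
  rcases l with _ | k | ⟨i, j⟩
  · refine ⟨fun t => t - 0, fun t ht => ?_⟩
    refine Tendsto.congr (fun n => (hP.psum_telescope n id ht).symm) ?_
    exact ((hP.tendsto_succIn ht).mono_right nhdsWithin_le_nhds).sub_const 0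
  · refine ⟨fun t => A t k - A 0 k, fun t ht => ?_⟩
    refine Tendsto.congr (fun n => (hP.psum_telescope n (fun t => A t k) ht).symm) ?_
    exact (((EuclideanSpace.proj k : E m →L[ℝ] ℝ).continuous.tendsto _).comp
      ((hA t ht).tendsto.comp (hP.tendsto_succIn ht))).sub_const _
  · obtain ⟨c, -, hc⟩ := hcov i j
    refine ⟨fun t => c t / 2, fun t ht => ((hc t ht).div_const 2).congr fun n => ?_⟩
    rw [psum, Finset.sum_div]
    rfl

theorem eventually_osc_le (hP : IsRefiningSeq T P) (hX : ContinuousOn X (Icc 0 T))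
    (hA : ContinuousOn A (Icc 0 T)) {η : ℝ} (hη : 0 < η) : ∀ᶠ n in atTop,
    (∀ s ∈ Icc 0 T, ∀ x ∈ Icc s (succIn (P n) s), ∀ y ∈ Icc s (succIn (P n) s),
      ‖X x - X y‖ ≤ η) ∧
    ∀ s ∈ Icc 0 T, ∀ x ∈ Icc s (succIn (P n) s), ∀ y ∈ Icc s (succIn (P n) s),
      m * ‖A x - A y‖ ≤ η := by
  have hη' : 0 < η / (m + 1) := by positivity
  filter_upwards [hP.norm_sub_succIn_le hX hη, hP.norm_sub_succIn_le hA hη'] with n h1 h2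
  refine ⟨h1, fun s hs x hx y hy => ?_⟩
  have := h2 s hs x hx y hy
  rw [le_div_iff₀ (by positivity)] at this
  linarith [norm_nonneg (A x - A y)]

/-- The remainders are dominated by the weights. -/
theorem exists_abs_remainder_le (hP : IsRefiningSeq T P) (hU : IsOpen U) (hW : IsOpen W)
    (hG : IsC12 T U W G) (hX : ContinuousOn X (Icc 0 T)) (hXU : ∀ u ∈ Icc 0 T, X u ∈ U)
    (hA : IsCBVPath T W A) (hz : IsClock T A v z) :
    ∃ B, 0 ≤ B ∧ ∀ᶠ n in atTop, ∀ s ∈ P n,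
      |remainder (P n) G X A s| ≤ B * gridWeight (P n) X z s := by
  obtain ⟨D₀, D, hD₀, hD, hder⟩ := hG.exists_derivs
  obtain ⟨η₁, hη₁, K, hKU, hK, hXK⟩ := exists_compact_nhd hU hX hXU
  obtain ⟨η₂, hη₂, L, hLW, hL, hAL⟩ := exists_compact_nhd hW hA.cont hA.mem
  choose C hC using fun l => (hder l).bdd K hKU hK L hLW hL
  set B := ∑ l, |C l| with hB
  have hB0 : 0 ≤ B := Finset.sum_nonneg fun _ _ => abs_nonneg _
  refine ⟨B, hB0, ?_⟩
  filter_upwards [eventually_osc_le hP hX hA.cont (lt_min hη₁ hη₂)] with n hn s hs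
  have hsT := hP.subset n s hs
  -- With zero coefficients the expansion is a crude bound; `B` adds up the bounds of all
  -- derivatives on paths in the compact neighbourhoods `K` and `L`.
  have := abs_remainder_sub_le (κ := 0) hP hU hG.nonAnticipative hG.continuous hD₀ hD hG.vertical
    hG.vertical₂ hA.cont hA.bv hz.norm_sub_le hKU hK.isClosed hLW hL.isClosed
    (fun u hu x hx => hXK u hu x (hx.trans (min_le_left _ _)))
    (fun u hu x hx => hAL u hu x (hx.trans (min_le_right _ _))) hn.1 hn.2 hsT hB0
    (fun t ht Y C' hY hC' _ _ l => by
      rw [Pi.zero_apply, sub_zero]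
      refine (hC l t ⟨hsT.1.trans ht.1, ht.2.trans (hP.succIn_le n hsT.2)⟩ Y C' hY hC').trans ?_
      exact (le_abs_self _).trans (Finset.single_le_sum (f := fun l => |C l|)
        (fun _ _ => abs_nonneg _) (Finset.mem_univ l)))
  simp only [Pi.zero_apply, zero_mul, Finset.sum_const_zero, sub_zero] at this
  exact this.trans (mul_le_mul_of_nonneg_left (hz.gridWeight_le hP hs) hB0)

theorem exists_pos_forall {ι : Type*} [Finite ι] {p : ι → ℝ → Prop}
    (hp : ∀ i x y, 0 < x → x ≤ y → p i y → p i x) (h : ∀ i, ∃ x > 0, p i x) :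
    ∃ x > 0, ∀ i, p i x := by
  have hev : ∀ i, ∀ᶠ x in 𝓝[>] (0 : ℝ), p i x := fun i => by
    obtain ⟨y, hy, hpy⟩ := h i
    filter_upwards [Ioo_mem_nhdsGT hy] with x hx
    exact hp i x y hx.1 hx.2.le hpy
  obtain ⟨x, hx, hx0⟩ := ((eventually_all.2 hev).and self_mem_nhdsWithin).exists
  exact ⟨x, hx0, hx⟩

/-- Near each time, from the left, the remainders are combinations of the increments of time, of
`A` and of the covariations. -/
theorem locallyApprox_remainder (hP : IsRefiningSeq T P) (hU : IsOpen U) (hW : IsOpen W)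
    (hG : IsC12 T U W G) (hX : ContinuousOn X (Icc 0 T)) (hXU : ∀ u ∈ Icc 0 T, X u ∈ U)
    (hA : IsCBVPath T W A) (hz : IsClock T A v z) :
    LocallyApprox T P (fun n => gridWeight (P n) X z) (fun n => remainder (P n) G X A)
      (fun (l : DerivIdx d m) n => gridIncr (P n) X A l) := by
  intro u hu ε hε
  have huT : u ∈ Icc 0 T := ⟨hu.1.le, hu.2⟩
  obtain ⟨D₀, D, hD₀, hD, hder⟩ := hG.exists_derivs
  obtain ⟨η₁, hη₁, K, hKU, hK, hXK⟩ := exists_compact_nhd hU hX hXU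
  obtain ⟨η₂, hη₂, L, hLW, hL, hAL⟩ := exists_compact_nhd hW hA.cont hA.mem
  -- A common radius for the left-continuity at `u` of all the finitely many derivatives.
  obtain ⟨η₃, hη₃, hclose⟩ := exists_pos_forall (fun l x y _ hxy hy t' ht' hd X' A' hX' hA' h1 h2 =>
      hy t' ht' (hd.trans hxy) X' A' hX' hA' (fun r hr => (h1 r hr).trans hxy)
        fun r hr => (h2 r hr).trans hxy)
    (fun l => (hder l).left.exists_close huT (.of_continuousOn hX hXU) hA.isBVPath hε)
  have hη₃' : 0 < η₃ / 2 := half_pos hη₃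
  set η := min (min η₁ η₂) (η₃ / 2) with hηdef
  have hη : 0 < η := lt_min (lt_min hη₁ hη₂) hη₃'
  obtain ⟨δ₁, hδ₁, hucX⟩ := Metric.uniformContinuousOn_iff.1
    (isCompact_Icc.uniformContinuousOn_of_continuous hX) _ hη₃'
  obtain ⟨δ₂, hδ₂, hucA⟩ := Metric.uniformContinuousOn_iff.1
    (isCompact_Icc.uniformContinuousOn_of_continuous hA.cont) _ hη₃'
  refine ⟨min η₃ (min δ₁ δ₂), lt_min hη₃ (lt_min hδ₁ hδ₂), fun l => derivs G D₀ D l u X A, ?_⟩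
  filter_upwards [eventually_osc_le hP hX hA.cont hη] with n hn s hs hsu hs'u
  have hsT := hP.subset n s hs
  have hd3 : u - s ≤ η₃ := by linarith [min_le_left η₃ (min δ₁ δ₂)]
  have hd1 : u - s < δ₁ := by
    linarith [(min_le_right η₃ (min δ₁ δ₂)).trans (min_le_left _ _)]
  have hd2 : u - s < δ₂ := by
    linarith [(min_le_right η₃ (min δ₁ δ₂)).trans (min_le_right _ _)]
  have hsu' : s ≤ u := (le_succIn _ _).trans hs'u.le
  have hmin : ∀ {r w : ℝ}, w ∈ Icc 0 T → r ∈ Icc 0 T → min r w ∈ Icc 0 T := fun hw hr =>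
    ⟨le_min hr.1 hw.1, (min_le_left _ _).trans hr.2⟩
  have hdist : ∀ r : ℝ, dist (min r u) (min r s) ≤ u - s := fun r => by
    rw [Real.dist_eq]
    refine (abs_min_sub_min_le_max r u r s).trans ?_
    rw [sub_self, abs_zero, abs_of_nonneg (sub_nonneg.2 hsu')]
    exact max_le (sub_nonneg.2 hsu') le_rfl
  -- Half of `η₃` pays for moving the stopping time from `u` to `s`, the other half for the distance
  -- of `Y'` to the path stopped at `s`. Since `t ≤ succIn (P n) s < u`, left-continuity is enough
  -- to compare times.
  have hfreeze : ∀ {k : ℕ} (Y Y' : ℝ → E k), (∀ r ∈ Icc 0 T, dist (Y (min r u)) (Y (min r s)) ≤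
      η₃ / 2) → (∀ r ∈ Icc 0 T, ‖Y' r - Y (min r s)‖ ≤ η) → ∀ t ∈ Icc s (succIn (P n) s),
      ∀ r ∈ Icc 0 T, ‖stopAt u Y r - stopAt t Y' r‖ ≤ η₃ := by
    intro k Y Y' h1 h2 t ht r hr
    have htT : t ∈ Icc 0 T := ⟨hsT.1.trans ht.1, ht.2.trans (hP.succIn_le n hsT.2)⟩
    rw [stopAt_apply Y huT.1 hr.1, stopAt_apply Y' htT.1 hr.1]
    have h3 := h2 (min r t) (hmin htT hr)
    rw [min_assoc, min_eq_right ht.1] at h3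
    have h4 := h1 r hr
    rw [dist_eq_norm] at h4
    rw [norm_sub_rev] at h3
    have h5 := norm_add_le (Y (min r u) - Y (min r s)) (Y (min r s) - Y' (min r t))
    rw [sub_add_sub_cancel] at h5
    have h6 : η ≤ η₃ / 2 := min_le_right _ _
    linarith
  have := abs_remainder_sub_le (κ := fun l => derivs G D₀ D l u X A) hP hU hG.nonAnticipative
    hG.continuous hD₀ hD hG.vertical
    hG.vertical₂ hA.cont hA.bv hz.norm_sub_le hKU hK.isClosed hLW hL.isClosed
    (fun u hu x hx => hXK u hu x (hx.trans ((min_le_left _ _).trans (min_le_left _ _))))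
    (fun u hu x hx => hAL u hu x (hx.trans ((min_le_left _ _).trans (min_le_right _ _))))
    hn.1 hn.2 hsT hε.le
    (fun t ht Y C' hY hC' hYn hCn l => by
      rw [abs_sub_comm]
      refine hclose l t ⟨hsT.1.trans ht.1, ht.2.trans_lt hs'u⟩ (by linarith [ht.1]) Y C'
        (hY.mono hKU) ⟨hC'.cadlag.mono hLW, hC'.bv⟩ (hfreeze X Y (fun r hr => ?_) hYn t ht)
        (hfreeze A C' (fun r hr => ?_) hCn t ht)
      · exact (hucX _ (hmin huT hr) _ (hmin hsT hr) ((hdist r).trans_lt hd1)).le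
      · exact (hucA _ (hmin huT hr) _ (hmin hsT hr) ((hdist r).trans_lt hd2)).le)
  exact this.trans (mul_le_mul_of_nonneg_left (hz.gridWeight_le hP hs) hε.le)

/-- The sums of the remainders converge. -/
theorem exists_tendsto_psum_remainder (hP : IsRefiningSeq T P) (hU : IsOpen U) (hW : IsOpen W)
    (hG : IsC12 T U W G) (hX : ContinuousOn X (Icc 0 T)) (hXU : ∀ u ∈ Icc 0 T, X u ∈ U)
    (hcov : HasContinuousCovariations T P X)
    (hA : IsCBVPath T W A) (hz : IsClock T A v z) {t : ℝ} (ht : t ∈ Icc 0 T) :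
    ∃ R, Tendsto (fun n => psum (P n) (remainder (P n) G X A) t) atTop (𝓝 R) := by
  obtain ⟨c, hc⟩ := exists_isWeight hP hX hcov hz.cont hz.monotoneOn
  obtain ⟨B, hB, hrem⟩ := exists_abs_remainder_le hP hU hW hG hX hXU hA hz
  choose β hβ using exists_tendsto_psum_gridIncr (d := d) hP hcov hA.cont
  have hle : ∀ n, ∀ s ∈ P n, gridWeight (P n) X z s ≤ max B 1 * gridWeight (P n) X z s :=
    fun n s hs => le_mul_of_one_le_left (hc.nonneg n s hs) (le_max_right _ _)
  refine hc.exists_tendsto_psum hP (hB.trans (le_max_left B 1)) ?_ (fun l => ?_)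
    (locallyApprox_remainder hP hU hW hG hX hXU hA hz) hβ ht
  · filter_upwards [hrem] with n hn s hs
    exact (hn s hs).trans (mul_le_mul_of_nonneg_right (le_max_left _ _) (hc.nonneg n s hs))
  · exact Eventually.of_forall fun n s hs => (hz.abs_gridIncr_le hP hs l).trans (hle n s hs)

/-- The values of a continuous functional along the step paths converge uniformly. -/
theorem gridValue_close (hP : IsRefiningSeq T P) (hG : ContinuousFunctional T U W G)
    (hX : ContinuousOn X (Icc 0 T)) (hXU : ∀ u ∈ Icc 0 T, X u ∈ U)
    (hA : IsCBVPath T W A) {ε : ℝ} (hε : 0 < ε) :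
    ∀ᶠ n in atTop, ∀ s ∈ P n, |gridValue (P n) G X A s - G s X A| ≤ ε := by
  have hmin : ∀ {r w : ℝ}, w ∈ Icc 0 T → r ∈ Icc 0 T → min r w ∈ Icc 0 T := fun hw hr =>
    ⟨le_min hr.1 hw.1, (min_le_left _ _).trans hr.2⟩
  have hXc : IsCadlag T U X := .of_continuousOn hX hXU
  -- The radius of continuity depends on the time, so the estimate is proved near each time and
  -- patched together by compactness of `[0, T]`.
  suffices H : ∃ V ∈ 𝓝ˢ (Icc 0 T), ∀ᶠ n in atTop, ∀ s ∈ P n, s ∈ V →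
      |gridValue (P n) G X A s - G s X A| ≤ ε by
    obtain ⟨V, hV, h⟩ := H
    filter_upwards [h] with n hn s hs
    exact hn s hs (subset_of_mem_nhdsSet hV (hP.subset n s hs))
  refine isCompact_Icc.induction_on (p := fun S => ∃ V ∈ 𝓝ˢ S, ∀ᶠ n in atTop, ∀ s ∈ P n, s ∈ V →
      |gridValue (P n) G X A s - G s X A| ≤ ε) ?_ ?_ ?_ ?_
  · exact ⟨∅, by simp, Eventually.of_forall fun n s _ hs => absurd hs (notMem_empty s)⟩
  · rintro S S' hSS' ⟨V, hV, h⟩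
    exact ⟨V, nhdsSet_mono hSS' hV, h⟩
  · rintro S S' ⟨V, hV, h⟩ ⟨V', hV', h'⟩
    refine ⟨V ∪ V', union_mem_nhdsSet hV hV', ?_⟩
    filter_upwards [h, h'] with n hn hn' s hs hsV
    exact hsV.elim (hn s hs) (hn' s hs)
  · intro u hu
    obtain ⟨η, hη, hclose⟩ := hG.exists_close hu hXc hA.isBVPath (half_pos hε)
    obtain ⟨δ₁, hδ₁, hucX⟩ := Metric.uniformContinuousOn_iff.1
      (isCompact_Icc.uniformContinuousOn_of_continuous hX) _ (half_pos hη)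
    obtain ⟨δ₂, hδ₂, hucA⟩ := Metric.uniformContinuousOn_iff.1
      (isCompact_Icc.uniformContinuousOn_of_continuous hA.cont) _ (half_pos hη)
    set δ := min η (min δ₁ δ₂) with hδ
    have hδ0 : 0 < δ := lt_min hη (lt_min hδ₁ hδ₂)
    refine ⟨Icc 0 T ∩ Metric.ball u δ, inter_mem_nhdsWithin _ (Metric.ball_mem_nhds u hδ0),
      Metric.ball u δ, Metric.isOpen_ball.mem_nhdsSet.2 inter_subset_right, ?_⟩
    filter_upwards [hP.norm_sub_succIn_le hX (half_pos hη)] with n hn s hs hsu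
    have hsT := hP.subset n s hs
    have hdist : ∀ r : ℝ, dist (min r u) (min r s) < δ := fun r => by
      refine lt_of_le_of_lt ?_ hsu
      rw [dist_comm s u, Real.dist_eq, Real.dist_eq]
      refine (abs_min_sub_min_le_max r u r s).trans ?_
      rw [sub_self, abs_zero]
      exact max_le (abs_nonneg _) le_rfl
    have hus : |u - s| ≤ η := by
      rw [← Real.dist_eq, dist_comm]
      exact (Metric.mem_ball.1 hsu).le.trans (min_le_left _ _)
    have hXn : ∀ r ∈ Icc 0 T, ‖X (min r u) - X (min r s)‖ ≤ η / 2 := fun r hr => by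
      rw [← dist_eq_norm]
      exact (hucX _ (hmin hu hr) _ (hmin hsT hr) ((hdist r).trans_le
        ((min_le_right _ _).trans (min_le_left _ _)))).le
    have hAn : ∀ r ∈ Icc 0 T, ‖stopAt u A r - stopAt s A r‖ ≤ η := fun r hr => by
      rw [stopAt_apply A hu.1 hr.1, stopAt_apply A hsT.1 hr.1, ← dist_eq_norm]
      exact (hucA _ (hmin hu hr) _ (hmin hsT hr) ((hdist r).trans_le
        ((min_le_right _ _).trans (min_le_right _ _)))).le.trans (half_le_self hη.le)
    have h1 := hclose s hsT hus X A hXc hA.isBVPath (fun r hr => by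
      rw [stopAt_apply X hu.1 hr.1, stopAt_apply X hsT.1 hr.1]
      exact (hXn r hr).trans (half_le_self hη.le)) hAn
    have h2 := hclose s hsT hus (stepBefore (P n) X s) A (isCadlag_stepBefore hP n hXU hsT)
      hA.isBVPath (fun r hr => by
        rw [stopAt_apply X hu.1 hr.1, stopAt_apply _ hsT.1 hr.1]
        have h3 : ‖X (min r s) - stepBefore (P n) X s (min r s)‖ ≤ η / 2 := by
          rcases lt_or_ge (min r s) s with h | h
          · rw [stepBefore_of_lt h]
            exact hn _ (hmin hsT hr) _ ⟨le_rfl, le_succIn _ _⟩ _ ⟨le_succIn _ _, le_rfl⟩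
          · rw [stepBefore_of_ge h, le_antisymm (min_le_right r s) h, sub_self, norm_zero]
            exact (half_pos hη).le
        have h4 := norm_add_le (X (min r u) - X (min r s))
          (X (min r s) - stepBefore (P n) X s (min r s))
        rw [sub_add_sub_cancel] at h4
        linarith [hXn r hr]) hAn
    rw [gridValue]
    have h3 := abs_add_le (-(G u X A - G s (stepBefore (P n) X s) A)) (G u X A - G s X A)
    rw [abs_neg] at h3
    refine le_trans (le_of_eq ?_) (h3.trans (by linarith))
    congr 1
    ring

end RemainderSums

/-! ### Lebesgue-Stieltjes integrals of continuous functions -/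

theorem continuous_stopAt {T : ℝ} (hT : 0 ≤ T) {g : ℝ → ℝ} (hg : ContinuousOn g (Icc 0 T)) :
    Continuous (stopAt T g) :=
  hg.comp_continuous (by fun_prop) fun _ => ⟨le_max_left _ _, max_le hT (min_le_right _ _)⟩

/-- The Lebesgue-Stieltjes integral of a continuous function `f` with respect to a continuous
function `g` of bounded variation is controlled by the variation `w` of `g`. -/
theorem exists_stieltjes_control {T : ℝ} (hT : 0 ≤ T) {f g : ℝ → ℝ}
    (hf : ContinuousOn f (Icc 0 T)) (hg : ContinuousOn g (Icc 0 T))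
    (hbv : BoundedVariationOn g (Icc 0 T)) :
    StieltjesIntegrable T f g ∧ stieltjesIntegral T f g 0 = 0 ∧ ∃ w : ℝ → ℝ, Continuous w ∧
      ∀ x ∈ Icc 0 T, ∀ y ∈ Icc 0 T, x ≤ y → |g y - g x| ≤ w y - w x ∧
        ∀ C, (∀ r ∈ Ioc x y, |f r - f x| ≤ C) →
          |stieltjesIntegral T f g y - stieltjesIntegral T f g x - f x * (g y - g x)|
            ≤ C * (w y - w x) := by
  have hbv' := boundedVariationOn_stopAt hT hbv
  have hcont := continuous_stopAt hT hg
  set M : SignedMeasure ℝ := hbv'.vectorMeasure with hM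
  have hfin : IsFiniteMeasure M.variation := by
    rw [← SignedMeasure.totalVariation_eq_variation]
    infer_instance
  have hIoc : ∀ x ∈ Icc 0 T, ∀ y ∈ Icc 0 T, x ≤ y → M (Ioc x y) = g y - g x := by
    intro x hx y hy hxy
    rw [hM, hbv'.vectorMeasure_Ioc hxy, (hcont.continuousWithinAt).rightLim_eq,
      (hcont.continuousWithinAt).rightLim_eq, stopAt_of_le g hx.1 hx.2, stopAt_of_le g hy.1 hy.2]
  have hsing : ∀ a, M {a} = 0 := fun a => by
    rw [hM, hbv'.vectorMeasure_singleton, (hcont.continuousWithinAt).rightLim_eq,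
      (hcont.continuousWithinAt).leftLim_eq, sub_self]
  -- Continuity of `g` excludes atoms of the variation measure, which makes its primitive, the
  -- control `w`, continuous.
  have hatoms : NullSingletonClass M.variation := ⟨fun a => by
    rw [VectorMeasure.variation_apply_eq_zero (measurableSet_singleton a)]
    intro t ht ht'
    rcases subset_singleton_iff_eq.1 ht with rfl | rfl
    · exact M.empty
    · exact hsing a⟩
  have hint : M.IntegrableOn f (Icc 0 T) := by
    rw [VectorMeasure.IntegrableOn, VectorMeasure.Integrable,
      VectorMeasure.variation_restrict measurableSet_Icc]
    exact hf.integrableOn_Icc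
  have hint' : ∀ x ∈ Icc 0 T, ∀ y ∈ Icc 0 T, M.IntegrableOn f (Ioc x y) := fun x hx y hy =>
    hint.mono measurableSet_Icc fun r hr => ⟨hx.1.trans hr.1.le, hr.2.trans hy.2⟩
  have hval : ∀ t, stieltjesIntegral T f g t =
      VectorMeasure.integral (M.restrict (Ioc 0 t)) f (ContinuousLinearMap.lsmul ℝ ℝ) := fun t =>
    dif_pos hbv'
  have h0T : (0 : ℝ) ∈ Icc 0 T := ⟨le_rfl, hT⟩
  refine ⟨⟨hbv', hint⟩, ?_, fun t => ∫ _ in (0 : ℝ)..t, (1 : ℝ) ∂M.variation, ?_, ?_⟩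
  · rw [hval, Ioc_self]
    exact VectorMeasure.setIntegral_empty
  · exact (integrable_const (1 : ℝ)).continuous_primitive 0
  · intro x hx y hy hxy
    have hw : (∫ _ in (0 : ℝ)..y, (1 : ℝ) ∂M.variation) - ∫ _ in (0 : ℝ)..x, (1 : ℝ) ∂M.variation
        = M.variation.real (Ioc x y) := by
      rw [intervalIntegral.integral_interval_sub_left
        (integrable_const (1 : ℝ)).intervalIntegrable (integrable_const (1 : ℝ)).intervalIntegrable,
        intervalIntegral.integral_of_le hxy]
      simp
    rw [hw, ← hIoc x hx y hy hxy]
    refine ⟨(Real.norm_eq_abs _).ge.trans (VectorMeasure.norm_measure_le_variation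
      (measure_ne_top _ _)), fun C hC => ?_⟩
    have hsplit : stieltjesIntegral T f g y - stieltjesIntegral T f g x =
        VectorMeasure.integral (M.restrict (Ioc x y)) f (ContinuousLinearMap.lsmul ℝ ℝ) := by
      rw [hval, hval, ← Ioc_union_Ioc_eq_Ioc hx.1 hxy, VectorMeasure.setIntegral_union
        (Ioc_disjoint_Ioc_of_le le_rfl) measurableSet_Ioc measurableSet_Ioc (hint' 0 h0T x hx)
        (hint' x hx y hy), add_sub_cancel_left]
    have hconst : VectorMeasure.integral (M.restrict (Ioc x y)) (fun _ => f x)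
        (ContinuousLinearMap.lsmul ℝ ℝ) = f x * M (Ioc x y) := by
      rw [VectorMeasure.setIntegral_const]
      rfl
    have hcint : (M.restrict (Ioc x y)).Integrable fun _ => f x := by
      have : IsFiniteMeasure (M.restrict (Ioc x y)).variation := by
        rw [VectorMeasure.variation_restrict measurableSet_Ioc]
        infer_instance
      exact integrable_const _
    rw [hsplit, ← hconst, ← VectorMeasure.integral_fun_sub (hint' x hx y hy) hcint]
    -- On an empty interval the hypothesis on `C` is vacuous and `C` may be negative.
    have hC' : 0 ≤ C ∨ Ioc x y = ∅ := by
      rcases (Ioc x y).eq_empty_or_nonempty with h | ⟨r, hr⟩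
      · exact Or.inr h
      · exact Or.inl ((abs_nonneg _).trans (hC r hr))
    rcases hC' with hC' | hC'
    · refine (Real.norm_eq_abs _).ge.trans ((VectorMeasure.norm_setIntegral_le_of_norm_le_const
        (f := fun r => f r - f x) fun r hr => (Real.norm_eq_abs _).le.trans (hC r hr)).trans ?_)
      refine mul_le_mul_of_nonneg_right ?_ measureReal_nonneg
      exact mul_le_of_le_one_right hC' ContinuousLinearMap.opNorm_lsmul_le
    · rw [hC']
      simp

/-- Existence of a clock that also dominates a given continuous increasing function. -/
theorem exists_isClock {m : ℕ} {T : ℝ} {W : Set (E m)} {A : ℝ → E m}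
    (hA : IsCBVPath T W A) {w : ℝ → ℝ} (hw : ContinuousOn w (Icc 0 T))
    (hmono : MonotoneOn w (Icc 0 T)) : ∃ v z : ℝ → ℝ, IsClock T A v z ∧
      ∀ x ∈ Icc 0 T, ∀ y ∈ Icc 0 T, x ≤ y → w y - w x ≤ z y - z x := by
  have hlbv := hA.bv.locallyBoundedVariationOn
  set v := variationOnFromTo A (Icc 0 T) 0 with hv
  have hle : ∀ x ∈ Icc 0 T, ∀ y ∈ Icc 0 T, x ≤ y → ‖A y - A x‖ ≤ v y - v x := by
    intro x hx y hy hxy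
    have h0 : (0 : ℝ) ∈ Icc 0 T := ⟨le_rfl, hx.1.trans hx.2⟩
    rw [hv, variationOnFromTo.sub_right hlbv h0 hy hx, variationOnFromTo.eq_of_le _ _ hxy,
      ← dist_eq_norm, dist_edist, edist_comm]
    refine ENNReal.toReal_mono (hlbv x y hx hy) ?_
    exact eVariationOn.edist_le _ ⟨hx, le_rfl, hxy⟩ ⟨hy, hxy, le_rfl⟩
  -- The one-sided jumps of the variation function are the sizes of the one-sided jumps of `A`,
  -- hence zero.
  have hcont : ContinuousOn v (Icc 0 T) := by
    intro b hb
    have h0 : (0 : ℝ) ∈ Icc 0 T := ⟨le_rfl, hb.1.trans hb.2⟩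
    have hl := variationOnFromTo.tendsto_left h0 hb hlbv ((hA.cont b hb).mono inter_subset_left)
    have hr := variationOnFromTo.tendsto_right h0 hb hlbv ((hA.cont b hb).mono inter_subset_left)
    rw [dist_self, sub_zero] at hl
    rw [dist_self, add_zero] at hr
    have hun : Icc 0 T ⊆ insert b (Icc 0 T ∩ Iio b ∪ Icc 0 T ∩ Ioi b) := by
      intro x hx
      rcases lt_trichotomy x b with h | h | h
      · exact Or.inr (Or.inl ⟨hx, h⟩)
      · exact Or.inl h
      · exact Or.inr (Or.inr ⟨hx, h⟩)
    refine ContinuousWithinAt.mono (continuousWithinAt_insert_self.2 ?_) hun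
    exact ContinuousWithinAt.union hl hr
  refine ⟨v, fun t => t + (m + 1) * v t + w t, ⟨?_, hle, ?_⟩, ?_⟩
  · exact (continuousOn_id.add (continuousOn_const.mul hcont)).add hw
  · intro x hx y hy hxy
    linarith [hmono hx hy hxy]
  · intro x hx y hy hxy
    have h1 := (norm_nonneg _).trans (hle x hx y hy hxy)
    have h2 : 0 ≤ ((m : ℝ) + 1) * (v y - v x) := by positivity
    linarith

/-! ### Exponentials of Lebesgue-Stieltjes integrals -/

theorem continuousOn_of_abs_sub_le {T C : ℝ} {h w : ℝ → ℝ} (hw : ContinuousOn w (Icc 0 T))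
    (hle : ∀ x ∈ Icc 0 T, ∀ y ∈ Icc 0 T, x ≤ y → |h y - h x| ≤ C * (w y - w x)) :
    ContinuousOn h (Icc 0 T) := by
  have hle' : ∀ x ∈ Icc 0 T, ∀ y ∈ Icc 0 T, |h y - h x| ≤ |C * (w y - w x)| := by
    intro x hx y hy
    rcases le_total x y with hxy | hxy
    · exact (hle x hx y hy hxy).trans (le_abs_self _)
    · rw [abs_sub_comm, show C * (w y - w x) = -(C * (w x - w y)) by ring, abs_neg]
      exact (hle y hy x hx hxy).trans (le_abs_self _)
  intro x hx
  rw [ContinuousWithinAt, tendsto_iff_dist_tendsto_zero]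
  have hlim : Tendsto (fun y => |C * (w y - w x)|) (𝓝[Icc 0 T] x) (𝓝 0) := by
    have := (((hw x hx).sub_const (w x)).const_mul C).abs
    simpa [ContinuousWithinAt] using this
  refine squeeze_zero' (Eventually.of_forall fun _ => dist_nonneg) ?_ hlim
  filter_upwards [self_mem_nhdsWithin] with y hy
  rw [Real.dist_eq]
  exact hle' x hx y hy

theorem exists_abs_le_of_continuousOn {T : ℝ} {h : ℝ → ℝ} (hh : ContinuousOn h (Icc 0 T)) :
    ∃ C > 0, ∀ x ∈ Icc 0 T, |h x| ≤ C := by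
  obtain ⟨C, hC⟩ := isCompact_Icc.exists_bound_of_continuousOn hh
  exact ⟨max C 1, lt_max_of_lt_right one_pos, fun x hx => (hC x hx).trans (le_max_left _ _)⟩

/-- The exponential `K` of the Lebesgue-Stieltjes integral of `1 / γ` with respect to `g`
satisfies `γ dK = K dg`. -/
theorem exists_exp_stieltjes_control {T : ℝ} (hT : 0 ≤ T) {γ g : ℝ → ℝ}
    (hγ : ContinuousOn γ (Icc 0 T)) (hpos : ∀ t ∈ Icc 0 T, 0 < γ t)
    (hg : ContinuousOn g (Icc 0 T)) (hbv : BoundedVariationOn g (Icc 0 T)) {K : ℝ → ℝ}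
    (hK : ∀ t, K t = Real.exp (stieltjesIntegral T (fun s => 1 / γ s) g t)) :
    StieltjesIntegrable T (fun s => 1 / γ s) g ∧ K 0 = 1 ∧ ContinuousOn K (Icc 0 T) ∧
    ∃ w : ℝ → ℝ, ContinuousOn w (Icc 0 T) ∧ MonotoneOn w (Icc 0 T) ∧
      (∀ x ∈ Icc 0 T, ∀ y ∈ Icc 0 T, x ≤ y → |g y - g x| ≤ w y - w x) ∧
      (∃ C, 0 ≤ C ∧ ∀ x ∈ Icc 0 T, ∀ y ∈ Icc 0 T, x ≤ y → |K y - K x| ≤ C * (w y - w x)) ∧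
      ∀ ε > 0, ∃ δ > 0, ∀ x ∈ Icc 0 T, ∀ y ∈ Icc 0 T, x ≤ y → y - x < δ →
        |γ x * (K y - K x) - K x * (g y - g x)| ≤ ε * (w y - w x) := by
  have hf : ContinuousOn (fun s => 1 / γ s) (Icc 0 T) :=
    continuousOn_const.div hγ fun t ht => (hpos t ht).ne'
  obtain ⟨hint, h0, w, hw, hctl⟩ := exists_stieltjes_control hT hf hg hbv
  set H := stieltjesIntegral T (fun s => 1 / γ s) g with hH
  have hwmono : MonotoneOn w (Icc 0 T) := fun x hx y hy hxy =>
    sub_nonneg.1 ((abs_nonneg _).trans (hctl x hx y hy hxy).1)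
  obtain ⟨F₀, hF₀, hfb⟩ := exists_abs_le_of_continuousOn hf
  have hHle : ∀ x ∈ Icc 0 T, ∀ y ∈ Icc 0 T, x ≤ y → |H y - H x| ≤ 3 * F₀ * (w y - w x) := by
    intro x hx y hy hxy
    obtain ⟨h1, h2⟩ := hctl x hx y hy hxy
    have h3 := h2 (2 * F₀) fun r hr => by
      have hb := hfb r ⟨hx.1.trans hr.1.le, hr.2.trans hy.2⟩
      exact (abs_sub _ _).trans (by linarith [hfb x hx])
    have h4 : |1 / γ x * (g y - g x)| ≤ F₀ * (w y - w x) := by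
      rw [abs_mul]
      exact mul_le_mul (hfb x hx) h1 (abs_nonneg _) hF₀.le
    have h5 := abs_add_le (H y - H x - 1 / γ x * (g y - g x)) (1 / γ x * (g y - g x))
    rw [sub_add_cancel] at h5
    linarith
  have hHc : ContinuousOn H (Icc 0 T) := continuousOn_of_abs_sub_le hw.continuousOn hHle
  have hKc : ContinuousOn K (Icc 0 T) := by
    rw [funext hK]
    exact hHc.rexp
  obtain ⟨K₀, hK₀, hKb⟩ := exists_abs_le_of_continuousOn hKc
  obtain ⟨G₀, hG₀, hGb⟩ := exists_abs_le_of_continuousOn hγ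
  have hKpos : ∀ t, 0 < K t := fun t => by rw [hK]; exact Real.exp_pos _
  have hKsub : ∀ x y, K y = K x * Real.exp (H y - H x) := fun x y => by
    rw [hK, hK, ← Real.exp_add, add_sub_cancel]
  refine ⟨hint, by rw [hK, h0, Real.exp_zero], hKc, w, hw.continuousOn, hwmono,
    fun x hx y hy hxy => (hctl x hx y hy hxy).1, ⟨K₀ * (3 * F₀), by positivity, ?_⟩, ?_⟩
  · intro x hx y hy hxy
    -- Convexity of the exponential bounds increments of `K` by those of `H`, with the bound `K₀` of
    -- `K` as constant.
    have hexp : ∀ a b : ℝ, Real.exp a - Real.exp b ≤ Real.exp a * (a - b) := fun a b => by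
      have h1 := Real.add_one_le_exp (b - a)
      have h2 : Real.exp b = Real.exp a * Real.exp (b - a) := by rw [← Real.exp_add]; ring_nf
      rw [h2]
      nlinarith [Real.exp_pos a]
    have hKle : ∀ x ∈ Icc 0 T, ∀ y ∈ Icc 0 T, K y - K x ≤ K₀ * |H y - H x| := fun x hx y hy => by
      have h1 := hexp (H y) (H x)
      rw [← hK, ← hK] at h1
      refine h1.trans ((mul_le_mul_of_nonneg_left (le_abs_self _) (hKpos y).le).trans ?_)
      exact mul_le_mul_of_nonneg_right ((le_abs_self _).trans (hKb y hy)) (abs_nonneg _)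
    rw [mul_assoc]
    refine le_trans ?_ (mul_le_mul_of_nonneg_left (hHle x hx y hy hxy) hK₀.le)
    rw [abs_sub_le_iff]
    refine ⟨hKle x hx y hy, ?_⟩
    rw [abs_sub_comm]
    exact hKle y hy x hx
  · intro ε hε
    set ε₁ := min 1 (ε / (G₀ * K₀ * (3 * F₀ + 1))) with hε₁
    have hε₁0 : 0 < ε₁ := lt_min one_pos (by positivity)
    obtain ⟨δ₁, hδ₁, huH⟩ := Metric.uniformContinuousOn_iff.1
      (isCompact_Icc.uniformContinuousOn_of_continuous hHc) _ hε₁0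
    obtain ⟨δ₂, hδ₂, huf⟩ := Metric.uniformContinuousOn_iff.1
      (isCompact_Icc.uniformContinuousOn_of_continuous hf) _ hε₁0
    refine ⟨min δ₁ δ₂, lt_min hδ₁ hδ₂, fun x hx y hy hxy hd => ?_⟩
    have hw0 : 0 ≤ w y - w x := sub_nonneg.2 (hwmono hx hy hxy)
    have hHs : |H y - H x| ≤ ε₁ := by
      rw [← Real.dist_eq]
      refine (huH y hy x hx ?_).le
      rw [Real.dist_eq, abs_of_nonneg (sub_nonneg.2 hxy)]
      exact hd.trans_le (min_le_left _ _)
    have h1 : |H y - H x - 1 / γ x * (g y - g x)| ≤ ε₁ * (w y - w x) := by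
      refine (hctl x hx y hy hxy).2 ε₁ fun r hr => ?_
      rw [← Real.dist_eq]
      refine (huf r ⟨hx.1.trans hr.1.le, hr.2.trans hy.2⟩ x hx ?_).le
      rw [Real.dist_eq, abs_of_nonneg (sub_nonneg.2 hr.1.le)]
      linarith [hr.2, hd.trans_le (min_le_right δ₁ δ₂)]
    have h2 : |Real.exp (H y - H x) - 1 - (H y - H x)| ≤ ε₁ * (3 * F₀ * (w y - w x)) := by
      refine (Real.abs_exp_sub_one_sub_id_le (hHs.trans (min_le_left _ _))).trans ?_
      rw [← sq_abs, sq]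
      exact mul_le_mul hHs (hHle x hx y hy hxy) (abs_nonneg _) hε₁0.le
    -- The defect is `γ K` times the second order error of the exponential plus the error of
    -- freezing `1 / γ` at `x`. The first is at most `ε₁ |H y - H x|`, the second at most `ε₁ (w y -
    -- w x)`.
    have h3 : γ x * (K y - K x) - K x * (g y - g x) = γ x * K x *
        ((Real.exp (H y - H x) - 1 - (H y - H x)) + (H y - H x - 1 / γ x * (g y - g x))) := by
      have := (hpos x hx).ne'
      rw [hKsub x y]
      field_simp
      ring
    have h4 : |γ x * K x| ≤ G₀ * K₀ := by
      rw [abs_mul]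
      exact mul_le_mul (hGb x hx) (hKb x hx) (abs_nonneg _) hG₀.le
    have h5 : ε₁ * (G₀ * K₀ * (3 * F₀ + 1)) ≤ ε :=
      (le_div_iff₀ (by positivity)).1 (min_le_right _ _)
    rw [h3, abs_mul]
    calc _ ≤ G₀ * K₀ * (ε₁ * (3 * F₀ * (w y - w x)) + ε₁ * (w y - w x)) :=
          mul_le_mul h4 ((abs_add_le _ _).trans (add_le_add h2 h1)) (abs_nonneg _) (by positivity)
      _ = ε₁ * (G₀ * K₀ * (3 * F₀ + 1)) * (w y - w x) := by ring
      _ ≤ ε * (w y - w x) := mul_le_mul_of_nonneg_right h5 hw0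

/-! ### Pathwise Itô integrals of the vertical derivatives -/

section Ito

variable {d m : ℕ} {T : ℝ} {P : ℕ → Finset ℝ} {U : Set (E d)} {W : Set (E m)} {X : ℝ → E d}
  {A : ℝ → E m} {G : Functional d m} {v z : ℝ → ℝ}

theorem ContinuousFunctional.continuousOn_path (hG : ContinuousFunctional T U W G)
    (hX : ContinuousOn X (Icc 0 T)) (hXU : ∀ u ∈ Icc 0 T, X u ∈ U) (hA : IsCBVPath T W A) :
    ContinuousOn (fun t => G t X A) (Icc 0 T) := by
  have hmin : ∀ {r w : ℝ}, w ∈ Icc 0 T → r ∈ Icc 0 T → min r w ∈ Icc 0 T := fun hw hr =>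
    ⟨le_min hr.1 hw.1, (min_le_left _ _).trans hr.2⟩
  have hXc : IsCadlag T U X := .of_continuousOn hX hXU
  intro u hu
  rw [Metric.continuousWithinAt_iff]
  intro ε hε
  obtain ⟨η, hη, hclose⟩ := hG.exists_close hu hXc hA.isBVPath (half_pos hε)
  obtain ⟨δ₁, hδ₁, hucX⟩ := Metric.uniformContinuousOn_iff.1
    (isCompact_Icc.uniformContinuousOn_of_continuous hX) _ hη
  obtain ⟨δ₂, hδ₂, hucA⟩ := Metric.uniformContinuousOn_iff.1
    (isCompact_Icc.uniformContinuousOn_of_continuous hA.cont) _ hη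
  refine ⟨min η (min δ₁ δ₂), lt_min hη (lt_min hδ₁ hδ₂), fun {s} hsT hsu => ?_⟩
  have hdist : ∀ r : ℝ, dist (min r u) (min r s) < min η (min δ₁ δ₂) := fun r => by
    refine lt_of_le_of_lt ?_ hsu
    rw [dist_comm s u, Real.dist_eq, Real.dist_eq]
    refine (abs_min_sub_min_le_max r u r s).trans ?_
    rw [sub_self, abs_zero]
    exact max_le (abs_nonneg _) le_rfl
  rw [dist_comm, Real.dist_eq]
  refine (hclose s hsT ?_ X A hXc hA.isBVPath (fun r hr => ?_) fun r hr => ?_).trans_lt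
    (half_lt_self hε)
  · rw [← Real.dist_eq, dist_comm]
    exact hsu.le.trans (min_le_left _ _)
  · rw [stopAt_apply X hu.1 hr.1, stopAt_apply X hsT.1 hr.1, ← dist_eq_norm]
    exact (hucX _ (hmin hu hr) _ (hmin hsT hr) ((hdist r).trans_le
      ((min_le_right _ _).trans (min_le_left _ _)))).le
  · rw [stopAt_apply A hu.1 hr.1, stopAt_apply A hsT.1 hr.1, ← dist_eq_norm]
    exact (hucA _ (hmin hu hr) _ (hmin hsT hr) ((hdist r).trans_le
      ((min_le_right _ _).trans (min_le_right _ _)))).le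

/-- The successor of `t` is a partition point, where the step path value is uniformly close to `G`
along `X`; continuity in time does the rest. -/
theorem tendsto_gridValue_succIn (hP : IsRefiningSeq T P) (hG : ContinuousFunctional T U W G)
    (hX : ContinuousOn X (Icc 0 T)) (hXU : ∀ u ∈ Icc 0 T, X u ∈ U) (hA : IsCBVPath T W A) {t : ℝ}
    (ht : t ∈ Icc 0 T) :
    Tendsto (fun n => gridValue (P n) G X A (succIn (P n) t)) atTop (𝓝 (G t X A)) := by
  have h1 : Tendsto (fun n => G (succIn (P n) t) X A) atTop (𝓝 (G t X A)) :=
    ((hG.continuousOn_path hX hXU hA) t ht).tendsto.comp (hP.tendsto_succIn ht)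
  have h2 : Tendsto (fun n => gridValue (P n) G X A (succIn (P n) t) - G (succIn (P n) t) X A)
      atTop (𝓝 0) := by
    rw [Metric.tendsto_nhds]
    intro ε hε
    filter_upwards [gridValue_close hP hG hX hXU hA (half_pos hε)] with n hn
    obtain ⟨s, hs, -, -, heq⟩ := hP.exists_pred n ht
    rw [Real.dist_eq, sub_zero]
    exact (hn _ (heq ▸ succIn_mem hs)).trans_lt (half_lt_self hε)
  simpa using h2.add h1

theorem gridValue_zero (hP : IsRefiningSeq T P) (hG : NonAnticipative T U W G)
    (hX : ContinuousOn X (Icc 0 T)) (hXU : ∀ u ∈ Icc 0 T, X u ∈ U) (hA : IsCBVPath T W A)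
    (n : ℕ) : gridValue (P n) G X A 0 = G 0 X A := by
  have h0 : (0 : ℝ) ∈ Icc 0 T := ⟨le_rfl, hP.nonneg⟩
  refine hG.congr h0 (isCadlag_stepBefore hP n hXU h0) (.of_continuousOn hX hXU) hA.isBVPath
    hA.isBVPath (fun u hu => ?_) fun _ _ => rfl
  rw [stepBefore_of_ge hu.1, le_antisymm hu.2 hu.1]

theorem itoSum_vgrad (Q : Finset ℝ) (G : Functional d m) (X : ℝ → E d) (A : ℝ → E m) (t : ℝ) :
    itoSum Q (vgrad G) X A t =
      psum Q (fun s => gridValue Q G X A (succIn Q s) - gridValue Q G X A s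
        - remainder Q G X A s) t := by
  refine Finset.sum_congr rfl fun s _ => ?_
  simp only [remainder, sub_sub_cancel, vgrad]

/-- The integral of the vertical gradient exists, and the sums of the remainders converge to
minus the process `Γ`. -/
theorem hasItoIntegral_vgrad (hP : IsRefiningSeq T P) (hU : IsOpen U) (hW : IsOpen W)
    (hG : IsC12 T U W G) (hX : ContinuousOn X (Icc 0 T)) (hXU : ∀ u ∈ Icc 0 T, X u ∈ U)
    (hcov : HasContinuousCovariations T P X)
    (hA : IsCBVPath T W A) (hz : IsClock T A v z) {t : ℝ} (ht : t ∈ Icc 0 T) :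
    HasItoIntegral P (vgrad G) X A t (itoIntegral P (vgrad G) X A t) ∧
    Tendsto (fun n => psum (P n) (remainder (P n) G X A) t) atTop (𝓝 (-Gam P G X A t)) := by
  obtain ⟨R, hR⟩ := exists_tendsto_psum_remainder hP hU hW hG hX hXU hcov hA hz ht
  -- The Itô sum is a telescoping sum of grid values minus the sum of remainders, and both converge.
  have hI : HasItoIntegral P (vgrad G) X A t (G t X A - G 0 X A - R) := by
    refine (((tendsto_gridValue_succIn hP hG.continuous hX hXU hA ht).sub_const
      (G 0 X A)).sub hR).congr fun n => ?_
    rw [itoSum_vgrad, psum_sub, hP.psum_telescope n (gridValue (P n) G X A) ht,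
      gridValue_zero hP hG.nonAnticipative hX hXU hA]
  have hlim : itoIntegral P (vgrad G) X A t = G t X A - G 0 X A - R := hI.limUnder_eq
  rw [hlim]
  refine ⟨hI, ?_⟩
  rw [Gam, hlim]
  convert hR using 2
  ring

/-- The remainders sum to `-Γ(t)` in the limit, and the increments of the continuous function `Γ`
telescope to `Γ(t) - Γ(0)`. -/
theorem tendsto_psum_remainder_add (hP : IsRefiningSeq T P) (hU : IsOpen U) (hW : IsOpen W)
    (hG : IsRegular T U W P G X A) (hX : ContinuousOn X (Icc 0 T)) (hXU : ∀ u ∈ Icc 0 T, X u ∈ U)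
    (hcov : HasContinuousCovariations T P X)
    (hA : IsCBVPath T W A) (hz : IsClock T A v z) {t : ℝ} (ht : t ∈ Icc 0 T) :
    Tendsto (fun n => psum (P n) (fun s => remainder (P n) G X A s +
      (Gam P G X A (succIn (P n) s) - Gam P G X A s)) t) atTop (𝓝 0) := by
  have h0T : (0 : ℝ) ∈ Icc 0 T := ⟨le_rfl, hP.nonneg⟩
  obtain ⟨c, hc⟩ := exists_isWeight hP hX hcov hz.cont hz.monotoneOn
  obtain ⟨B, hB, hrem⟩ := exists_abs_remainder_le hP hU hW hG.c12 hX hXU hA hz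
  -- This is not immediate from the definition, because the Itô sums at time `0` contain the term `s
  -- = 0`.
  have hΓ0 : Gam P G X A 0 = 0 := by
    have h1 := (hasItoIntegral_vgrad hP hU hW hG.c12 hX hXU hcov hA hz h0T).2
    have h2 : Tendsto (fun n => psum (P n) (remainder (P n) G X A) 0) atTop (𝓝 0) := by
      rw [Metric.tendsto_nhds]
      intro ε hε
      filter_upwards [hc.psum_zero_small hP hB hrem (half_pos hε)] with n hn
      rw [Real.dist_eq, sub_zero]
      exact hn.trans_lt (half_lt_self hε)
    linarith [tendsto_nhds_unique h1 h2]
  have h1 := (hasItoIntegral_vgrad hP hU hW hG.c12 hX hXU hcov hA hz ht).2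
  have h2 : Tendsto (fun n => Gam P G X A (succIn (P n) t)) atTop (𝓝 (Gam P G X A t)) :=
    (hG.cont t ht).tendsto.comp (hP.tendsto_succIn ht)
  have h3 := h1.add h2
  rw [neg_add_cancel] at h3
  refine h3.congr fun n => ?_
  rw [psum_add, hP.psum_telescope n (Gam P G X A) ht, hΓ0, sub_zero]

/-- Sums of small multiples of increments of a function dominated by those of `z` vanish. -/
theorem tendsto_psum_of_abs_le (hP : IsRefiningSeq T P) (hmono : MonotoneOn z (Icc 0 T)) {C : ℝ}
    (hC : 0 ≤ C) {a : ℕ → ℝ → ℝ}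
    (ha : ∀ ε > 0, ∀ᶠ n in atTop, ∀ s ∈ P n, |a n s| ≤ ε * (C * (z (succIn (P n) s) - z s)))
    {t : ℝ} (ht : t ∈ Icc 0 T) : Tendsto (fun n => psum (P n) (a n) t) atTop (𝓝 0) := by
  have h0T : (0 : ℝ) ∈ Icc 0 T := ⟨le_rfl, hP.nonneg⟩
  have hTT : T ∈ Icc 0 T := ⟨hP.nonneg, le_rfl⟩
  have hD : 0 ≤ C * (z T - z 0) := mul_nonneg hC (sub_nonneg.2 (hmono h0T hTT hP.nonneg))
  rw [Metric.tendsto_nhds]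
  intro ε hε
  have hε₁ : 0 < ε / (C * (z T - z 0) + 1) := by positivity
  filter_upwards [ha _ hε₁] with n hn
  rw [Real.dist_eq, sub_zero]
  refine (abs_psum_le hn).trans_lt ?_
  rw [psum_mul_left, psum_mul_left, hP.psum_telescope n z ht, div_mul_eq_mul_div,
    div_lt_iff₀ (by positivity)]
  have hle : C * (z (succIn (P n) t) - z 0) ≤ C * (z T - z 0) := by
    have hs := hP.succIn_mem_Icc n ht
    exact mul_le_mul_of_nonneg_left (sub_le_sub_right (hmono hs hTT hs.2) _) hC
  nlinarith

/-- The integral of `∂G` times the exponential of `∫ dΓ / G`. -/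
theorem hasItoIntegral_eta (hP : IsRefiningSeq T P) (hU : IsOpen U) (hW : IsOpen W)
    (hG : IsRegular T U W P G X A) (hX : ContinuousOn X (Icc 0 T)) (hXU : ∀ u ∈ Icc 0 T, X u ∈ U)
    (hcov : HasContinuousCovariations T P X) (hA : IsCBVPath T W A)
    (hpos : ∀ t ∈ Icc 0 T, 0 < G t X A) :
    StieltjesIntegrable T (fun t => 1 / G t X A) (Gam P G X A) ∧ expGam T P G X A 0 = 1 ∧
    ∀ t ∈ Icc 0 T, HasItoIntegral P (eta T P G X A) X A t
      (G t X A * expGam T P G X A t - G 0 X A) := by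
  have hγ := hG.c12.continuous.continuousOn_path hX hXU hA
  obtain ⟨hint, hK0, hKc, w, hw, hwmono, hΓw, ⟨C, hC, hKw⟩, hctl⟩ :=
    exists_exp_stieltjes_control (K := expGam T P G X A) hP.nonneg hγ hpos hG.cont hG.bv
      fun t => rfl
  refine ⟨hint, hK0, fun t ht => ?_⟩
  set K := expGam T P G X A with hK
  set Γ := Gam P G X A with hΓ
  obtain ⟨v, z, hz, hwz⟩ := exists_isClock hA hw hwmono
  have hzmono := hz.monotoneOn
  obtain ⟨c, hc⟩ := exists_isWeight hP hX hcov hz.cont hzmono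
  obtain ⟨B, hB, hrem⟩ := exists_abs_remainder_le hP hU hW hG.c12 hX hXU hA hz
  obtain ⟨K₀, hK₀, hKb⟩ := exists_abs_le_of_continuousOn hKc
  have hmem : ∀ {n s}, s ∈ P n → s ∈ Icc 0 T ∧ succIn (P n) s ∈ Icc 0 T := fun {n s} hs =>
    ⟨hP.subset n s hs, hP.subset n _ (succIn_mem hs)⟩
  have hzle : ∀ {n s}, s ∈ P n → w (succIn (P n) s) - w s ≤ z (succIn (P n) s) - z s :=
    fun {n s} hs => hwz s (hmem hs).1 _ (hmem hs).2 (le_succIn _ _)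
  have hb : ∀ᶠ n in atTop, ∀ s ∈ P n,
      |remainder (P n) G X A s + (Γ (succIn (P n) s) - Γ s)| ≤
        (B + 1) * gridWeight (P n) X z s := by
    filter_upwards [hrem] with n hn s hs
    have h1 := (hΓw s (hmem hs).1 _ (hmem hs).2 (le_succIn _ _)).trans
      ((hzle hs).trans (sub_le_gridWeight (P n) X z s))
    have h2 := (abs_add_le _ _).trans (add_le_add (hn s hs) h1)
    linarith
  have hle : ∀ n, ∀ s ∈ P n, (B + 1) * gridWeight (P n) X z s ≤
      ((B + 1) * (K₀ + 1)) * gridWeight (P n) X z s := fun n s hs => by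
    have := mul_nonneg hB (hc.nonneg n s hs)
    nlinarith [hc.nonneg n s hs]
  -- Near `u` the factor `K s` is close to `K u`, so the summands are locally a multiple of summands
  -- whose sums vanish by `tendsto_psum_remainder_add`.
  have h4 : Tendsto (fun n => psum (P n) (fun s => K s *
      (remainder (P n) G X A s + (Γ (succIn (P n) s) - Γ s))) t) atTop (𝓝 0) := by
    refine hc.tendsto_psum_zero (Λ := Unit) (B := (B + 1) * (K₀ + 1)) hP (by positivity) ?_
      (fun _ => ?_) ?_
      (fun _ t ht => tendsto_psum_remainder_add hP hU hW hG hX hXU hcov hA hz ht) ht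
    · filter_upwards [hb] with n hn s hs
      rw [abs_mul]
      refine (mul_le_mul (hKb s (hmem hs).1) (hn s hs) (abs_nonneg _) hK₀.le).trans ?_
      have := mul_nonneg (show 0 ≤ B + 1 by linarith) (hc.nonneg n s hs)
      linarith
    · filter_upwards [hb] with n hn s hs
      exact (hn s hs).trans (hle n s hs)
    · intro u hu ε hε
      have huT : u ∈ Icc 0 T := ⟨hu.1.le, hu.2⟩
      have hε₁ : 0 < ε / (B + 1) := by positivity
      obtain ⟨δ, hδ, huc⟩ := Metric.continuousWithinAt_iff.1 (hKc u huT) _ hε₁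
      refine ⟨δ, hδ, fun _ => K u, ?_⟩
      filter_upwards [hb] with n hn s hs hsu hs'u
      rw [Fintype.sum_unique, ← sub_mul, abs_mul]
      have hd : |K s - K u| ≤ ε / (B + 1) := by
        rw [← Real.dist_eq]
        refine (huc (hmem hs).1 ?_).le
        rw [dist_comm, Real.dist_eq, abs_of_nonneg]
        · linarith
        · linarith [le_succIn (P n) s]
      refine (mul_le_mul hd (hn s hs) (abs_nonneg _) hε₁.le).trans (le_of_eq ?_)
      rw [← mul_assoc, div_mul_cancel₀ _ (by positivity)]
  -- The discrete form of `G dK = K dΓ`.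
  have h3 : Tendsto (fun n => psum (P n) (fun s => G s X A * (K (succIn (P n) s) - K s)
      - K s * (Γ (succIn (P n) s) - Γ s)) t) atTop (𝓝 0) := by
    refine tendsto_psum_of_abs_le (C := 1) hP hzmono zero_le_one (fun ε hε => ?_) ht
    obtain ⟨δ, hδ, h⟩ := hctl ε hε
    filter_upwards [hP.mesh δ hδ] with n hn s hs
    refine (h s (hmem hs).1 _ (hmem hs).2 (le_succIn _ _) (hn s hs)).trans ?_
    rw [one_mul]
    exact mul_le_mul_of_nonneg_left (hzle hs) hε.le
  -- In the product rule `G` is evaluated at `s'` along the step path; replacing it by `G s X A`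
  -- costs a uniformly small factor times increments of `K`.
  have h2 : Tendsto (fun n => psum (P n) (fun s => (gridValue (P n) G X A (succIn (P n) s)
      - G s X A) * (K (succIn (P n) s) - K s)) t) atTop (𝓝 0) := by
    refine tendsto_psum_of_abs_le (C := C) hP hzmono hC (fun ε hε => ?_) ht
    filter_upwards [gridValue_close hP hG.c12.continuous hX hXU hA (half_pos hε),
      hP.norm_sub_succIn_le hγ (half_pos hε)] with n hn hn' s hs
    rw [abs_mul]
    refine mul_le_mul ?_ ((hKw s (hmem hs).1 _ (hmem hs).2 (le_succIn _ _)).trans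
      (mul_le_mul_of_nonneg_left (hzle hs) hC)) (abs_nonneg _) hε.le
    have h5 := hn _ (succIn_mem hs)
    have h6 := hn' s (hmem hs).1 _ ⟨le_succIn _ _, le_rfl⟩ s ⟨le_rfl, le_succIn _ _⟩
    rw [Real.norm_eq_abs] at h6
    have h7 := (abs_add_le _ _).trans (add_le_add h5 h6)
    rw [sub_add_sub_cancel, add_halves] at h7
    exact h7
  have h1 : Tendsto (fun n => K (succIn (P n) t) * gridValue (P n) G X A (succIn (P n) t)
      - G 0 X A) atTop (𝓝 (G t X A * K t - G 0 X A)) := by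
    rw [mul_comm (G t X A)]
    exact (((hKc t ht).tendsto.comp (hP.tendsto_succIn ht)).mul
      (tendsto_gridValue_succIn hP hG.c12.continuous hX hXU hA ht)).sub_const _
  -- Product rule, with `g` the grid value, `R` the remainder and `Δ` the increment from `s` to
  -- `s'`: `K(s) (Δg - R) = Δ(K g) - (g(s') - G(s)) ΔK - (G(s) ΔK - K(s) ΔΓ) - K(s) (R + ΔΓ)`.
  have hsum := ((h1.sub h2).sub h3).sub h4
  simp only [sub_zero] at hsum
  refine hsum.congr fun n => ?_
  have htel := hP.psum_telescope n (fun s => K s * gridValue (P n) G X A s) ht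
  simp only [hK0, one_mul] at htel
  rw [gridValue_zero hP hG.c12.nonAnticipative hX hXU hA] at htel
  rw [← htel, ← psum_sub, ← psum_sub, ← psum_sub]
  refine Finset.sum_congr rfl fun s _ => ?_
  have hi : ∑ i, eta T P G X A s (stepBefore (P n) X s) A i * (X (succIn (P n) s) i - X s i) =
      K s * ∑ i, vderiv i G s (stepBefore (P n) X s) A * (X (succIn (P n) s) i - X s i) := by
    rw [Finset.mul_sum]
    refine Finset.sum_congr rfl fun i _ => ?_
    rw [eta]
    ring
  rw [hi]
  simp only [remainder]
  ring

end Ito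

/-! ### The main result -/

section Market

variable {d : ℕ} {T : ℝ} {S : ℝ → E d}

theorem IsCapitalization.continuousOn_marketWeights (hS : IsCapitalization T S) :
    ContinuousOn (marketWeights S) (Icc 0 T) := by
  have hSi : ∀ i, ContinuousOn (fun t => S t i) (Icc 0 T) := fun i =>
    (EuclideanSpace.proj i : E d →L[ℝ] ℝ).continuous.comp_continuousOn hS.cont
  have hpi : ContinuousOn (fun t => fun i => S t i / ∑ j, S t j) (Icc 0 T) :=
    continuousOn_pi.2 fun i => (hSi i).div (continuousOn_finsetSum _ fun j _ => hSi j) hS.total_ne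
  exact (PiLp.continuous_toLp 2 fun _ : Fin d => ℝ).comp_continuousOn hpi

theorem IsCapitalization.sum_marketWeights (hS : IsCapitalization T S) {t : ℝ}
    (ht : t ∈ Icc 0 T) : ∑ i, marketWeights S t i = 1 := by
  change ∑ i, S t i / ∑ j, S t j = 1
  rw [← Finset.sum_div, div_self (hS.total_ne t ht)]

end Market

/-! ### From `η` to the generated strategy `ψ` -/

section Generation

variable {d m : ℕ} {T : ℝ} {P : ℕ → Finset ℝ} {U : Set (E d)} {W : Set (E m)}
  {G : Functional d m} {X : ℝ → E d} {A : ℝ → E m}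

theorem HasItoIntegral.itoIntegral_eq {Θ : Integrand d m} {t I : ℝ}
    (h : HasItoIntegral P Θ X A t I) : itoIntegral P Θ X A t = I :=
  h.limUnder_eq

/-- The exponential and both defects are computed from the fixed pair `(X, A)`; the argument paths
enter only through `∂_i G`. -/
theorem nonAnticipative_psi (hU : IsOpen U) (hG : NonAnticipative T U W G) :
    NonAnticipative T U W (psi T P G X A) := by
  intro t ht Y B hY hB
  funext i
  simp only [psi, eta]
  rw [nonAnticipative_vderiv hU hG i t ht Y B hY hB]

/-- The sums defining the integrals do not change if the same number is subtracted from all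
components of the integrand at a given time, when the components of the integrator sum to one. -/
theorem itoSum_psi (hP : IsRefiningSeq T P) (hX : ∀ t ∈ Icc 0 T, ∑ i, X t i = 1) (n : ℕ) (t : ℝ) :
    itoSum (P n) (psi T P G X A) X A t = itoSum (P n) (eta T P G X A) X A t := by
  refine Finset.sum_congr rfl fun s hs => ?_
  have hs := (Finset.mem_filter.1 hs).1
  have h : ∑ i, (X (succIn (P n) s) i - X s i) = 0 := by
    rw [Finset.sum_sub_distrib, hX _ (hP.subset n _ (succIn_mem hs)), hX _ (hP.subset n _ hs),
      sub_self]
  simp only [psi, sub_sub, sub_mul _ (_ + _)]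
  rw [Finset.sum_sub_distrib, ← Finset.mul_sum, h, mul_zero, sub_zero]

theorem value_psi {t : ℝ} (hX : ∑ i, X t i = 1) :
    value (psi T P G X A) X A t =
      value (eta T P G X A) X A t - defectSF P (eta T P G X A) X A t - defectBalance G X A := by
  simp only [value, psi, sub_sub, sub_mul _ (_ + _)]
  rw [Finset.sum_sub_distrib, ← Finset.mul_sum, hX, mul_one]

end Generation

end PathwiseFG

end

theorem mainTheorem5 {d m : ℕ} (hd : 2 ≤ d) {T : ℝ} (hT : 0 < T)
    {P : ℕ → Finset ℝ} (hP : PathwiseFG.IsRefiningSeq T P)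
    {U : Set (PathwiseFG.E d)} (hU : IsOpen U) {W : Set (PathwiseFG.E m)} (hW : IsOpen W)
    {S μ : ℝ → PathwiseFG.E d} (hS : PathwiseFG.IsCapitalization T S)
    (hμ : μ = PathwiseFG.marketWeights S) (hμU : ∀ t ∈ Set.Icc 0 T, μ t ∈ U)
    (hcov : PathwiseFG.HasContinuousCovariations T P μ)
    {A : ℝ → PathwiseFG.E m} (hA : PathwiseFG.IsCBVPath T W A)
    {G : PathwiseFG.Functional d m}
    (hGpos : ∀ t ∈ Set.Icc 0 T, ∀ X B, PathwiseFG.IsCadlag T U X → PathwiseFG.IsBVPath T W B →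
      0 < G t X B)
    (hG : PathwiseFG.IsRegular T U W P G μ A)
    (hloc : PathwiseFG.LocallyBoundedOn T fun t => 1 / G t μ A) :
    -- the integrals entering the definition of `ψ` exist
    (∀ t ∈ Set.Icc 0 T,
      (∃ I, PathwiseFG.HasItoIntegral P (PathwiseFG.vgrad G) μ A t I) ∧
      ∃ I, PathwiseFG.HasItoIntegral P (PathwiseFG.eta T P G μ A) μ A t I) ∧
    PathwiseFG.StieltjesIntegrable T (fun t => 1 / G t μ A) (PathwiseFG.Gam P G μ A) ∧
    -- `ψ` is a trading strategy
    PathwiseFG.IsTradingStrategy T U W P (PathwiseFG.psi T P G μ A) μ A ∧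
    ∀ t ∈ Set.Icc 0 T,
      -- its value process
      PathwiseFG.value (PathwiseFG.psi T P G μ A) μ A t =
        G t μ A * Real.exp (PathwiseFG.stieltjesIntegral T (fun s => 1 / G s μ A)
          (PathwiseFG.Gam P G μ A) t) ∧
      0 < PathwiseFG.value (PathwiseFG.psi T P G μ A) μ A t ∧
      -- its components
      ∀ i, PathwiseFG.psi T P G μ A t μ A i =
        PathwiseFG.value (PathwiseFG.psi T P G μ A) μ A t *
          (1 + 1 / G t μ A * (PathwiseFG.vderiv i G t μ A
            - ∑ j, μ t j * PathwiseFG.vderiv j G t μ A)) := by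
  open PathwiseFG in
  have hX : ContinuousOn μ (Icc 0 T) := hμ ▸ hS.continuousOn_marketWeights
  have hsum : ∀ t ∈ Icc 0 T, ∑ i, μ t i = 1 := fun t ht => hμ ▸ hS.sum_marketWeights ht
  have hpos : ∀ t ∈ Icc 0 T, 0 < G t μ A := fun t ht =>
    hGpos t ht μ A (.of_continuousOn hX hμU) hA.isBVPath
  have h0 : (0 : ℝ) ∈ Icc 0 T := ⟨le_rfl, hT.le⟩
  obtain ⟨hint, hK0, hη⟩ := hasItoIntegral_eta hP hU hW hG hX hμU hcov hA hpos
  -- As `K(0) = 1`, the value of `η` at time `0` cancels against the sum in `C(0)`, and the two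
  -- terms `G(0)` cancel as well.
  have hQ : ∀ t ∈ Icc 0 T, defectSF P (eta T P G μ A) μ A t + defectBalance G μ A =
      value (eta T P G μ A) μ A t - G t μ A * expGam T P G μ A t := by
    intro t ht
    rw [defectSF, (hη t ht).itoIntegral_eq, defectBalance]
    simp only [value, eta, hK0, mul_one]
    ring
  have hval : ∀ t ∈ Icc 0 T,
      value (psi T P G μ A) μ A t = G t μ A * expGam T P G μ A t := fun t ht => by
    rw [value_psi (hsum t ht), sub_sub, hQ t ht, sub_sub_cancel]
  refine ⟨fun t ht => ⟨?_, _, hη t ht⟩, hint, ⟨nonAnticipative_psi hU hG.c12.nonAnticipative,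
    fun t ht => ?_⟩, fun t ht => ⟨hval t ht, ?_, fun i => ?_⟩⟩
  · obtain ⟨v, z, hz, -⟩ := exists_isClock hA continuousOn_const (monotoneOn_const (c := (0 : ℝ)))
    exact ⟨_, (hasItoIntegral_vgrad hP hU hW hG.c12 hX hμU hcov hA hz ht).1⟩
  · rw [hval t ht, hval 0 h0, hK0, mul_one]
    exact (hη t ht).congr fun n => (itoSum_psi hP hsum n t).symm
  · rw [hval t ht]
    exact mul_pos (hpos t ht) (Real.exp_pos _)
  · have hne := (hpos t ht).ne'
    -- It remains to factor `G K` out of `ψ_i = η_i - V^η + G K`.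
    have hv : value (eta T P G μ A) μ A t =
        (∑ j, μ t j * vderiv j G t μ A) * expGam T P G μ A t := by
      rw [value, Finset.sum_mul]
      refine Finset.sum_congr rfl fun j _ => ?_
      rw [eta]
      ring
    rw [psi, sub_sub, hQ t ht, hval t ht, hv, eta]
    field_simp
    ring
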